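/- Let $d, r \in \mathbb{N}$, let $\lambda > 1$, and set $\mathtt{gap} := \frac{\lambda + \lambda^{-1} - 2}{\lambda + \lambda^{-1}} = \frac{(\lambda-1)^2}{\lambda^2+1} \in (0,1)$. Let $\mathrm{Stief}(d,k)$ be the set of matrices $V \in \mathbb{R}^{d\times k}$ with $V^\top V = I_k$. Let $\mathbf{M} = \mathbf{W} + \lambda \mathbf{U}\mathbf{U}^\top$, where $\mathbf{U}$ is uniform on $\mathrm{Stief}(d,r)$ and $\mathbf{W} \sim \mathrm{GOE}(d)$ is independent of $\mathbf{U}$; that is, $\mathbf{W}$ is symmetric, its entries on and above the diagonal are independent, $\mathbf{W}_{ii} \sim \mathcal{N}(0, 2/d)$, and $\mathbf{W}_{ij} \sim \mathcal{N}(0, 1/d)$ for $i<j$. A randomized adaptive query algorithm chooses, in round $i = 1, \dots, T$, a query $\mathsf{v}^{(i)} \in \mathbb{R}^d$ as a measurable function of a random seed, independent of $(\mathbf{W},\mathbf{U})$, and of the earlier pairs $(\mathsf{v}^{(1)},\mathsf{w}^{(1)}),\dots,(\mathsf{v}^{(i-1)},\mathsf{w}^{(i-1)})$, and receives the response $\mathsf{w}^{(i)}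 = \mathbf{M}\mathsf{v}^{(i)}$. Suppose that its $T$ queries are always orthonormal (so $T \le d$), and for $k \in \{1,\dots,T\}$ let $\mathsf{V}_k = [\mathsf{v}^{(1)} | \cdots | \mathsf{v}^{(k)}] \in \mathrm{Stief}(d,k)$. Write $\lambda_1(A) \ge \lambda_2(A) \ge \cdots$ for the eigenvalues of a symmetric matrix $A$. If $d \ge \mathtt{gap}^{-1/2}$, then for every $\delta \in (0,1)$, with probability at least $1-\delta$ over $\mathbf{W}$, $\mathbf{U}$ and the seed, one has simultaneously for all $k \in \{1,\dots,T\}$ and all $r' \in \{1,\dots,r\}$ $$\lambda_{r'}\big(\mathbf{U}^\top \mathsf{V}_k\mathsf{V}_k^\top \mathbf{U}\big) \le \frac{26\, r\, \lambda^{9k/r'} \log(20 d^2)\,\log(e/\delta)}{d\,\mathtt{gap}^2}.$$ In particular, for an algorithm that makes $T = d$ queries, the bound holds for all $k \in \{1,\dots,d\}$. -/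

import Mathlib

open MeasureTheory ProbabilityTheory
open scoped NNReal Matrix

noncomputable section

/-- Entrywise measurable structure (the Borel one) on real matrices. -/
instance Matrix.instMeasurableSpaceReal {m n : ℕ} :
    MeasurableSpace (Matrix (Fin m) (Fin n) ℝ) :=
  inferInstanceAs (MeasurableSpace (Fin m → Fin n → ℝ))

/-- The Stiefel manifold: `d × k` real matrices with orthonormal columns. -/
def Stiefel (d k : ℕ) : Set (Matrix (Fin d) (Fin k) ℝ) :=
  {V | Vᵀ * V = 1}

/-- `W ∼ GOE(d)`: a random symmetric matrix with independent entries on and above the diagonal,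
`N(0, 2/d)` on the diagonal and `N(0, 1/d)` above it. -/
structure IsGOE {Ω : Type*} [MeasurableSpace Ω] {d : ℕ}
    (W : Ω → Matrix (Fin d) (Fin d) ℝ) (μ : Measure Ω) : Prop where
  measurable : Measurable W
  symm : ∀ᵐ ω ∂μ, (W ω).IsSymm
  indep : iIndepFun (fun (p : {p : Fin d × Fin d // p.1 ≤ p.2}) (ω : Ω) => W ω p.1.1 p.1.2) μ
  diag : ∀ i, HasLaw (fun ω => W ω i i) (gaussianReal 0 (2 / (d : ℝ≥0))) μ
  offdiag : ∀ i j, i < j → HasLaw (fun ω => W ω i j) (gaussianReal 0 (1 / (d : ℝ≥0))) μ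

/-- `U` is uniformly distributed on `Stief(d, r)`: its law is carried by the Stiefel manifold and
invariant under the transitive left action of the orthogonal group `O(d)`. -/
structure IsUniformStiefel {Ω : Type*} [MeasurableSpace Ω] {d r : ℕ}
    (U : Ω → Matrix (Fin d) (Fin r) ℝ) (μ : Measure Ω) : Prop where
  measurable : Measurable U
  mem : ∀ᵐ ω ∂μ, U ω ∈ Stiefel d r
  invariant : ∀ Q ∈ Matrix.orthogonalGroup (Fin d) ℝ, μ.map (fun ω => Q * U ω) = μ.map U

/-- A randomized adaptive matrix-vector query algorithm in dimension `d`: round `i` (counted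
from `0`) queries a vector that is a measurable function of a random seed and of the `i` earlier
query-response pairs. -/
structure QueryAlgorithm (d : ℕ) (S : Type*) [MeasurableSpace S] where
  query : (i : ℕ) → S → (Fin i → (Fin d → ℝ) × (Fin d → ℝ)) → (Fin d → ℝ)
  measurable_query : ∀ i, Measurable
    (fun p : S × (Fin i → (Fin d → ℝ) × (Fin d → ℝ)) => query i p.1 p.2)

namespace QueryAlgorithm

variable {d : ℕ} {S : Type*} [MeasurableSpace S]

/-- The first `i` query-response pairs `(v, M v)` when the algorithm is run with seed `s` on the
matrix `M`. -/
def history (A : QueryAlgorithm d S) (s : S) (M : Matrix (Fin d) (Fin d) ℝ) :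
    (i : ℕ) → Fin i → (Fin d → ℝ) × (Fin d → ℝ)
  | 0 => Fin.elim0
  | i + 1 => Fin.snoc (α := fun _ => (Fin d → ℝ) × (Fin d → ℝ)) (A.history s M i)
      (A.query i s (A.history s M i), M *ᵥ A.query i s (A.history s M i))

/-- The matrix `V_k` whose columns are the first `k` queries made with seed `s` on `M`. -/
def queryMatrix (A : QueryAlgorithm d S) (s : S) (M : Matrix (Fin d) (Fin d) ℝ) (k : ℕ) :
    Matrix (Fin d) (Fin k) ℝ :=
  Matrix.of fun a j => (A.history s M k j).1 a

/-- The first `T` queries are orthonormal, whatever the symmetric input and the seed. -/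
def IsOrthonormal (A : QueryAlgorithm d S) (T : ℕ) : Prop :=
  ∀ (s : S) (M : Matrix (Fin d) (Fin d) ℝ), M.IsSymm → A.queryMatrix s M T ∈ Stiefel d T

end QueryAlgorithm

/-- The overlap matrix `Uᵀ V Vᵀ U`. -/
def overlap {d r k : ℕ} (U : Matrix (Fin d) (Fin r) ℝ) (V : Matrix (Fin d) (Fin k) ℝ) :
    Matrix (Fin r) (Fin r) ℝ :=
  Uᵀ * V * Vᵀ * U

theorem overlap_isHermitian {d r k : ℕ} (U : Matrix (Fin d) (Fin r) ℝ)
    (V : Matrix (Fin d) (Fin k) ℝ) : (overlap U V).IsHermitian := by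
  simp [Matrix.IsHermitian, overlap, Matrix.conjTranspose_eq_transpose_of_trivial,
    Matrix.transpose_mul, Matrix.mul_assoc]

/-- The eigenvalues of a symmetric matrix in decreasing order, with multiplicity:
the one with index `j : Fin r` is the `(j+1)`-st largest. -/
def sortedEigenvalue {r : ℕ} {A : Matrix (Fin r) (Fin r) ℝ} (hA : A.IsHermitian) (j : Fin r) : ℝ :=
  hA.eigenvalues₀ (Fin.cast (Fintype.card_fin r).symm j)

/-- The asymptotic eigengap `(λ + λ⁻¹ - 2) / (λ + λ⁻¹)` of the deformed Wigner model. -/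
def asymptoticGap (lam : ℝ) : ℝ :=
  (lam + lam⁻¹ - 2) / (lam + lam⁻¹)

end

/-! The potential is the regularised determinant det(Uᵀ V_k V_kᵀ U + c' I). It starts at c'^r, and
each query is a rank-one update. If the update multiplies no quadratic form by more than β, it
multiplies the determinant by at most β (`det_add_vecMulVec_le`). So after k queries the r'-th
eigenvalue is at most c' β^(k/r'). Here β = λ^9 and c' is the prefactor of the theorem.

The one-step growth in a fixed unit direction a is a change-of-measure argument
(`lintegral_jump_le`). Put u = U a and split λ U Uᵀ = D₀ + λ u uᵀ. If the algorithm were run on W +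
D₀, its queries would know nothing about u except what the rest of U reveals, and d - r + 1 times
the squared overlap of k + 1 queries with u would have exponential moments bounded by those of a χ²
variable. Restoring the spike λ u uᵀ costs a likelihood ratio. Its size is governed by the overlap
of the first k queries only, because query k + 1 is a function of the first k answers. Young's
inequality (`exp_le_young`) bounds the ratio by a multiple of a ratio of mean one plus an
exponential of the k-overlap. On the event that the overlap jumps by more than a factor β, the
k-overlap is below 1/β times the (k+1)-overlap, minus c. The exponential is then absorbed by the χ²
moment, and c supplies the gain.

For an adaptive algorithm the likelihood ratio is found by averaging: the block of W that the
queries have not touched is still a fresh GOE block given the transcript (`lintegral_resample`), so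
its share of the Cameron–Martin density integrates to one.

A union bound over at most d rounds and (2d + 1)^r grid directions, extended to all directions by
`quadratic_le_of_grid`, completes the proof. Rounds at which the claimed bound is at least 1 need no
argument, which allows k log λ to be at most of order r log d in the tail estimate. -/

/-! ### Measures on matrices and their characteristic functions. -/

instance Matrix.instBorelSpaceReal {m n : ℕ} : BorelSpace (Matrix (Fin m) (Fin n) ℝ) :=
  inferInstanceAs (BorelSpace (Fin m → Fin n → ℝ))

theorem measurable_matrix_iff {α : Type*} [MeasurableSpace α] {m n : ℕ}
    {f : α → Matrix (Fin m) (Fin n) ℝ} :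
    Measurable f ↔ ∀ i j, Measurable fun x => f x i j := by
  constructor
  · intro h i j
    exact (measurable_pi_apply j).comp ((measurable_pi_apply i).comp h)
  · intro h
    exact measurable_pi_lambda _ fun i => measurable_pi_lambda _ fun j => h i j

/-- The entrywise (Frobenius) inner product of two real matrices. -/
noncomputable def frobInner {m n : ℕ} (A B : Matrix (Fin m) (Fin n) ℝ) : ℝ :=
  ∑ i, ∑ j, A i j * B i j

/-- Every continuous linear functional is the pairing with the matrix of its values on the unit
matrices, so agreement on such pairings is agreement of characteristic functions. -/
theorem measure_pi_pi_ext {m n : ℕ} {μ ν : Measure (Fin m → Fin n → ℝ)}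
    [IsFiniteMeasure μ] [IsFiniteMeasure ν]
    (h : ∀ B : Fin m → Fin n → ℝ,
      ∫ X, Complex.exp ((∑ i, ∑ j, B i j * X i j : ℝ) * Complex.I) ∂μ =
        ∫ X, Complex.exp ((∑ i, ∑ j, B i j * X i j : ℝ) * Complex.I) ∂ν) : μ = ν := by
  refine Measure.ext_of_charFunDual ?_
  funext L
  rw [charFunDual_apply, charFunDual_apply]
  have key : ∀ X : Fin m → Fin n → ℝ,
      L X = ∑ i, ∑ j, L (Pi.single i (Pi.single j 1)) * X i j := by
    intro X
    have hX : X = ∑ i, ∑ j, X i j • (Pi.single i (Pi.single j (1 : ℝ)) : Fin m → Fin n → ℝ) := by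
      ext i j
      simp [Finset.sum_apply, Pi.single_apply, apply_ite, ite_apply]
    conv_lhs => rw [hX]
    simp only [map_sum, map_smul, smul_eq_mul]
    exact Finset.sum_congr rfl fun i _ => Finset.sum_congr rfl fun j _ => mul_comm _ _
  have h' : ∀ ρ : Measure (Fin m → Fin n → ℝ), ∫ X, Complex.exp (L X * Complex.I) ∂ρ =
      ∫ X, Complex.exp ((∑ i, ∑ j, L (Pi.single i (Pi.single j 1)) * X i j : ℝ) * Complex.I) ∂ρ :=
    fun ρ => integral_congr_ae <| Filter.Eventually.of_forall fun X =>
      congrArg (fun t : ℝ => Complex.exp (t * Complex.I)) (key X)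
  rw [h', h', h]

/-- A finite measure on real matrices is determined by its characteristic function. -/
theorem measure_matrix_ext {m n : ℕ} {μ ν : Measure (Matrix (Fin m) (Fin n) ℝ)}
    [hμ : IsFiniteMeasure μ] [hν : IsFiniteMeasure ν]
    (h : ∀ B : Matrix (Fin m) (Fin n) ℝ,
      ∫ X, Complex.exp (frobInner B X * Complex.I) ∂μ =
        ∫ X, Complex.exp (frobInner B X * Complex.I) ∂ν) : μ = ν :=
  @measure_pi_pi_ext m n μ ν hμ hν h

/-! ### The transform of the GOE. -/

theorem sum_sum_eq_sum_upper {R : Type*} [AddCommMonoid R] {d : ℕ} (f : Fin d → Fin d → R) :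
    ∑ i, ∑ j, f i j = ∑ p : {p : Fin d × Fin d // p.1 ≤ p.2},
      if p.1.1 = p.1.2 then f p.1.1 p.1.1 else f p.1.1 p.1.2 + f p.1.2 p.1.1 := by
  have h1 : ∀ i j : Fin d, f i j = (if i ≤ j then f i j else 0) + (if j < i then f i j else 0) := by
    intro i j
    rcases le_or_gt i j with h | h
    · simp [h, not_lt.2 h]
    · simp [h, not_le.2 h]
  have h2 : ∑ i, ∑ j, f i j =
      ∑ i, ∑ j, ((if i ≤ j then f i j else 0) + (if i < j then f j i else 0)) := by
    simp only [Finset.sum_add_distrib]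
    rw [Finset.sum_comm (f := fun i j => if i < j then f j i else 0), ← Finset.sum_add_distrib]
    refine Finset.sum_congr rfl fun i _ => ?_
    rw [← Finset.sum_add_distrib]
    exact Finset.sum_congr rfl fun j _ => h1 i j
  have h3 : ∀ p : Fin d × Fin d, ((if p.1 ≤ p.2 then f p.1 p.2 else 0) +
      (if p.1 < p.2 then f p.2 p.1 else 0)) = if p.1 ≤ p.2 then
        (if p.1 = p.2 then f p.1 p.1 else f p.1 p.2 + f p.2 p.1) else 0 := by
    rintro ⟨i, j⟩
    rcases lt_trichotomy i j with h | h | h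
    · simp [h, h.le, h.ne]
    · simp [h]
    · simp [not_le.2 h, not_lt.2 h.le]
  rw [h2, ← Finset.sum_product', Finset.univ_product_univ, Finset.sum_congr rfl fun p _ => h3 p,
    ← Finset.sum_filter]
  exact Finset.sum_subtype _ (by simp) _

/-- A law on symmetric matrices with the moment generating function of `GOE(d)`. -/
structure IsGOELaw {d : ℕ} (γ : Measure (Matrix (Fin d) (Fin d) ℝ)) : Prop where
  symm : ∀ᵐ X ∂γ, X.IsSymm
  integral_cexp : ∀ Z : Fin d → Fin d → ℂ,
    ∫ X, Complex.exp (∑ i, ∑ j, Z i j * (X i j : ℂ)) ∂γ =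
      Complex.exp (∑ i, ∑ j, (Z i j + Z j i) ^ 2 / (4 * d))

theorem measurableSet_isSymm {d : ℕ} :
    MeasurableSet {X : Matrix (Fin d) (Fin d) ℝ | X.IsSymm} := by
  have : {X : Matrix (Fin d) (Fin d) ℝ | X.IsSymm} = ⋂ i, ⋂ j, {X | X j i = X i j} := by
    ext X
    simp [Matrix.IsSymm.ext_iff]
  rw [this]
  refine MeasurableSet.iInter fun i => MeasurableSet.iInter fun j => ?_
  have h := measurable_matrix_iff.1 (measurable_id (α := Matrix (Fin d) (Fin d) ℝ))
  exact measurableSet_eq_fun (h j i) (h i j)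

/-- Pairing each entry with its mirror image leaves a sum over the independent upper triangle, and
the transform factors into Gaussian ones. Complex Z makes one formula serve both for identifying
laws and for real exponential moments. -/
theorem IsGOE.isGOELaw {Ω : Type*} [MeasurableSpace Ω] {d : ℕ}
    {W : Ω → Matrix (Fin d) (Fin d) ℝ} {μ : Measure Ω} [IsProbabilityMeasure μ]
    (hW : IsGOE W μ) : IsGOELaw (μ.map W) := by
  have hm := measurable_matrix_iff.1 hW.measurable
  refine ⟨(ae_map_iff hW.measurable.aemeasurable measurableSet_isSymm).2 hW.symm, fun Z => ?_⟩
  rw [integral_map hW.measurable.aemeasurable]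
  swap
  · have h := measurable_matrix_iff.1 (measurable_id (α := Matrix (Fin d) (Fin d) ℝ))
    simp only [id] at h
    refine Measurable.aestronglyMeasurable (Complex.measurable_exp.comp ?_)
    refine Finset.measurable_sum _ fun i _ => Finset.measurable_sum _ fun j _ => ?_
    exact (Complex.measurable_ofReal.comp (h i j)).const_mul _
  let c : {p : Fin d × Fin d // p.1 ≤ p.2} → ℂ := fun p =>
    if p.1.1 = p.1.2 then Z p.1.1 p.1.1 else Z p.1.1 p.1.2 + Z p.1.2 p.1.1
  have h1 : ∀ᵐ ω ∂μ, Complex.exp (∑ i, ∑ j, Z i j * (W ω i j : ℂ)) =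
      ∏ p : {p : Fin d × Fin d // p.1 ≤ p.2}, Complex.exp (c p * (W ω p.1.1 p.1.2 : ℂ)) := by
    filter_upwards [hW.symm] with ω hω
    rw [sum_sum_eq_sum_upper, Complex.exp_sum]
    refine Finset.prod_congr rfl fun p _ => ?_
    congr 1
    by_cases hp : p.1.1 = p.1.2
    · simp [c, hp]
    · simp only [c, hp, if_false]
      rw [hω.apply p.1.1 p.1.2]
      ring
  rw [integral_congr_ae h1]
  have h2 := (iIndepFun_iff_map_fun_eq_pi_map
    (fun p : {p : Fin d × Fin d // p.1 ≤ p.2} => (hm p.1.1 p.1.2).aemeasurable)).1 hW.indep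
  have h3 : ∫ ω, ∏ p : {p : Fin d × Fin d // p.1 ≤ p.2},
      Complex.exp (c p * (W ω p.1.1 p.1.2 : ℂ)) ∂μ =
      ∏ p : {p : Fin d × Fin d // p.1 ≤ p.2}, ∫ x, Complex.exp (c p * (x : ℂ))
        ∂(μ.map fun ω => W ω p.1.1 p.1.2) := by
    have : ∀ p : {p : Fin d × Fin d // p.1 ≤ p.2},
        IsProbabilityMeasure (μ.map fun ω => W ω p.1.1 p.1.2) :=
      fun p => Measure.isProbabilityMeasure_map (hm _ _).aemeasurable
    rw [← integral_fintype_prod_eq_prod (𝕜 := ℂ)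
      (fun (p : {p : Fin d × Fin d // p.1 ≤ p.2}) (x : ℝ) => Complex.exp (c p * (x : ℂ))), ← h2,
      integral_map (measurable_pi_lambda _ fun p => hm _ _).aemeasurable]
    refine Measurable.aestronglyMeasurable ?_
    fun_prop
  have h4 : ∀ (v : ℝ≥0) (ν : Measure ℝ), ν = gaussianReal 0 v → ∀ z : ℂ,
      ∫ x, Complex.exp (z * (x : ℂ)) ∂ν = Complex.exp (v * z ^ 2 / 2) := by
    rintro v ν rfl z
    have := complexMGF_gaussianReal (p := gaussianReal 0 v) (X := id) (μ := 0) (v := v)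
      Measure.map_id z
    simpa [complexMGF] using this
  rw [h3, sum_sum_eq_sum_upper, Complex.exp_sum]
  refine Finset.prod_congr rfl fun p _ => ?_
  rcases p with ⟨⟨i, j⟩, hij⟩
  by_cases hp : i = j
  · subst hp
    rw [h4 _ _ (hW.diag i).map_eq]
    simp only [c, if_true]
    congr 1
    push_cast
    ring
  · rw [h4 _ _ (hW.offdiag i j (lt_of_le_of_ne hij hp)).map_eq]
    simp only [c, hp, if_false]
    congr 1
    push_cast
    ring

/-! ### Frobenius inner product and measurability of matrix operations. -/

theorem frobInner_eq_trace {m n : ℕ} (A B : Matrix (Fin m) (Fin n) ℝ) :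
    frobInner A B = (Aᵀ * B).trace := by
  simp only [frobInner, Matrix.trace, Matrix.diag, Matrix.mul_apply, Matrix.transpose_apply]
  exact Finset.sum_comm

theorem frobInner_add_right {m n : ℕ} (A B C : Matrix (Fin m) (Fin n) ℝ) :
    frobInner A (B + C) = frobInner A B + frobInner A C := by
  simp [frobInner_eq_trace, Matrix.mul_add]

theorem frobInner_sub_right {m n : ℕ} (A B C : Matrix (Fin m) (Fin n) ℝ) :
    frobInner A (B - C) = frobInner A B - frobInner A C := by
  simp [frobInner_eq_trace, Matrix.mul_sub]

theorem frobInner_comm {m n : ℕ} (A B : Matrix (Fin m) (Fin n) ℝ) :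
    frobInner A B = frobInner B A := by
  simp only [frobInner, mul_comm]

theorem frobInner_sub_left {m n : ℕ} (A B C : Matrix (Fin m) (Fin n) ℝ) :
    frobInner (A - B) C = frobInner A C - frobInner B C := by
  simp only [frobInner_comm _ C, frobInner_sub_right]

theorem frobInner_smul_left {m n : ℕ} (t : ℝ) (A B : Matrix (Fin m) (Fin n) ℝ) :
    frobInner (t • A) B = t * frobInner A B := by
  simp [frobInner_eq_trace]

theorem frobInner_smul_right {m n : ℕ} (t : ℝ) (A B : Matrix (Fin m) (Fin n) ℝ) :
    frobInner A (t • B) = t * frobInner A B := by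
  simp [frobInner_eq_trace]

/-- For a symmetric idempotent P the map B ↦ P B P is an orthogonal projection on matrix space. This
is its self-adjointness. -/
theorem frobInner_compress {d : ℕ} {P : Matrix (Fin d) (Fin d) ℝ} (hP : P.IsSymm)
    (A B : Matrix (Fin d) (Fin d) ℝ) :
    frobInner A (P * B * P) = frobInner (P * A * P) B := by
  rw [frobInner_eq_trace, frobInner_eq_trace, Matrix.transpose_mul, Matrix.transpose_mul, hP.eq,
    ← Matrix.mul_assoc, Matrix.trace_mul_comm, Matrix.mul_assoc, Matrix.mul_assoc]

theorem frobInner_compress_compress {d : ℕ} {P : Matrix (Fin d) (Fin d) ℝ} (hP : P.IsSymm)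
    (hPP : P * P = P) (A B : Matrix (Fin d) (Fin d) ℝ) :
    frobInner (P * A * P) (P * B * P) = frobInner (P * A * P) B := by
  rw [frobInner_compress hP]
  congr 1
  rw [Matrix.mul_assoc, Matrix.mul_assoc, Matrix.mul_assoc, hPP, ← Matrix.mul_assoc,
    ← Matrix.mul_assoc, hPP]

theorem measurable_frobInner {α : Type*} [MeasurableSpace α] {m n : ℕ}
    {f g : α → Matrix (Fin m) (Fin n) ℝ} (hf : Measurable f) (hg : Measurable g) :
    Measurable fun x => frobInner (f x) (g x) := by
  rw [measurable_matrix_iff] at hf hg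
  exact Finset.measurable_sum _ fun i _ => Finset.measurable_sum _ fun j _ => (hf i j).mul (hg i j)

theorem measurable_matrix_mul {α : Type*} [MeasurableSpace α] {l m n : ℕ}
    {f : α → Matrix (Fin l) (Fin m) ℝ} {g : α → Matrix (Fin m) (Fin n) ℝ}
    (hf : Measurable f) (hg : Measurable g) : Measurable fun x => f x * g x := by
  rw [measurable_matrix_iff] at hf hg ⊢
  intro i j
  simp only [Matrix.mul_apply]
  exact Finset.measurable_sum _ fun k _ => (hf i k).mul (hg k j)

theorem measurable_matrix_transpose {α : Type*} [MeasurableSpace α] {m n : ℕ}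
    {f : α → Matrix (Fin m) (Fin n) ℝ} (hf : Measurable f) : Measurable fun x => (f x)ᵀ := by
  rw [measurable_matrix_iff] at hf ⊢
  exact fun i j => hf j i

theorem measurable_matrix_add {α : Type*} [MeasurableSpace α] {m n : ℕ}
    {f g : α → Matrix (Fin m) (Fin n) ℝ}
    (hf : Measurable f) (hg : Measurable g) : Measurable fun x => f x + g x := by
  rw [measurable_matrix_iff] at hf hg ⊢
  exact fun i j => (hf i j).add (hg i j)

theorem measurable_matrix_sub {α : Type*} [MeasurableSpace α] {m n : ℕ}
    {f g : α → Matrix (Fin m) (Fin n) ℝ}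
    (hf : Measurable f) (hg : Measurable g) : Measurable fun x => f x - g x := by
  rw [measurable_matrix_iff] at hf hg ⊢
  exact fun i j => (hf i j).sub (hg i j)

theorem measurable_matrix_smul {α : Type*} [MeasurableSpace α] {m n : ℕ} {c : α → ℝ}
    {f : α → Matrix (Fin m) (Fin n) ℝ} (hc : Measurable c)
    (hf : Measurable f) : Measurable fun x => c x • f x := by
  rw [measurable_matrix_iff] at hf ⊢
  exact fun i j => hc.mul (hf i j)

/-! ### Block independence and the Cameron–Martin formula. -/

namespace IsGOELaw

variable {d : ℕ} {γ : Measure (Matrix (Fin d) (Fin d) ℝ)}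

theorem integral_cexp_frobInner (hγ : IsGOELaw γ) (B : Matrix (Fin d) (Fin d) ℝ) :
    ∫ X, Complex.exp (frobInner B X * Complex.I) ∂γ =
      Complex.exp (-(frobInner (B + Bᵀ) (B + Bᵀ) / (4 * d) : ℝ)) := by
  have h := hγ.integral_cexp fun i j => B i j * Complex.I
  convert h using 2
  · funext X
    congr 1
    simp only [frobInner]
    push_cast
    rw [Finset.sum_mul]
    refine Finset.sum_congr rfl fun i _ => ?_
    rw [Finset.sum_mul]
    exact Finset.sum_congr rfl fun j _ => by ring
  · simp only [frobInner, Matrix.add_apply, Matrix.transpose_apply]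
    push_cast
    rw [Finset.sum_div, ← Finset.sum_neg_distrib]
    refine Finset.sum_congr rfl fun i _ => ?_
    rw [Finset.sum_div, ← Finset.sum_neg_distrib]
    refine Finset.sum_congr rfl fun j _ => ?_
    rw [← add_mul, mul_pow, Complex.I_sq]
    ring

/-- For a `GOE` matrix `X` and a projection `P`, the block `P X P` is independent of the rest:
replacing it by that of an independent copy does not change the law. -/
theorem map_resample (hγ : IsGOELaw γ) [IsProbabilityMeasure γ] {P : Matrix (Fin d) (Fin d) ℝ}
    (hP : P.IsSymm) (hPP : P * P = P) :
    (γ.prod γ).map (fun x => x.1 - P * x.1 * P + P * x.2 * P) = γ := by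
  have hm : Measurable fun x : Matrix (Fin d) (Fin d) ℝ × Matrix (Fin d) (Fin d) ℝ =>
      x.1 - P * x.1 * P + P * x.2 * P :=
    measurable_matrix_add (measurable_matrix_sub measurable_fst
      (measurable_matrix_mul (measurable_matrix_mul measurable_const measurable_fst)
        measurable_const))
      (measurable_matrix_mul (measurable_matrix_mul measurable_const measurable_snd)
        measurable_const)
  have : IsProbabilityMeasure ((γ.prod γ).map fun x => x.1 - P * x.1 * P + P * x.2 * P) :=
    Measure.isProbabilityMeasure_map hm.aemeasurable
  refine measure_matrix_ext fun B => ?_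
  rw [integral_map hm.aemeasurable]
  swap
  · refine Measurable.aestronglyMeasurable (Complex.measurable_exp.comp ?_)
    exact (Complex.measurable_ofReal.comp
      (measurable_frobInner measurable_const measurable_id)).mul_const _
  have h1 : ∀ x : Matrix (Fin d) (Fin d) ℝ × Matrix (Fin d) (Fin d) ℝ,
      Complex.exp (frobInner B (x.1 - P * x.1 * P + P * x.2 * P) * Complex.I) =
      Complex.exp (frobInner (B - P * B * P) x.1 * Complex.I) *
        Complex.exp (frobInner (P * B * P) x.2 * Complex.I) := by
    intro x
    rw [← Complex.exp_add, frobInner_add_right, frobInner_sub_right, frobInner_sub_left,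
      frobInner_compress hP, frobInner_compress hP]
    congr 1
    push_cast
    ring
  simp only [h1]
  rw [integral_prod_mul (fun X => Complex.exp (frobInner (B - P * B * P) X * Complex.I))
    fun X => Complex.exp (frobInner (P * B * P) X * Complex.I), hγ.integral_cexp_frobInner,
    hγ.integral_cexp_frobInner, hγ.integral_cexp_frobInner, ← Complex.exp_add, ← Complex.ofReal_neg,
    ← Complex.ofReal_neg, ← Complex.ofReal_neg, ← Complex.ofReal_add]
  congr 2
  -- The exponents add up by Pythagoras: the symmetric part of B splits into its compression and an
  -- orthogonal remainder.
  have e1 : B - P * B * P + (B - P * B * P)ᵀ = (B + Bᵀ) - P * (B + Bᵀ) * P := by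
    simp only [Matrix.transpose_sub, Matrix.transpose_mul, hP.eq, Matrix.mul_add, Matrix.add_mul,
      Matrix.mul_assoc]
    abel
  have e2 : P * B * P + (P * B * P)ᵀ = P * (B + Bᵀ) * P := by
    simp only [Matrix.transpose_mul, hP.eq, Matrix.mul_add, Matrix.add_mul, Matrix.mul_assoc]
  rw [e1, e2, frobInner_sub_left, frobInner_sub_right, frobInner_sub_right,
    frobInner_compress_compress hP hPP, frobInner_compress hP]
  ring

theorem integrable_exp_frobInner (hγ : IsGOELaw γ) (A : Matrix (Fin d) (Fin d) ℝ) :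
    Integrable (fun X => Real.exp (frobInner A X)) γ := by
  have h := hγ.integral_cexp fun i j => (A i j : ℂ)
  have h2 : Integrable (fun X : Matrix (Fin d) (Fin d) ℝ =>
      Complex.exp (∑ i, ∑ j, (A i j : ℂ) * (X i j : ℂ))) γ := by
    -- A non-integrable function has integral 0 by convention, but the transform is an exponential
    -- and never vanishes.
    by_contra hn
    rw [integral_undef hn] at h
    exact Complex.exp_ne_zero _ h.symm
  have h3 := h2.re
  convert h3 using 2 with X
  have : (∑ i, ∑ j, (A i j : ℂ) * (X i j : ℂ)) = ((frobInner A X : ℝ) : ℂ) := by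
    simp [frobInner]
  rw [this, ← Complex.ofReal_exp]
  rfl

/-- Cameron–Martin formula for the `GOE`. -/
theorem map_add_right (hγ : IsGOELaw γ) [IsProbabilityMeasure γ] (hd : 0 < d)
    {D : Matrix (Fin d) (Fin d) ℝ} (hD : D.IsSymm) :
    γ.map (· + D) = γ.withDensity fun X =>
      ENNReal.ofReal (Real.exp (d / 2 * frobInner D X - d / 4 * frobInner D D)) := by
  have hm : Measurable fun X : Matrix (Fin d) (Fin d) ℝ => X + D :=
    measurable_matrix_add measurable_id measurable_const
  have : IsProbabilityMeasure (γ.map (· + D)) := Measure.isProbabilityMeasure_map hm.aemeasurable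
  have hmf : Measurable fun X : Matrix (Fin d) (Fin d) ℝ =>
      Real.exp (d / 2 * frobInner D X - d / 4 * frobInner D D) :=
    Real.measurable_exp.comp (((measurable_frobInner measurable_const measurable_id).const_mul
      _).sub_const _)
  have hint : Integrable (fun X : Matrix (Fin d) (Fin d) ℝ =>
      Real.exp (d / 2 * frobInner D X - d / 4 * frobInner D D)) γ := by
    have := (hγ.integrable_exp_frobInner ((d / 2 : ℝ) • D)).mul_const
      (Real.exp (-(d / 4 * frobInner D D)))
    refine this.congr (Filter.Eventually.of_forall fun X => ?_)
    simp only [frobInner_smul_left]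
    rw [← Real.exp_add, sub_eq_add_neg]
  have : IsFiniteMeasure (γ.withDensity fun X =>
      ENNReal.ofReal (Real.exp (d / 2 * frobInner D X - d / 4 * frobInner D D))) :=
    isFiniteMeasure_withDensity_ofReal hint.2
  refine measure_matrix_ext fun B => ?_
  rw [integral_map hm.aemeasurable]
  swap
  · refine Measurable.aestronglyMeasurable (Complex.measurable_exp.comp ?_)
    exact (Complex.measurable_ofReal.comp
      (measurable_frobInner measurable_const measurable_id)).mul_const _
  rw [integral_withDensity_eq_integral_toReal_smul hmf.ennreal_ofReal (by simp)]
  have h1 : ∀ X, Complex.exp (frobInner B (X + D) * Complex.I) =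
      Complex.exp (frobInner B X * Complex.I) * Complex.exp (frobInner B D * Complex.I) := by
    intro X
    rw [← Complex.exp_add, frobInner_add_right]
    push_cast
    ring_nf
  -- The density turns the characteristic function into the transform at the complex matrix i B +
  -- (d/2) D. Expanding its square reproduces the phase of the shift.
  have h2 : ∀ X : Matrix (Fin d) (Fin d) ℝ,
      (ENNReal.ofReal (Real.exp (d / 2 * frobInner D X - d / 4 * frobInner D D))).toReal •
        Complex.exp (frobInner B X * Complex.I) =
      Complex.exp (∑ i, ∑ j, (B i j * Complex.I + d / 2 * D i j) * (X i j : ℂ)) *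
        Complex.exp (-(d / 4 * frobInner D D : ℝ)) := by
    intro X
    rw [ENNReal.toReal_ofReal (Real.exp_pos _).le, Complex.real_smul, Complex.ofReal_exp,
      ← Complex.exp_add, ← Complex.exp_add]
    congr 1
    simp only [frobInner, add_mul, Finset.sum_add_distrib]
    push_cast
    simp only [Finset.mul_sum, Finset.sum_mul]
    have : ∀ i j, (B i j : ℂ) * X i j * Complex.I = B i j * Complex.I * X i j := fun i j => by ring
    simp only [this, mul_assoc]
    ring
  simp only [h1, h2]
  rw [integral_mul_const, integral_mul_const, hγ.integral_cexp, hγ.integral_cexp_frobInner,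
    ← Complex.exp_add, ← Complex.exp_add]
  congr 1
  have hd' : (d : ℂ) ≠ 0 := by exact_mod_cast hd.ne'
  have h3 : ∀ i j, ((B i j : ℂ) * Complex.I + d / 2 * D i j + (B j i * Complex.I + d / 2 * D j i)) ^ 2
      / (4 * d) = -(((B i j + B j i) * (B i j + B j i) : ℝ) / (4 * d) : ℂ) +
        (1 / 2) * ((B i j * D i j : ℝ) + (B j i * D j i : ℝ) : ℂ) * Complex.I +
        d / 4 * (D i j * D i j : ℝ) := by
    intro i j
    rw [hD.apply i j]
    push_cast
    field_simp
    ring_nf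
    simp only [Complex.I_sq]
    ring
  simp only [h3, Finset.sum_add_distrib, Finset.sum_neg_distrib, ← Finset.sum_div,
    ← Finset.mul_sum, ← Finset.sum_mul]
  rw [Finset.sum_comm (f := fun i j => ((B j i * D j i : ℝ) : ℂ))]
  simp only [frobInner, Matrix.add_apply, Matrix.transpose_apply]
  push_cast
  ring

end IsGOELaw

/-! ### Projections away from the queried directions. -/

theorem frobInner_vecMulVec {m n : ℕ} (a c : Fin m → ℝ) (b e : Fin n → ℝ) :
    frobInner (Matrix.vecMulVec a b) (Matrix.vecMulVec c e) = (a ⬝ᵥ c) * (b ⬝ᵥ e) := by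
  simp only [frobInner, Matrix.vecMulVec_apply, dotProduct, Finset.sum_mul_sum]
  exact Finset.sum_congr rfl fun i _ => Finset.sum_congr rfl fun j _ => by ring

/-- Pythagoras for the compression by P. -/
theorem frobInner_sub_compress {d : ℕ} {P : Matrix (Fin d) (Fin d) ℝ} (hP : P.IsSymm)
    (hPP : P * P = P) (D : Matrix (Fin d) (Fin d) ℝ) :
    frobInner (D - P * D * P) (D - P * D * P) =
      frobInner D D - frobInner (P * D * P) (P * D * P) := by
  have h1 := frobInner_compress hP D D
  have h2 := frobInner_compress_compress hP hPP D D
  have h3 := frobInner_comm D (P * D * P)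
  rw [frobInner_sub_right, frobInner_sub_left, frobInner_sub_left]
  linarith

/-- The projection `1 - V Vᵀ` onto the orthogonal complement of the columns of `V`. -/
noncomputable def complProj {d k : ℕ} (V : Matrix (Fin d) (Fin k) ℝ) : Matrix (Fin d) (Fin d) ℝ :=
  1 - V * Vᵀ

theorem complProj_isSymm {d k : ℕ} (V : Matrix (Fin d) (Fin k) ℝ) : (complProj V).IsSymm := by
  simp [Matrix.IsSymm, complProj]

theorem complProj_mul_self_of_mem {d k : ℕ} {V : Matrix (Fin d) (Fin k) ℝ} (hV : V ∈ Stiefel d k) :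
    complProj V * V = 0 := by
  rw [complProj, Matrix.sub_mul, Matrix.mul_assoc, show Vᵀ * V = 1 from hV]
  simp

theorem complProj_mul_complProj {d k : ℕ} {V : Matrix (Fin d) (Fin k) ℝ} (hV : V ∈ Stiefel d k) :
    complProj V * complProj V = complProj V := by
  conv_lhs => rw [complProj.eq_def V, ← complProj.eq_def V]
  rw [show complProj V * complProj V = complProj V * (1 - V * Vᵀ) from rfl, Matrix.mul_sub,
    ← Matrix.mul_assoc, complProj_mul_self_of_mem hV]
  simp

theorem measurable_complProj {α : Type*} [MeasurableSpace α] {d k : ℕ}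
    {f : α → Matrix (Fin d) (Fin k) ℝ} (hf : Measurable f) :
    Measurable fun x => complProj (f x) :=
  measurable_matrix_sub measurable_const
    (measurable_matrix_mul hf (measurable_matrix_transpose hf))

/-! ### Adaptive algorithms: resampling the unseen block and changing measure. -/

namespace QueryAlgorithm

variable {d : ℕ} {S : Type*} [MeasurableSpace S] (A : QueryAlgorithm d S)

theorem measurable_history (k : ℕ) :
    Measurable fun x : S × Matrix (Fin d) (Fin d) ℝ => A.history x.1 x.2 k := by
  induction k with
  | zero => exact measurable_pi_lambda _ fun j => j.elim0
  | succ k ih =>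
    have hq : Measurable fun x : S × Matrix (Fin d) (Fin d) ℝ =>
        A.query k x.1 (A.history x.1 x.2 k) :=
      (A.measurable_query k).comp (measurable_fst.prodMk ih)
    refine measurable_pi_lambda _ fun j => ?_
    refine Fin.lastCases ?_ (fun j => ?_) j
    · simp only [history, Fin.snoc_last]
      refine hq.prodMk (measurable_pi_lambda _ fun a => ?_)
      simp only [Matrix.mulVec, dotProduct]
      refine Finset.measurable_sum _ fun b _ => ?_
      exact (measurable_matrix_iff.1 measurable_snd a b).mul ((measurable_pi_apply b).comp hq)
    · simp only [history, Fin.snoc_castSucc]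
      exact (measurable_pi_apply j).comp ih

theorem measurable_queryMatrix (k : ℕ) :
    Measurable fun x : S × Matrix (Fin d) (Fin d) ℝ => A.queryMatrix x.1 x.2 k := by
  rw [measurable_matrix_iff]
  intro i j
  exact (measurable_pi_apply i).comp
    (measurable_fst.comp ((measurable_pi_apply j).comp (A.measurable_history k)))

/-- The query matrix with `k + 1` columns as a function of the first `k` query-response pairs. -/
def queryMatrixOfHistory (s : S) (k : ℕ) (h : Fin k → (Fin d → ℝ) × (Fin d → ℝ)) :
    Matrix (Fin d) (Fin (k + 1)) ℝ :=
  Matrix.of fun a j => Fin.snoc (α := fun _ => Fin d → ℝ) (fun i => (h i).1) (A.query k s h) j a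

theorem queryMatrix_succ_eq (s : S) (M : Matrix (Fin d) (Fin d) ℝ) (k : ℕ) :
    A.queryMatrix s M (k + 1) = A.queryMatrixOfHistory s k (A.history s M k) := by
  ext a j
  refine Fin.lastCases ?_ (fun j => ?_) j <;>
  simp [queryMatrix, queryMatrixOfHistory, history]

theorem queryMatrix_eq_submatrix (s : S) (M : Matrix (Fin d) (Fin d) ℝ) {k l : ℕ} (hkl : k ≤ l) :
    A.queryMatrix s M k = (A.queryMatrix s M l).submatrix id (Fin.castLE hkl) := by
  induction l, hkl using Nat.le_induction with
  | base => rfl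
  | succ l hkl ih =>
    rw [ih]
    ext a j
    simp only [queryMatrix, history, Matrix.submatrix_apply, Matrix.of_apply, id]
    have : Fin.castLE (hkl.trans l.le_succ) j = Fin.castSucc (Fin.castLE hkl j) := rfl
    rw [this, Fin.snoc_castSucc]

variable {A} in
theorem IsOrthonormal.mem_stiefel {T : ℕ} (hA : A.IsOrthonormal T) (s : S)
    {M : Matrix (Fin d) (Fin d) ℝ} (hM : M.IsSymm) {k : ℕ} (hk : k ≤ T) :
    A.queryMatrix s M k ∈ Stiefel d k := by
  have h : (A.queryMatrix s M T)ᵀ * A.queryMatrix s M T = 1 := hA s M hM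
  show (A.queryMatrix s M k)ᵀ * A.queryMatrix s M k = 1
  rw [A.queryMatrix_eq_submatrix s M hk, Matrix.transpose_submatrix,
    ← Matrix.submatrix_mul _ _ _ id _ Function.bijective_id, h]
  ext i j
  simp [Matrix.one_apply]

variable {A} in
-- The complements of the query spans are nested, since the first k queries are among the first k +
-- 1.
theorem IsOrthonormal.complProj_succ_mul {T : ℕ} (hA : A.IsOrthonormal T) (s : S)
    {M : Matrix (Fin d) (Fin d) ℝ} (hM : M.IsSymm) {k : ℕ} (hk : k + 1 ≤ T) :
    complProj (A.queryMatrix s M (k + 1)) * complProj (A.queryMatrix s M k) =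
      complProj (A.queryMatrix s M (k + 1)) := by
  have h0 : complProj (A.queryMatrix s M (k + 1)) * A.queryMatrix s M k = 0 := by
    have h := complProj_mul_self_of_mem (hA.mem_stiefel s hM hk)
    rw [A.queryMatrix_eq_submatrix s M k.le_succ]
    ext a j
    exact congrFun (congrFun h a) (Fin.castLE k.le_succ j)
  conv_lhs => rw [complProj.eq_def (A.queryMatrix s M k), Matrix.mul_sub, ← Matrix.mul_assoc, h0]
  simp

/-- The algorithm learns about M only through M V_k. By induction, if M' agrees with M on the
queries made for M, every query and answer is reproduced. -/
theorem history_congr (s : S) {M M' : Matrix (Fin d) (Fin d) ℝ} {k : ℕ}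
    (h : M' * A.queryMatrix s M k = M * A.queryMatrix s M k) :
    A.history s M' k = A.history s M k := by
  induction k with
  | zero => rfl
  | succ k ih =>
    have hk : A.history s M' k = A.history s M k := by
      refine ih ?_
      rw [A.queryMatrix_eq_submatrix s M k.le_succ]
      ext a j
      exact congrFun (congrFun h a) (Fin.castLE k.le_succ j)
    have hl : M' *ᵥ A.query k s (A.history s M k) = M *ᵥ A.query k s (A.history s M k) := by
      ext a
      have := congrFun (congrFun h a) (Fin.last k)
      simpa [Matrix.mul_apply, queryMatrix, history, Matrix.mulVec, dotProduct] using this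
    simp only [history]
    rw [hk, hl]

/-- The matrix `W` with the block that the first `k` queries made on `W + D₀` do not see replaced by
that of `X`. -/
noncomputable def resample (s : S) (D₀ : Matrix (Fin d) (Fin d) ℝ) (k : ℕ)
    (W X : Matrix (Fin d) (Fin d) ℝ) : Matrix (Fin d) (Fin d) ℝ :=
  W - complProj (A.queryMatrix s (W + D₀) k) * W * complProj (A.queryMatrix s (W + D₀) k) +
    complProj (A.queryMatrix s (W + D₀) k) * X * complProj (A.queryMatrix s (W + D₀) k)

theorem measurable_queryMatrix_add (s : S) (D₀ : Matrix (Fin d) (Fin d) ℝ) (k : ℕ) :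
    Measurable fun W : Matrix (Fin d) (Fin d) ℝ => A.queryMatrix s (W + D₀) k :=
  (A.measurable_queryMatrix k).comp
    (measurable_const.prodMk (measurable_matrix_add measurable_id measurable_const))

theorem measurable_history_add (s : S) (D₀ : Matrix (Fin d) (Fin d) ℝ) (k : ℕ) :
    Measurable fun W : Matrix (Fin d) (Fin d) ℝ => A.history s (W + D₀) k :=
  (A.measurable_history k).comp
    (measurable_const.prodMk (measurable_matrix_add measurable_id measurable_const))

theorem measurable_resample (s : S) (D₀ : Matrix (Fin d) (Fin d) ℝ) (k : ℕ) :
    Measurable fun x : Matrix (Fin d) (Fin d) ℝ × Matrix (Fin d) (Fin d) ℝ =>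
      A.resample s D₀ k x.1 x.2 := by
  have hP : Measurable fun x : Matrix (Fin d) (Fin d) ℝ × Matrix (Fin d) (Fin d) ℝ =>
      complProj (A.queryMatrix s (x.1 + D₀) k) :=
    measurable_complProj ((A.measurable_queryMatrix_add s D₀ k).comp measurable_fst)
  exact measurable_matrix_add (measurable_matrix_sub measurable_fst
    (measurable_matrix_mul (measurable_matrix_mul hP measurable_fst) hP))
    (measurable_matrix_mul (measurable_matrix_mul hP measurable_snd) hP)

variable {A} in
-- The replaced block kills every query already made, so all answers are unchanged.
theorem IsOrthonormal.history_resample {T : ℕ} (hA : A.IsOrthonormal T) (s : S)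
    {D₀ W : Matrix (Fin d) (Fin d) ℝ} (hD₀ : D₀.IsSymm) (hW : W.IsSymm) {k : ℕ} (hk : k ≤ T)
    (X : Matrix (Fin d) (Fin d) ℝ) :
    A.history s (A.resample s D₀ k W X + D₀) k = A.history s (W + D₀) k := by
  apply A.history_congr
  have h := complProj_mul_self_of_mem (hA.mem_stiefel s (hW.add hD₀) hk)
  rw [Matrix.add_mul, Matrix.add_mul, resample, Matrix.add_mul, Matrix.sub_mul,
    Matrix.mul_assoc _ _ (A.queryMatrix s (W + D₀) k), h,
    Matrix.mul_assoc _ _ (A.queryMatrix s (W + D₀) k), h]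
  simp

/-- This is the statement that, given the transcript, the unseen block is a fresh GOE block. It is
proved by invariance under resampling, which avoids conditional distributions. -/
theorem IsOrthonormal.lintegral_resample {T : ℕ} {A : QueryAlgorithm d S} (hA : A.IsOrthonormal T)
    (s : S) {D₀ : Matrix (Fin d) (Fin d) ℝ} (hD₀ : D₀.IsSymm)
    {γ : Measure (Matrix (Fin d) (Fin d) ℝ)} [IsProbabilityMeasure γ] (hγ : IsGOELaw γ) {k : ℕ}
    (hk : k ≤ T) {F : Matrix (Fin d) (Fin d) ℝ → ENNReal} (hF : Measurable F) :
    ∫⁻ W, ∫⁻ X, F (A.resample s D₀ k W X) ∂γ ∂γ = ∫⁻ W, F W ∂γ := by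
  induction k generalizing F with
  | zero =>
    have h : ∀ W X, A.resample s D₀ 0 W X = X := by
      intro W X
      have h1 : complProj (A.queryMatrix s (W + D₀) 0) = 1 := by
        ext i j
        simp [complProj]
      simp [resample, h1]
    simp [h]
  | succ k ih =>
    have hk' : k ≤ T := k.le_succ.trans hk
    have hFk : Measurable fun W => ∫⁻ X, F (A.resample s D₀ (k + 1) W X) ∂γ :=
      (hF.comp (A.measurable_resample s D₀ (k + 1))).lintegral_prod_right'
    -- The inductive hypothesis replaces the outer matrix on both sides by one already resampled at
    -- round k. With W fixed, the projections of rounds k and k + 1 are then constant.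
    rw [← ih hk' hFk, ← ih hk' hF]
    refine lintegral_congr_ae ?_
    filter_upwards [hγ.symm] with W hW
    have hM := hW.add hD₀
    set Q := complProj (A.queryMatrix s (W + D₀) k) with hQ
    set P := complProj (A.queryMatrix s (W + D₀) (k + 1)) with hP
    have hPs : P.IsSymm := complProj_isSymm _
    have hQs : Q.IsSymm := complProj_isSymm _
    have hPP : P * P = P := complProj_mul_complProj (hA.mem_stiefel s hM hk)
    have hPQ : P * Q = P := hA.complProj_succ_mul s hM hk
    have hQP : Q * P = P := by
      have := congrArg Matrix.transpose hPQ
      rwa [Matrix.transpose_mul, hPs.eq, hQs.eq] at this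
    -- Resampling at round k and then at round k + 1 is a single resampling at round k from X with
    -- its own P-block redrawn. The same P serves both times because query k + 1 depends only on the
    -- preserved history.
    have key : ∀ X Y, A.resample s D₀ (k + 1) (A.resample s D₀ k W X) Y =
        A.resample s D₀ k W (X - P * X * P + P * Y * P) := by
      intro X Y
      have h1 : complProj (A.queryMatrix s (A.resample s D₀ k W X + D₀) (k + 1)) = P := by
        rw [A.queryMatrix_succ_eq, hA.history_resample s hD₀ hW hk', ← A.queryMatrix_succ_eq]
      rw [resample, h1]
      simp only [resample]
      rw [← hQ]
      have e : ∀ Z, P * (Q * Z * Q) * P = P * Z * P := by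
        intro Z
        rw [← Matrix.mul_assoc, ← Matrix.mul_assoc, hPQ, Matrix.mul_assoc, hQP]
      have e' : ∀ Z, Q * (P * Z * P) * Q = P * Z * P := by
        intro Z
        rw [← Matrix.mul_assoc, ← Matrix.mul_assoc, hQP, Matrix.mul_assoc, hPQ]
      have e1 : P * (W - Q * W * Q + Q * X * Q) * P = P * X * P := by
        rw [Matrix.mul_add, Matrix.mul_sub, Matrix.add_mul, Matrix.sub_mul, e, e]
        abel
      have e2 : Q * (X - P * X * P + P * Y * P) * Q = Q * X * Q - P * X * P + P * Y * P := by
        rw [Matrix.mul_add, Matrix.mul_sub, Matrix.add_mul, Matrix.sub_mul, e', e']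
      rw [e1, e2]
      abel
    simp only [key]
    have hG : Measurable fun X => F (A.resample s D₀ k W X) :=
      hF.comp ((A.measurable_resample s D₀ k).comp measurable_prodMk_left)
    have hm : Measurable fun x : Matrix (Fin d) (Fin d) ℝ × Matrix (Fin d) (Fin d) ℝ =>
        x.1 - P * x.1 * P + P * x.2 * P :=
      measurable_matrix_add (measurable_matrix_sub measurable_fst
        (measurable_matrix_mul (measurable_matrix_mul measurable_const measurable_fst)
          measurable_const))
        (measurable_matrix_mul (measurable_matrix_mul measurable_const measurable_snd)
          measurable_const)
    conv_rhs => rw [← hγ.map_resample hPs hPP, lintegral_map hG hm]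
    exact (lintegral_prod _ (hG.comp hm).aemeasurable).symm

/-- Change of measure: shifting a `GOE` matrix by `D` changes the law of the history of an adaptive
algorithm by the likelihood ratio of the part of `D` that the queries see. -/
theorem IsOrthonormal.lintegral_history_add {T : ℕ} {A : QueryAlgorithm d S}
    (hA : A.IsOrthonormal T) (hd : 0 < d) (s : S) {D₀ D : Matrix (Fin d) (Fin d) ℝ}
    (hD₀ : D₀.IsSymm) (hD : D.IsSymm)
    {γ : Measure (Matrix (Fin d) (Fin d) ℝ)} [IsProbabilityMeasure γ] (hγ : IsGOELaw γ) {k : ℕ}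
    (hk : k ≤ T) {G : (Fin k → (Fin d → ℝ) × (Fin d → ℝ)) → ENNReal} (hG : Measurable G)
    {Δ : Matrix (Fin d) (Fin d) ℝ → Matrix (Fin d) (Fin d) ℝ}
    (hΔ : ∀ W, Δ W = D - complProj (A.queryMatrix s (W + D₀) k) * D *
      complProj (A.queryMatrix s (W + D₀) k)) :
    ∫⁻ W, G (A.history s (W + (D₀ + D)) k) ∂γ =
      ∫⁻ W, G (A.history s (W + D₀) k) *
        ENNReal.ofReal (Real.exp (d / 2 * frobInner (Δ W) W - d / 4 * frobInner (Δ W) (Δ W)))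
        ∂γ := by
  have hmexp : ∀ E : Matrix (Fin d) (Fin d) ℝ, Measurable fun W : Matrix (Fin d) (Fin d) ℝ =>
      ENNReal.ofReal (Real.exp (d / 2 * frobInner E W - d / 4 * frobInner E E)) := fun E =>
    (Real.measurable_exp.comp (((measurable_frobInner measurable_const measurable_id).const_mul
      _).sub_const _)).ennreal_ofReal
  have hH : Measurable fun W => G (A.history s (W + D₀) k) :=
    hG.comp (A.measurable_history_add s D₀ k)
  have h1 : ∫⁻ W, G (A.history s (W + (D₀ + D)) k) ∂γ =
      ∫⁻ W, ENNReal.ofReal (Real.exp (d / 2 * frobInner D W - d / 4 * frobInner D D)) *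
        G (A.history s (W + D₀) k) ∂γ := by
    have h := lintegral_withDensity_eq_lintegral_mul γ (hmexp D) hH
    rw [← hγ.map_add_right hd hD,
      lintegral_map hH (show Measurable fun W : Matrix (Fin d) (Fin d) ℝ => W + D from
        measurable_matrix_add measurable_id measurable_const)] at h
    simp only [add_assoc, add_comm D D₀] at h
    exact h
  rw [h1]
  -- Averaging over the unseen block leaves the history fixed, so only the density is averaged. It
  -- factors into the part Δ of the shift that is seen and the part P D P that is not.
  refine (hA.lintegral_resample s hD₀ hγ hk ((hmexp D).mul hH)).symm.trans ?_
  refine lintegral_congr_ae ?_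
  filter_upwards [hγ.symm] with W hW
  simp only [Pi.mul_apply, hA.history_resample s hD₀ hW hk]
  have hmr : Measurable fun X => ENNReal.ofReal (Real.exp
      (d / 2 * frobInner D (A.resample s D₀ k W X) - d / 4 * frobInner D D)) :=
    (hmexp D).comp ((A.measurable_resample s D₀ k).comp measurable_prodMk_left)
  rw [lintegral_mul_const _ hmr, mul_comm]
  congr 1
  set P := complProj (A.queryMatrix s (W + D₀) k) with hP
  have hPs : P.IsSymm := complProj_isSymm _
  have hPP : P * P = P := complProj_mul_complProj (hA.mem_stiefel s (hW.add hD₀) hk)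
  have h2 : ∀ X, ENNReal.ofReal (Real.exp (d / 2 * frobInner D (A.resample s D₀ k W X) -
      d / 4 * frobInner D D)) =
      ENNReal.ofReal (Real.exp (d / 2 * frobInner (Δ W) W - d / 4 * frobInner (Δ W) (Δ W))) *
      ENNReal.ofReal (Real.exp (d / 2 * frobInner (P * D * P) X -
        d / 4 * frobInner (P * D * P) (P * D * P))) := by
    intro X
    rw [← ENNReal.ofReal_mul (Real.exp_pos _).le, ← Real.exp_add, hΔ, ← hP, resample, ← hP]
    congr 2
    rw [frobInner_sub_compress hPs hPP, frobInner_add_right, frobInner_sub_right,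
      frobInner_sub_left, frobInner_compress hPs, frobInner_compress hPs]
    ring
  have hPD : (P * D * P).IsSymm := by
    rw [Matrix.IsSymm, Matrix.transpose_mul, Matrix.transpose_mul, hPs.eq, hD.eq, Matrix.mul_assoc]
  -- The unseen factor is the density of the law shifted by P D P, so it has total mass one.
  have h3 : ∫⁻ X, ENNReal.ofReal (Real.exp (d / 2 * frobInner (P * D * P) X -
        d / 4 * frobInner (P * D * P) (P * D * P))) ∂γ = 1 := by
    have hm : Measurable fun X : Matrix (Fin d) (Fin d) ℝ => X + P * D * P :=
      measurable_matrix_add measurable_id measurable_const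
    have : (γ.map (· + P * D * P)) Set.univ = 1 := by
      rw [Measure.map_apply hm MeasurableSet.univ, Set.preimage_univ, measure_univ]
    rw [hγ.map_add_right hd hPD, withDensity_apply _ MeasurableSet.univ,
      Measure.restrict_univ] at this
    exact this
  simp only [h2]
  rw [lintegral_const_mul _ (hmexp _), h3, mul_one]

/-- With z = |Vᵀ u|², the compression is λ (Pu)(Pu)ᵀ and |Pu|² = 1 - z. Hence the squared norm of Δ
is λ² (1 - (1 - z)²) ≤ 2 λ² z. -/
theorem frobInner_sub_compress_self {d k : ℕ} {V : Matrix (Fin d) (Fin k) ℝ}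
    (hV : V ∈ Stiefel d k) {u : Fin d → ℝ} (hu : u ⬝ᵥ u = 1) (lam : ℝ)
    {D Δ : Matrix (Fin d) (Fin d) ℝ} (hD : D = lam • Matrix.vecMulVec u u)
    (hΔ : Δ = D - complProj V * D * complProj V) :
    frobInner Δ Δ ≤ 2 * lam ^ 2 * ((Vᵀ *ᵥ u) ⬝ᵥ (Vᵀ *ᵥ u)) := by
  have hs := complProj_isSymm V
  have hP := complProj_mul_complProj hV
  have h1 : frobInner Δ Δ = frobInner D D - frobInner (complProj V * D * complProj V)
      (complProj V * D * complProj V) := by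
    rw [hΔ, frobInner_sub_compress hs hP]
  have h2 : complProj V * D * complProj V =
      lam • Matrix.vecMulVec (complProj V *ᵥ u) (complProj V *ᵥ u) := by
    rw [hD, Matrix.mul_smul, Matrix.smul_mul, Matrix.mul_vecMulVec, Matrix.vecMulVec_mul]
    congr 2
    rw [← Matrix.mulVec_transpose, hs.eq]
  have h3 : (complProj V *ᵥ u) ⬝ᵥ (complProj V *ᵥ u) = 1 - (Vᵀ *ᵥ u) ⬝ᵥ (Vᵀ *ᵥ u) := by
    rw [Matrix.dotProduct_mulVec, ← Matrix.mulVec_transpose, hs.eq, Matrix.mulVec_mulVec, hP,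
      complProj, Matrix.sub_mulVec, Matrix.one_mulVec, sub_dotProduct, hu, ← Matrix.mulVec_mulVec,
      dotProduct_comm, Matrix.dotProduct_mulVec, ← Matrix.mulVec_transpose]
  rw [h1, h2, hD]
  simp only [frobInner_smul_left, frobInner_smul_right, frobInner_vecMulVec, h3, hu]
  nlinarith [mul_nonneg (sq_nonneg lam) (sq_nonneg ((Vᵀ *ᵥ u) ⬝ᵥ (Vᵀ *ᵥ u)))]

/-- Convexity of exp with weights 1/p and 1 - 1/p. In the application l is the log-likelihood ratio
of the shift Δ, κ is d/4 times the squared norm of Δ, and A is the log-likelihood ratio of the shift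
p Δ. The free parameter η sets the size of the term of known mean. -/
theorem exp_le_young {p η l κ A : ℝ} (hp : 1 < p) (hη : 0 < η)
    (hA : A = p * l - p * (p - 1) * κ) :
    Real.exp l ≤ p⁻¹ * η * Real.exp A +
      (1 - p⁻¹) * η ^ (-(1 / (p - 1))) * Real.exp (p * κ) := by
  have hp0 : 0 < p := by linarith
  have hpi : p⁻¹ ≤ 1 := inv_le_one_of_one_le₀ hp.le
  have h := convexOn_exp.2 (Set.mem_univ (Real.log η + A))
    (Set.mem_univ (-(1 / (p - 1)) * Real.log η + p * κ)) (inv_pos.2 hp0).le (sub_nonneg.2 hpi)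
    (by ring)
  have hp1 : p - 1 ≠ 0 := by linarith
  have e : p⁻¹ • (Real.log η + A) + (1 - p⁻¹) • (-(1 / (p - 1)) * Real.log η + p * κ) = l := by
    simp only [smul_eq_mul, hA]
    field_simp
    ring
  rw [e, Real.exp_add, Real.exp_add, Real.exp_log hη, mul_comm (-(1 / (p - 1))),
    ← Real.rpow_def_of_pos hη] at h
  simp only [smul_eq_mul] at h
  linarith

/-- A truncated change of measure: an event about the history of an adaptive algorithm run on
`W + D₀ + lam • u uᵀ` is compared with the same event for `W + D₀`, at the cost of an exponential of
the overlap of the queries with `u`. -/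
theorem IsOrthonormal.lintegral_history_spike_le {T : ℕ} {A : QueryAlgorithm d S}
    (hA : A.IsOrthonormal T) (hd : 0 < d) (s : S) {D₀ : Matrix (Fin d) (Fin d) ℝ}
    (hD₀ : D₀.IsSymm) {u : Fin d → ℝ} (hu : u ⬝ᵥ u = 1) (lam : ℝ)
    {γ : Measure (Matrix (Fin d) (Fin d) ℝ)} [IsProbabilityMeasure γ] (hγ : IsGOELaw γ) {k : ℕ}
    (hk : k ≤ T) {G : (Fin k → (Fin d → ℝ) × (Fin d → ℝ)) → ENNReal} (hG : Measurable G)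
    (hG1 : ∀ h, G h ≤ 1) {p η : ℝ} (hp : 1 < p) (hη : 0 < η) :
    ∫⁻ W, G (A.history s (W + (D₀ + lam • Matrix.vecMulVec u u)) k) ∂γ ≤
      ENNReal.ofReal (p⁻¹ * η) +
      ∫⁻ W, G (A.history s (W + D₀) k) * ENNReal.ofReal ((1 - p⁻¹) * η ^ (-(1 / (p - 1))) *
        Real.exp (p * (d / 2 * lam ^ 2 * (((A.queryMatrix s (W + D₀) k)ᵀ *ᵥ u) ⬝ᵥ
          ((A.queryMatrix s (W + D₀) k)ᵀ *ᵥ u))))) ∂γ := by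
  have hp0 : 0 < p := by linarith
  have hpi : 0 ≤ 1 - p⁻¹ := sub_nonneg.2 (inv_le_one_of_one_le₀ hp.le)
  set D := lam • Matrix.vecMulVec u u with hD
  have hDs : D.IsSymm := by
    rw [hD, Matrix.IsSymm, Matrix.transpose_smul, Matrix.transpose_vecMulVec]
  set V := fun W => A.queryMatrix s (W + D₀) k with hV
  set Δ := fun W => D - complProj (V W) * D * complProj (V W) with hΔ
  have hVm : Measurable V := A.measurable_queryMatrix_add s D₀ k
  have hΔm : Measurable Δ := measurable_matrix_sub measurable_const (measurable_matrix_mul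
    (measurable_matrix_mul (measurable_complProj hVm) measurable_const) (measurable_complProj hVm))
  have hexpm : Measurable fun W => Real.exp (d / 2 * frobInner (p • Δ W) W -
      d / 4 * frobInner (p • Δ W) (p • Δ W)) := by
    have hpΔ : Measurable fun W => p • Δ W := measurable_matrix_smul measurable_const hΔm
    exact Real.measurable_exp.comp (((measurable_frobInner hpΔ measurable_id).const_mul _).sub
      ((measurable_frobInner hpΔ hpΔ).const_mul _))
  -- The tilted exponential is the likelihood ratio for the spike p D. The change of measure with G
  -- = 1 shows that its mean is one.
  have h1 : ∫⁻ W, ENNReal.ofReal (Real.exp (d / 2 * frobInner (p • Δ W) W -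
      d / 4 * frobInner (p • Δ W) (p • Δ W))) ∂γ = 1 := by
    have h := hA.lintegral_history_add hd s hD₀ (hDs.smul p) hγ hk (G := fun _ => 1)
      measurable_const (Δ := fun W => p • Δ W) (fun W => by
        simp only [hΔ, hV, smul_sub, Matrix.mul_smul, Matrix.smul_mul])
    simpa using h.symm
  rw [hA.lintegral_history_add hd s hD₀ hDs hγ hk hG (Δ := Δ) fun W => rfl]
  calc ∫⁻ W, G (A.history s (W + D₀) k) *
        ENNReal.ofReal (Real.exp (d / 2 * frobInner (Δ W) W - d / 4 * frobInner (Δ W) (Δ W))) ∂γ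
      ≤ ∫⁻ W, (ENNReal.ofReal (p⁻¹ * η) * ENNReal.ofReal (Real.exp
          (d / 2 * frobInner (p • Δ W) W - d / 4 * frobInner (p • Δ W) (p • Δ W))) +
        G (A.history s (W + D₀) k) * ENNReal.ofReal ((1 - p⁻¹) * η ^ (-(1 / (p - 1))) *
          Real.exp (p * (d / 2 * lam ^ 2 * (((V W)ᵀ *ᵥ u) ⬝ᵥ ((V W)ᵀ *ᵥ u)))))) ∂γ := by
        refine lintegral_mono_ae ?_
        filter_upwards [hγ.symm] with W hW
        have hb := frobInner_sub_compress_self (hA.mem_stiefel s (hW.add hD₀) hk) hu lam hD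
          (Δ := Δ W) rfl
        have hy := exp_le_young (l := d / 2 * frobInner (Δ W) W - d / 4 * frobInner (Δ W) (Δ W))
          (κ := d / 4 * frobInner (Δ W) (Δ W)) hp hη
          (A := d / 2 * frobInner (p • Δ W) W - d / 4 * frobInner (p • Δ W) (p • Δ W)) (by
            simp only [frobInner_smul_left, frobInner_smul_right]
            ring)
        have hle : Real.exp (p * (d / 4 * frobInner (Δ W) (Δ W))) ≤
            Real.exp (p * (d / 2 * lam ^ 2 * (((V W)ᵀ *ᵥ u) ⬝ᵥ ((V W)ᵀ *ᵥ u)))) := by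
          refine Real.exp_le_exp.2 (mul_le_mul_of_nonneg_left ?_ hp0.le)
          have hd' : (0 : ℝ) ≤ d := Nat.cast_nonneg d
          calc (d / 4 * frobInner (Δ W) (Δ W) : ℝ) ≤ d / 4 * _ :=
                mul_le_mul_of_nonneg_left hb (by positivity)
            _ = _ := by ring
        have hc : 0 ≤ (1 - p⁻¹) * η ^ (-(1 / (p - 1))) :=
          mul_nonneg hpi (Real.rpow_nonneg hη.le _)
        have hy' := hy.trans (add_le_add_right (mul_le_mul_of_nonneg_left hle hc) _)
        calc _ ≤ G (A.history s (W + D₀) k) * ENNReal.ofReal _ :=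
              mul_le_mul_right (ENNReal.ofReal_le_ofReal hy') _
          _ ≤ _ := by
              rw [ENNReal.ofReal_add (by positivity) (by positivity), mul_add,
                ← ENNReal.ofReal_mul (by positivity)]
              exact add_le_add_left (mul_le_of_le_one_left zero_le (hG1 _)) _
    _ = _ := by
        rw [lintegral_add_left (hexpm.ennreal_ofReal.const_mul _),
          lintegral_const_mul _ hexpm.ennreal_ofReal, h1, mul_one]

end QueryAlgorithm

/-! ### Gaussian vectors: rotation invariance and χ² moments. -/

/-- The standard Gaussian measure on `ℝ^d`. -/
noncomputable def stdGaussianPi (d : ℕ) : Measure (Fin d → ℝ) :=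
  Measure.pi fun _ => gaussianReal 0 1

instance (d : ℕ) : IsProbabilityMeasure (stdGaussianPi d) := by
  unfold stdGaussianPi
  infer_instance

theorem measurable_mulVec {α : Type*} [MeasurableSpace α] {m n : ℕ}
    {f : α → Matrix (Fin m) (Fin n) ℝ} {g : α → Fin n → ℝ}
    (hf : Measurable f) (hg : Measurable g) : Measurable fun x => f x *ᵥ g x := by
  rw [measurable_matrix_iff] at hf
  refine measurable_pi_lambda _ fun i => ?_
  simp only [Matrix.mulVec, dotProduct]
  exact Finset.measurable_sum _ fun j _ => (hf i j).mul ((measurable_pi_apply j).comp hg)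

theorem measurable_dotProduct {α : Type*} [MeasurableSpace α] {n : ℕ}
    {f g : α → Fin n → ℝ} (hf : Measurable f) (hg : Measurable g) :
    Measurable fun x => f x ⬝ᵥ g x :=
  Finset.measurable_sum _ fun j _ =>
    ((measurable_pi_apply j).comp hf).mul ((measurable_pi_apply j).comp hg)

theorem measurable_vecMulVec {α : Type*} [MeasurableSpace α] {m n : ℕ}
    {f : α → Fin m → ℝ} {g : α → Fin n → ℝ} (hf : Measurable f) (hg : Measurable g) :
    Measurable fun x => Matrix.vecMulVec (f x) (g x) :=
  measurable_matrix_iff.2 fun i j =>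
    ((measurable_pi_apply i).comp hf).mul ((measurable_pi_apply j).comp hg)

theorem integral_cexp_stdGaussianPi {d : ℕ} (t : Fin d → ℝ) :
    ∫ g, Complex.exp ((t ⬝ᵥ g : ℝ) * Complex.I) ∂(stdGaussianPi d) =
      Complex.exp (-(t ⬝ᵥ t / 2 : ℝ)) := by
  have h1 : ∀ z : ℂ, ∫ x, Complex.exp (z * (x : ℂ)) ∂(gaussianReal 0 1) =
      Complex.exp (z ^ 2 / 2) := by
    intro z
    have := complexMGF_gaussianReal (p := gaussianReal 0 1) (X := id) (μ := 0) (v := 1)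
      Measure.map_id z
    simpa [complexMGF] using this
  have h2 : ∀ g : Fin d → ℝ, Complex.exp ((t ⬝ᵥ g : ℝ) * Complex.I) =
      ∏ i, Complex.exp ((t i * Complex.I) * (g i : ℂ)) := by
    intro g
    rw [← Complex.exp_sum]
    congr 1
    simp only [dotProduct]
    push_cast
    rw [Finset.sum_mul]
    exact Finset.sum_congr rfl fun i _ => by ring
  simp only [h2, stdGaussianPi]
  rw [integral_fintype_prod_eq_prod (𝕜 := ℂ)
    (fun (i : Fin d) (x : ℝ) => Complex.exp ((t i * Complex.I) * (x : ℂ)))]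
  simp only [h1]
  rw [← Complex.exp_sum]
  congr 1
  simp only [dotProduct]
  push_cast
  rw [Finset.sum_div, ← Finset.sum_neg_distrib]
  refine Finset.sum_congr rfl fun i _ => ?_
  rw [mul_pow, Complex.I_sq]
  ring

theorem measure_vec_ext {d : ℕ} {μ ν : Measure (Fin d → ℝ)} [IsFiniteMeasure μ] [IsFiniteMeasure ν]
    (h : ∀ t : Fin d → ℝ, ∫ g, Complex.exp ((t ⬝ᵥ g : ℝ) * Complex.I) ∂μ =
      ∫ g, Complex.exp ((t ⬝ᵥ g : ℝ) * Complex.I) ∂ν) : μ = ν := by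
  refine Measure.ext_of_charFunDual ?_
  funext L
  rw [charFunDual_apply, charFunDual_apply]
  have key : ∀ X : Fin d → ℝ, L X = (fun i => L (Pi.single i 1)) ⬝ᵥ X := by
    intro X
    have hX : X = ∑ i, X i • (Pi.single i (1 : ℝ) : Fin d → ℝ) := by
      ext i
      simp [Finset.sum_apply, Pi.single_apply]
    conv_lhs => rw [hX]
    simp only [map_sum, map_smul, smul_eq_mul, dotProduct]
    exact Finset.sum_congr rfl fun i _ => mul_comm _ _
  have h' : ∀ ρ : Measure (Fin d → ℝ), ∫ X, Complex.exp (L X * Complex.I) ∂ρ =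
      ∫ X, Complex.exp (((fun i => L (Pi.single i 1)) ⬝ᵥ X : ℝ) * Complex.I) ∂ρ :=
    fun ρ => integral_congr_ae <| Filter.Eventually.of_forall fun X =>
      congrArg (fun t : ℝ => Complex.exp (t * Complex.I)) (key X)
  rw [h', h', h]

/-- The standard Gaussian measure is rotation invariant. -/
theorem map_mulVec_stdGaussianPi {d : ℕ} {Q : Matrix (Fin d) (Fin d) ℝ} (hQ : Q * Qᵀ = 1) :
    (stdGaussianPi d).map (fun g => Q *ᵥ g) = stdGaussianPi d := by
  have hm : Measurable fun g : Fin d → ℝ => Q *ᵥ g :=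
    measurable_mulVec measurable_const measurable_id
  have : IsProbabilityMeasure ((stdGaussianPi d).map fun g => Q *ᵥ g) :=
    Measure.isProbabilityMeasure_map hm.aemeasurable
  refine measure_vec_ext fun t => ?_
  rw [integral_map hm.aemeasurable]
  swap
  · refine Measurable.aestronglyMeasurable (Complex.measurable_exp.comp ?_)
    exact (Complex.measurable_ofReal.comp
      (measurable_dotProduct measurable_const measurable_id)).mul_const _
  have h : ∀ g : Fin d → ℝ, t ⬝ᵥ (Q *ᵥ g) = (Qᵀ *ᵥ t) ⬝ᵥ g := by
    intro g
    rw [Matrix.dotProduct_mulVec, Matrix.mulVec_transpose]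
  simp only [h]
  rw [integral_cexp_stdGaussianPi, integral_cexp_stdGaussianPi, Matrix.dotProduct_mulVec,
    ← Matrix.mulVec_transpose, Matrix.transpose_transpose, Matrix.mulVec_mulVec, hQ,
    Matrix.one_mulVec]

theorem lintegral_prod_stdGaussianPi {d : ℕ} {f : Fin d → ℝ → ℝ} (hf : ∀ i x, 0 ≤ f i x)
    (hi : ∀ i, Integrable (f i) (gaussianReal 0 1)) :
    ∫⁻ g, ENNReal.ofReal (∏ i, f i (g i)) ∂(stdGaussianPi d) =
      ENNReal.ofReal (∏ i, ∫ x, f i x ∂(gaussianReal 0 1)) := by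
  rw [stdGaussianPi, ← integral_fintype_prod_eq_prod (𝕜 := ℝ),
    ofReal_integral_eq_lintegral_ofReal (Integrable.fintype_prod hi)]
  exact Filter.Eventually.of_forall fun g => Finset.prod_nonneg fun i _ => hf i _

theorem lintegral_exp_dotProduct {d : ℕ} (t : Fin d → ℝ) :
    ∫⁻ g, ENNReal.ofReal (Real.exp (t ⬝ᵥ g)) ∂(stdGaussianPi d) =
      ENNReal.ofReal (Real.exp (t ⬝ᵥ t / 2)) := by
  have h1 : ∀ s : ℝ, ∫ x, Real.exp (s * x) ∂(gaussianReal 0 1) = Real.exp (s * s / 2) := by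
    intro s
    have := mgf_gaussianReal (p := gaussianReal 0 1) (X := id) (μ := 0) (v := 1)
      Measure.map_id s
    simpa [mgf, sq] using this
  have h := lintegral_prod_stdGaussianPi (f := fun i x => Real.exp (t i * x))
    (fun i x => (Real.exp_pos _).le) (fun i => integrable_exp_mul_gaussianReal _)
  simp only [h1, ← Real.exp_sum, ← Finset.sum_div] at h
  exact h

theorem integral_exp_sq_gaussianReal {θ : ℝ} (hθ : θ < 1 / 2) :
    Integrable (fun x : ℝ => Real.exp (θ * x ^ 2)) (gaussianReal 0 1) ∧
      ∫ x, Real.exp (θ * x ^ 2) ∂(gaussianReal 0 1) = (1 - 2 * θ) ^ (-(1 / 2) : ℝ) := by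
  have hb : 0 < 1 / 2 - θ := by linarith
  have e : ∀ x : ℝ, gaussianPDFReal 0 1 x * Real.exp (θ * x ^ 2) =
      (√(2 * Real.pi))⁻¹ * Real.exp (-(1 / 2 - θ) * x ^ 2) := by
    intro x
    rw [gaussianPDFReal, mul_assoc, ← Real.exp_add]
    simp only [NNReal.coe_one, mul_one, sub_zero]
    ring_nf
  constructor
  · rw [gaussianReal_of_var_ne_zero 0 one_ne_zero,
      integrable_withDensity_iff (measurable_gaussianPDF 0 1)
        (Filter.Eventually.of_forall fun x => gaussianPDF_lt_top)]
    have : ∀ x : ℝ, Real.exp (θ * x ^ 2) * (gaussianPDF 0 1 x).toReal =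
        (√(2 * Real.pi))⁻¹ * Real.exp (-(1 / 2 - θ) * x ^ 2) := by
      intro x
      rw [← e, toReal_gaussianPDF, mul_comm]
    simp only [this]
    exact (integrable_exp_neg_mul_sq hb).const_mul _
  · rw [integral_gaussianReal_eq_integral_smul one_ne_zero]
    simp only [smul_eq_mul, e]
    rw [integral_const_mul, integral_gaussian, ← Real.sqrt_inv, ← Real.sqrt_mul (by positivity),
      Real.rpow_neg (by linarith), ← Real.sqrt_eq_rpow, ← Real.sqrt_inv]
    congr 1
    have : (1 - 2 * θ) ≠ 0 := by linarith
    have hpi := Real.pi_ne_zero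
    field_simp

theorem lintegral_exp_sq_stdGaussianPi {k : ℕ} {θ : ℝ} (hθ : θ < 1 / 2) :
    ∫⁻ g, ENNReal.ofReal (Real.exp (θ * (g ⬝ᵥ g))) ∂(stdGaussianPi k) =
      ENNReal.ofReal ((1 - 2 * θ) ^ (-(k / 2) : ℝ)) := by
  have h := lintegral_prod_stdGaussianPi (f := fun (_ : Fin k) x => Real.exp (θ * x ^ 2))
    (fun i x => (Real.exp_pos _).le) (fun i => (integral_exp_sq_gaussianReal hθ).1)
  simp only [(integral_exp_sq_gaussianReal hθ).2, ← Real.exp_sum, ← Finset.mul_sum,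
    Finset.prod_const, Finset.card_univ, Fintype.card_fin] at h
  rw [← Real.rpow_natCast, ← Real.rpow_mul (by linarith)] at h
  convert h using 3
  · simp only [dotProduct, sq]
  · ring

theorem dotProduct_mulVec_self_le {d : ℕ} {P : Matrix (Fin d) (Fin d) ℝ} (hP : P.IsSymm)
    (hPP : P * P = P) (x : Fin d → ℝ) : (P *ᵥ x) ⬝ᵥ (P *ᵥ x) ≤ x ⬝ᵥ x := by
  have h1 : (P *ᵥ x) ⬝ᵥ (P *ᵥ x) = x ⬝ᵥ (P *ᵥ x) := by
    rw [Matrix.dotProduct_mulVec, ← Matrix.mulVec_transpose, hP.eq, Matrix.mulVec_mulVec, hPP,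
      dotProduct_comm]
  have h2 : 0 ≤ (x - P *ᵥ x) ⬝ᵥ (x - P *ᵥ x) := Finset.sum_nonneg fun _ _ => mul_self_nonneg _
  rw [sub_dotProduct, dotProduct_sub, dotProduct_sub, h1, dotProduct_comm (P *ᵥ x) x] at h2
  linarith

theorem dotProduct_self_nonneg_real {n : ℕ} (x : Fin n → ℝ) : 0 ≤ x ⬝ᵥ x :=
  Finset.sum_nonneg fun _ _ => mul_self_nonneg _

theorem stiefel_mulVec_dotProduct {d k : ℕ} {V : Matrix (Fin d) (Fin k) ℝ} (hV : V ∈ Stiefel d k)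
    (x : Fin k → ℝ) : (V *ᵥ x) ⬝ᵥ (V *ᵥ x) = x ⬝ᵥ x := by
  rw [Matrix.dotProduct_mulVec, ← Matrix.mulVec_transpose, Matrix.mulVec_mulVec,
    show Vᵀ * V = 1 from hV, Matrix.one_mulVec]

/-- The moment generating function of `‖Vᵀ P g‖²`, for `V` with `k` orthonormal columns, a
projection `P` and a standard Gaussian vector `g`, is at most that of a `χ²` variable. -/
theorem lintegral_exp_sq_proj_le {d k : ℕ} {V : Matrix (Fin d) (Fin k) ℝ} (hV : V ∈ Stiefel d k)
    {P : Matrix (Fin d) (Fin d) ℝ} (hP : P.IsSymm) (hPP : P * P = P) {θ : ℝ} (hθ0 : 0 ≤ θ)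
    (hθ : θ < 1 / 2) :
    ∫⁻ g, ENNReal.ofReal (Real.exp (θ * ((Vᵀ *ᵥ (P *ᵥ g)) ⬝ᵥ (Vᵀ *ᵥ (P *ᵥ g)))))
      ∂(stdGaussianPi d) ≤ ENNReal.ofReal ((1 - 2 * θ) ^ (-(k / 2) : ℝ)) := by
  have hs : √(2 * θ) * √(2 * θ) = 2 * θ := Real.mul_self_sqrt (by linarith)
  -- The Gaussian square is linearised: exp(θ|y|²) is the mean of exp(√(2θ) y·h) over a standard
  -- Gaussian h. After swapping the integrals only |P V h| ≤ |h| is needed.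
  have h1 : ∀ g : Fin d → ℝ,
      ENNReal.ofReal (Real.exp (θ * ((Vᵀ *ᵥ (P *ᵥ g)) ⬝ᵥ (Vᵀ *ᵥ (P *ᵥ g))))) =
      ∫⁻ h, ENNReal.ofReal (Real.exp ((√(2 * θ) • (P *ᵥ (V *ᵥ h))) ⬝ᵥ g)) ∂(stdGaussianPi k) := by
    intro g
    have e : ∀ h : Fin k → ℝ, (√(2 * θ) • (P *ᵥ (V *ᵥ h))) ⬝ᵥ g =
        (√(2 * θ) • (Vᵀ *ᵥ (P *ᵥ g))) ⬝ᵥ h := by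
      intro h
      rw [smul_dotProduct, smul_dotProduct, dotProduct_comm, Matrix.dotProduct_mulVec,
        ← Matrix.mulVec_transpose, hP.eq, Matrix.dotProduct_mulVec, ← Matrix.mulVec_transpose]
    simp only [e]
    rw [lintegral_exp_dotProduct, smul_dotProduct, dotProduct_smul, smul_smul, hs, smul_eq_mul]
    congr 2
    ring
  simp only [h1]
  have hm : Measurable fun x : (Fin d → ℝ) × (Fin k → ℝ) =>
      ENNReal.ofReal (Real.exp ((√(2 * θ) • (P *ᵥ (V *ᵥ x.2))) ⬝ᵥ x.1)) := by
    refine (Real.measurable_exp.comp (measurable_dotProduct ?_ measurable_fst)).ennreal_ofReal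
    have h2 : Measurable fun x : (Fin d → ℝ) × (Fin k → ℝ) => P *ᵥ (V *ᵥ x.2) :=
      measurable_mulVec measurable_const (measurable_mulVec measurable_const measurable_snd)
    exact h2.const_smul (√(2 * θ))
  rw [lintegral_lintegral_swap hm.aemeasurable, ← lintegral_exp_sq_stdGaussianPi hθ]
  refine lintegral_mono fun h => ?_
  rw [lintegral_exp_dotProduct]
  refine ENNReal.ofReal_le_ofReal (Real.exp_le_exp.2 ?_)
  rw [smul_dotProduct, dotProduct_smul, smul_smul, hs, smul_eq_mul]
  have := dotProduct_mulVec_self_le hP hPP (V *ᵥ h)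
  rw [stiefel_mulVec_dotProduct hV] at this
  nlinarith

theorem integral_dotProduct_proj_stdGaussianPi {d : ℕ} {P : Matrix (Fin d) (Fin d) ℝ}
    (hP : P.IsSymm) (hPP : P * P = P) :
    Integrable (fun g => (P *ᵥ g) ⬝ᵥ (P *ᵥ g)) (stdGaussianPi d) ∧
      ∫ g, (P *ᵥ g) ⬝ᵥ (P *ᵥ g) ∂(stdGaussianPi d) = P.trace := by
  have hmp : ∀ i : Fin d, MeasurePreserving (Function.eval i) (stdGaussianPi d)
      (gaussianReal 0 1) := fun i => measurePreserving_eval _ i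
  have hL2 : ∀ i : Fin d, MemLp (fun g : Fin d → ℝ => g i) 2 (stdGaussianPi d) := fun i =>
    (memLp_id_gaussianReal (μ := 0) (v := 1) 2).comp_measurePreserving (hmp i)
  have hint : ∀ i j : Fin d, Integrable (fun g : Fin d → ℝ => g i * g j) (stdGaussianPi d) :=
    fun i j => (hL2 i).integrable_mul (hL2 j)
  have hmean : ∀ i : Fin d, ∫ g, g i ∂(stdGaussianPi d) = 0 := by
    intro i
    rw [← integral_id_gaussianReal (μ := 0) (v := 1), ← (hmp i).map_eq,
      integral_map (f := fun x : ℝ => x) (hmp i).measurable.aemeasurable aestronglyMeasurable_id]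
  have hval : ∀ i j : Fin d, ∫ g, g i * g j ∂(stdGaussianPi d) = if i = j then 1 else 0 := by
    intro i j
    split_ifs with hij
    · subst hij
      have hv := variance_id_gaussianReal (μ := 0) (v := 1)
      rw [variance_eq_integral aemeasurable_id, ← (hmp i).map_eq,
        integral_map (hmp i).measurable.aemeasurable aestronglyMeasurable_id,
        integral_map (hmp i).measurable.aemeasurable
          (by exact Measurable.aestronglyMeasurable (by fun_prop))] at hv
      simp only [id, Function.eval, hmean, sub_zero, sq] at hv
      simpa using hv
    · have hI : iIndepFun (fun (i : Fin d) (g : Fin d → ℝ) => g i) (stdGaussianPi d) :=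
        iIndepFun_pi (X := fun _ => id) (fun _ => aemeasurable_id)
      rw [(hI.indepFun hij).integral_fun_mul_eq_mul_integral
        (measurable_pi_apply i).aestronglyMeasurable (measurable_pi_apply j).aestronglyMeasurable,
        hmean, zero_mul]
  set p : Fin d → Fin d → ℝ := fun i j => P i j with hp
  have e : ∀ g : Fin d → ℝ, (P *ᵥ g) ⬝ᵥ (P *ᵥ g) = ∑ i, ∑ j, p i j * (g i * g j) := by
    intro g
    rw [Matrix.dotProduct_mulVec, ← Matrix.mulVec_transpose, hP.eq, Matrix.mulVec_mulVec, hPP,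
      dotProduct_comm]
    simp only [dotProduct, Matrix.mulVec, Finset.mul_sum]
    exact Finset.sum_congr rfl fun i _ => Finset.sum_congr rfl fun j _ => by ring
  simp only [e]
  refine ⟨integrable_finsetSum _ fun i _ => integrable_finsetSum _ fun j _ =>
    (hint i j).const_mul _, ?_⟩
  rw [integral_finsetSum _ fun i _ => integrable_finsetSum _ fun j _ => (hint i j).const_mul _]
  refine Finset.sum_congr rfl fun i _ => ?_
  rw [integral_finsetSum _ fun j _ => (hint i j).const_mul _]
  simp [integral_const_mul, hval, hp]

theorem ofReal_integral_le_lintegral_ofReal {α : Type*} [MeasurableSpace α] {μ : Measure α}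
    {f : α → ℝ} (hf : Integrable f μ) :
    ENNReal.ofReal (∫ x, f x ∂μ) ≤ ∫⁻ x, ENNReal.ofReal (f x) ∂μ := by
  calc ENNReal.ofReal (∫ x, f x ∂μ) ≤ ENNReal.ofReal (∫ x, max (f x) 0 ∂μ) :=
        ENNReal.ofReal_le_ofReal (integral_mono hf hf.pos_part fun x => le_max_left _ _)
    _ = ∫⁻ x, ENNReal.ofReal (max (f x) 0) ∂μ :=
        ofReal_integral_eq_lintegral_ofReal hf.pos_part
          (Filter.Eventually.of_forall fun x => le_max_right _ _)
    _ = _ := by simp [ENNReal.ofReal_max]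

/-- Jensen's inequality by the tangent line of exp at the mean. The lower integral on the right
makes integrability of exp X unnecessary. -/
theorem ofReal_exp_integral_le {α : Type*} [MeasurableSpace α] {μ : Measure α}
    [IsProbabilityMeasure μ] {X : α → ℝ} (hX : Integrable X μ) :
    ENNReal.ofReal (Real.exp (∫ x, X x ∂μ)) ≤ ∫⁻ x, ENNReal.ofReal (Real.exp (X x)) ∂μ := by
  set m := ∫ x, X x ∂μ with hm
  have hi : Integrable (fun x => Real.exp m * (X x - m + 1)) μ :=
    ((hX.sub (integrable_const m)).add (integrable_const 1)).const_mul _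
  have h1 : ∫ x, Real.exp m * (X x - m + 1) ∂μ = Real.exp m := by
    have hs : Integrable (fun x => X x - m) μ := hX.sub (integrable_const m)
    rw [integral_const_mul, integral_add hs (integrable_const 1),
      integral_sub hX (integrable_const m)]
    simp [← hm]
  calc ENNReal.ofReal (Real.exp m) = ENNReal.ofReal (∫ x, Real.exp m * (X x - m + 1) ∂μ) := by
        rw [h1]
    _ ≤ ∫⁻ x, ENNReal.ofReal (Real.exp m * (X x - m + 1)) ∂μ :=
        ofReal_integral_le_lintegral_ofReal hi
    _ ≤ _ := by
        refine lintegral_mono fun x => ENNReal.ofReal_le_ofReal ?_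
        have := Real.add_one_le_exp (X x - m)
        calc _ ≤ Real.exp m * Real.exp (X x - m) :=
              mul_le_mul_of_nonneg_left this (Real.exp_pos _).le
          _ = _ := by rw [← Real.exp_add]; congr 1; ring

/-! ### Random rotations and reflections. -/

/-- There is a right-invariant probability measure carried by the orthogonal group. -/
theorem exists_invariant_orthogonal (d : ℕ) : ∃ H : Measure (Matrix (Fin d) (Fin d) ℝ),
    IsProbabilityMeasure H ∧ (∀ᵐ Q ∂H, Q * Qᵀ = 1) ∧
    ∀ R : Matrix (Fin d) (Fin d) ℝ, R * Rᵀ = 1 →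
      ∀ F : Matrix (Fin d) (Fin d) ℝ → ENNReal, Measurable F →
        ∫⁻ Q, F (Q * R) ∂H = ∫⁻ Q, F Q ∂H := by
  let O := Matrix.orthogonalGroup (Fin d) ℝ
  have hcl : IsClosed {Q : Matrix (Fin d) (Fin d) ℝ | Q * Qᵀ = 1} :=
    isClosed_eq (by fun_prop) continuous_const
  have hcpt : IsCompact {Q : Matrix (Fin d) (Fin d) ℝ | Q * Qᵀ = 1} := by
    have hbox : IsCompact (Set.univ.pi fun _ : Fin d => Set.univ.pi fun _ : Fin d =>
        Set.Icc (-1 : ℝ) 1) :=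
      isCompact_univ_pi fun _ => isCompact_univ_pi fun _ => isCompact_Icc
    refine hbox.of_isClosed_subset hcl fun (Q : Matrix (Fin d) (Fin d) ℝ) hQ => ?_
    intro i _ j _
    have h := congrFun (congrFun (show Q * Qᵀ = 1 from hQ) i) i
    rw [Matrix.mul_apply, Matrix.one_apply_eq] at h
    simp only [Matrix.transpose_apply] at h
    have h2 : Q i j * Q i j ≤ 1 := by
      rw [← h]
      exact Finset.single_le_sum (f := fun l => Q i l * Q i l) (fun l _ => mul_self_nonneg _)
        (Finset.mem_univ j)
    exact abs_le.1 (abs_le_one_iff_mul_self_le_one.2 h2)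
  have hO : (O : Set (Matrix (Fin d) (Fin d) ℝ)) = {Q | Q * Qᵀ = 1} := by
    ext Q
    exact Matrix.mem_orthogonalGroup_iff (Fin d) ℝ
  have : CompactSpace O := isCompact_iff_compactSpace.1 (hO ▸ hcpt)
  let : MeasurableSpace O := borel O
  have : BorelSpace O := ⟨rfl⟩
  let m : Measure O := Measure.haar
  have hm0 : m Set.univ ≠ 0 := by
    exact (isOpen_univ.measure_pos m Set.univ_nonempty).ne'
  have hmt : m Set.univ ≠ ⊤ := measure_ne_top _ _
  -- Pushing forward by inversion turns left-invariant Haar measure into a right-invariant one.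
  have hval : Measurable fun Q : O => ((Q⁻¹ : O) : Matrix (Fin d) (Fin d) ℝ) :=
    (continuous_subtype_val.comp continuous_inv).measurable
  refine ⟨(m Set.univ)⁻¹ • m.map fun Q : O => ((Q⁻¹ : O) : Matrix (Fin d) (Fin d) ℝ), ?_, ?_, ?_⟩
  · refine ⟨?_⟩
    rw [Measure.smul_apply, Measure.map_apply hval MeasurableSet.univ, Set.preimage_univ,
      smul_eq_mul, ENNReal.inv_mul_cancel hm0 hmt]
  · refine Measure.ae_smul_measure ?_ _
    rw [ae_map_iff hval.aemeasurable hcl.measurableSet]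
    exact Filter.Eventually.of_forall fun Q => (Matrix.mem_orthogonalGroup_iff (Fin d) ℝ).1 (Q⁻¹).2
  · intro R hR F hF
    have hFR : Measurable fun Q => F (Q * R) :=
      hF.comp (measurable_matrix_mul measurable_id measurable_const)
    rw [lintegral_smul_measure, lintegral_smul_measure, lintegral_map hFR hval,
      lintegral_map hF hval]
    let R' : O := ⟨R, (Matrix.mem_orthogonalGroup_iff (Fin d) ℝ).2 hR⟩
    have h := lintegral_mul_left_eq_self (μ := m)
      (fun Q : O => F ((Q⁻¹ : O) : Matrix (Fin d) (Fin d) ℝ)) R'⁻¹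
    rw [← h]
    simp only [mul_inv_rev]
    rfl

/-- A rotation (Householder reflection) exchanging two unit vectors and fixing everything
orthogonal to both. -/
theorem exists_reflection {d : ℕ} {u v : Fin d → ℝ} (hu : u ⬝ᵥ u = 1) (hv : v ⬝ᵥ v = 1) :
    ∃ R : Matrix (Fin d) (Fin d) ℝ, R * Rᵀ = 1 ∧ R *ᵥ u = v ∧
      ∀ x : Fin d → ℝ, x ⬝ᵥ u = 0 → x ⬝ᵥ v = 0 → R *ᵥ x = x := by
  by_cases h : u = v
  · exact ⟨1, by simp, by simp [h], by simp⟩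
  set w := u - v with hw
  have hw0 : w ⬝ᵥ w ≠ 0 := by
    rw [Ne, dotProduct_self_eq_zero]
    exact sub_ne_zero.2 h
  have hww : w ⬝ᵥ w = 2 * (w ⬝ᵥ u) := by
    simp only [hw, sub_dotProduct, dotProduct_sub, hu, hv, dotProduct_comm v u]
    ring
  set R : Matrix (Fin d) (Fin d) ℝ := 1 - (2 / (w ⬝ᵥ w)) • Matrix.vecMulVec w w with hR
  have hRx : ∀ x, R *ᵥ x = x - (2 / (w ⬝ᵥ w) * (w ⬝ᵥ x)) • w := by
    intro x
    rw [hR, Matrix.sub_mulVec, Matrix.one_mulVec, Matrix.smul_mulVec, Matrix.vecMulVec_mulVec]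
    ext i
    simp
    ring
  refine ⟨R, ?_, ?_, fun x hxu hxv => ?_⟩
  · have hRt : Rᵀ = R := by
      rw [hR, Matrix.transpose_sub, Matrix.transpose_one, Matrix.transpose_smul,
        Matrix.transpose_vecMulVec]
    rw [hRt]
    refine Matrix.ext_of_mulVec_single fun i => ?_
    have e : ∀ (x : Fin d → ℝ) (c : ℝ), w ⬝ᵥ (x - c • w) = w ⬝ᵥ x - c * (w ⬝ᵥ w) := by
      intro x c
      rw [dotProduct_sub w, dotProduct_smul, smul_eq_mul]
    rw [← Matrix.mulVec_mulVec, hRx, hRx, e, Matrix.one_mulVec]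
    ext j
    simp only [Pi.sub_apply, Pi.smul_apply, smul_eq_mul]
    clear_value w
    field_simp
    ring
  · rw [hRx, hww]
    have : w ⬝ᵥ u ≠ 0 := by
      intro h0
      rw [hww, h0, mul_zero] at hw0
      exact hw0 rfl
    have e : 2 / (2 * (w ⬝ᵥ u)) * (w ⬝ᵥ u) = 1 := by field_simp
    rw [e, one_smul, hw]
    abel
  · have : w ⬝ᵥ x = 0 := by
      rw [dotProduct_comm, hw, dotProduct_sub, hxu, hxv, sub_zero]
    rw [hRx, this]
    simp

/-! ### Splitting off and redrawing one direction of U. -/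

/-- The matrix `U (1 - a aᵀ)`. -/
noncomputable def dropDir {d r : ℕ} (a : Fin r → ℝ) (U : Matrix (Fin d) (Fin r) ℝ) :
    Matrix (Fin d) (Fin r) ℝ :=
  U - Matrix.vecMulVec (U *ᵥ a) a

section dropDir

variable {d r : ℕ} {a : Fin r → ℝ}

theorem dropDir_add (U : Matrix (Fin d) (Fin r) ℝ) :
    dropDir a U + Matrix.vecMulVec (U *ᵥ a) a = U := by
  simp [dropDir]

theorem mul_dropDir (Q : Matrix (Fin d) (Fin d) ℝ) (U : Matrix (Fin d) (Fin r) ℝ) :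
    dropDir a (Q * U) = Q * dropDir a U := by
  rw [dropDir, dropDir, Matrix.mul_sub, Matrix.mul_vecMulVec, Matrix.mulVec_mulVec]

theorem dropDir_mulVec (ha : a ⬝ᵥ a = 1) (U : Matrix (Fin d) (Fin r) ℝ) :
    dropDir a U *ᵥ a = 0 := by
  rw [dropDir, Matrix.sub_mulVec, Matrix.vecMulVec_mulVec, ha]
  simp

theorem dropDir_add_vecMulVec (ha : a ⬝ᵥ a = 1) (U : Matrix (Fin d) (Fin r) ℝ)
    (x : Fin d → ℝ) : (dropDir a U + Matrix.vecMulVec x a) *ᵥ a = x ∧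
      dropDir a (dropDir a U + Matrix.vecMulVec x a) = dropDir a U := by
  have h : (dropDir a U + Matrix.vecMulVec x a) *ᵥ a = x := by
    rw [Matrix.add_mulVec, dropDir_mulVec ha, Matrix.vecMulVec_mulVec, ha]
    simp
  refine ⟨h, ?_⟩
  conv_lhs => rw [dropDir, h]
  abel

/-- The matrix `dropDir a U` is only a partial isometry with kernel spanned by a. That still makes
its `complProj` a projection, of rank d - r + 1. -/
theorem dropDir_transpose_mul (ha : a ⬝ᵥ a = 1) {U : Matrix (Fin d) (Fin r) ℝ}
    (hU : U ∈ Stiefel d r) :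
    (dropDir a U)ᵀ * dropDir a U = 1 - Matrix.vecMulVec a a := by
  have hUU : Uᵀ * U = 1 := hU
  have h1 : dropDir a U = U * (1 - Matrix.vecMulVec a a) := by
    rw [dropDir, Matrix.mul_sub, Matrix.mul_one, Matrix.mul_vecMulVec]
  have h2 : (1 - Matrix.vecMulVec a a)ᵀ = 1 - Matrix.vecMulVec a a := by
    rw [Matrix.transpose_sub, Matrix.transpose_one, Matrix.transpose_vecMulVec]
  rw [h1, Matrix.transpose_mul, h2, Matrix.mul_assoc, ← Matrix.mul_assoc Uᵀ, hUU, Matrix.one_mul,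
    Matrix.mul_sub, Matrix.mul_one, Matrix.sub_mul, Matrix.one_mul, Matrix.vecMulVec_mul_vecMulVec,
    ha]
  simp

theorem dropDir_mul_proj (ha : a ⬝ᵥ a = 1) (U : Matrix (Fin d) (Fin r) ℝ) :
    dropDir a U * (1 - Matrix.vecMulVec a a) = dropDir a U := by
  rw [Matrix.mul_sub, Matrix.mul_vecMulVec, dropDir_mulVec ha]
  simp

theorem complProj_dropDir_mul_dropDir (ha : a ⬝ᵥ a = 1) {U : Matrix (Fin d) (Fin r) ℝ}
    (hU : U ∈ Stiefel d r) : complProj (dropDir a U) * dropDir a U = 0 := by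
  rw [complProj, Matrix.sub_mul, Matrix.mul_assoc, dropDir_transpose_mul ha hU,
    dropDir_mul_proj ha]
  simp

theorem complProj_dropDir_idem (ha : a ⬝ᵥ a = 1) {U : Matrix (Fin d) (Fin r) ℝ}
    (hU : U ∈ Stiefel d r) :
    complProj (dropDir a U) * complProj (dropDir a U) = complProj (dropDir a U) := by
  conv_lhs => rw [complProj.eq_def, ← complProj.eq_def]
  rw [show complProj (dropDir a U) * complProj (dropDir a U) =
    complProj (dropDir a U) * (1 - dropDir a U * (dropDir a U)ᵀ) from rfl, Matrix.mul_sub,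
    ← Matrix.mul_assoc, complProj_dropDir_mul_dropDir ha hU]
  simp

theorem trace_complProj_dropDir (ha : a ⬝ᵥ a = 1) {U : Matrix (Fin d) (Fin r) ℝ}
    (hU : U ∈ Stiefel d r) : (complProj (dropDir a U)).trace = d - r + 1 := by
  rw [complProj, Matrix.trace_sub, Matrix.trace_mul_comm, dropDir_transpose_mul ha hU,
    Matrix.trace_sub, Matrix.trace_vecMulVec, ha]
  simp
  ring

/-- The cross terms vanish because `dropDir a U` kills a. The spike thus splits into a part not
involving U a and a rank-one term to be removed by change of measure. -/
theorem stiefel_mul_transpose_eq (ha : a ⬝ᵥ a = 1) (U : Matrix (Fin d) (Fin r) ℝ) :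
    U * Uᵀ = dropDir a U * (dropDir a U)ᵀ + Matrix.vecMulVec (U *ᵥ a) (U *ᵥ a) := by
  conv_lhs => rw [← dropDir_add (a := a) U]
  rw [Matrix.transpose_add, Matrix.transpose_vecMulVec, Matrix.mul_add, Matrix.add_mul,
    Matrix.add_mul, Matrix.vecMulVec_mul_vecMulVec, ha, Matrix.mul_vecMulVec, dropDir_mulVec ha,
    Matrix.vecMulVec_mul, Matrix.vecMul_transpose, dropDir_mulVec ha]
  simp

theorem complProj_mul_left {Q : Matrix (Fin d) (Fin d) ℝ} (hQ : Q * Qᵀ = 1)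
    (X : Matrix (Fin d) (Fin r) ℝ) : complProj (Q * X) = Q * complProj X * Qᵀ := by
  rw [complProj, complProj, Matrix.mul_sub, Matrix.mul_one, Matrix.sub_mul, hQ,
    Matrix.transpose_mul]
  simp only [Matrix.mul_assoc]

theorem dotProduct_mulVec_orthogonal {Q : Matrix (Fin d) (Fin d) ℝ} (hQ : Q * Qᵀ = 1)
    (x : Fin d → ℝ) : (Q *ᵥ x) ⬝ᵥ (Q *ᵥ x) = x ⬝ᵥ x := by
  have hQ' : Qᵀ * Q = 1 := mul_eq_one_comm.1 hQ
  exact stiefel_mulVec_dotProduct (show Q ∈ Stiefel d d from hQ') x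

open Classical in
/-- The matrix `U` with its column in the direction `a` replaced by the direction of the projection
of `g` to the complement of the others. -/
noncomputable def redraw (a : Fin r → ℝ) (U : Matrix (Fin d) (Fin r) ℝ) (g : Fin d → ℝ) :
    Matrix (Fin d) (Fin r) ℝ :=
  dropDir a U + Matrix.vecMulVec
    -- The default U a keeps the redrawn matrix an orthogonal image of U for every g, with no
    -- exceptional set.
    (if complProj (dropDir a U) *ᵥ g = 0 then U *ᵥ a else
      (√((complProj (dropDir a U) *ᵥ g) ⬝ᵥ (complProj (dropDir a U) *ᵥ g)))⁻¹ •
        (complProj (dropDir a U) *ᵥ g)) a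

theorem measurable_dropDir : Measurable (dropDir a : Matrix (Fin d) (Fin r) ℝ → _) :=
  measurable_matrix_sub measurable_id
    (measurable_vecMulVec (measurable_mulVec measurable_id measurable_const) measurable_const)

theorem measurable_redraw : Measurable fun x : Matrix (Fin d) (Fin r) ℝ × (Fin d → ℝ) =>
    redraw a x.1 x.2 := by
  have hU : Measurable fun x : Matrix (Fin d) (Fin r) ℝ × (Fin d → ℝ) => dropDir a x.1 :=
    measurable_dropDir.comp measurable_fst
  have hP : Measurable fun x : Matrix (Fin d) (Fin r) ℝ × (Fin d → ℝ) =>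
      complProj (dropDir a x.1) *ᵥ x.2 :=
    measurable_mulVec (measurable_complProj hU) measurable_snd
  refine measurable_matrix_add hU (measurable_vecMulVec ?_ measurable_const)
  refine Measurable.ite (hP (measurableSet_singleton 0))
    (measurable_mulVec measurable_fst measurable_const) ?_
  exact ((measurable_dotProduct hP hP).sqrt).inv.smul hP

theorem complProj_dropDir_mul {Q : Matrix (Fin d) (Fin d) ℝ} (hQ : Q * Qᵀ = 1)
    (U : Matrix (Fin d) (Fin r) ℝ) (g : Fin d → ℝ) :
    complProj (dropDir a (Q * U)) *ᵥ (Q *ᵥ g) = Q *ᵥ (complProj (dropDir a U) *ᵥ g) := by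
  have hQ' : Qᵀ * Q = 1 := mul_eq_one_comm.1 hQ
  rw [mul_dropDir, complProj_mul_left hQ, Matrix.mulVec_mulVec, Matrix.mul_assoc, hQ',
    Matrix.mul_one, Matrix.mulVec_mulVec]

theorem redraw_mul {Q : Matrix (Fin d) (Fin d) ℝ} (hQ : Q * Qᵀ = 1)
    (U : Matrix (Fin d) (Fin r) ℝ) (g : Fin d → ℝ) :
    redraw a (Q * U) (Q *ᵥ g) = Q * redraw a U g := by
  have hQ' : Qᵀ * Q = 1 := mul_eq_one_comm.1 hQ
  have h0 : ∀ x : Fin d → ℝ, Q *ᵥ x = 0 ↔ x = 0 := by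
    intro x
    rw [← dotProduct_self_eq_zero, dotProduct_mulVec_orthogonal hQ, dotProduct_self_eq_zero]
  rw [redraw, redraw, complProj_dropDir_mul hQ, dotProduct_mulVec_orthogonal hQ, mul_dropDir,
    Matrix.mul_add, Matrix.mul_vecMulVec]
  simp only [h0]
  congr 2
  split_ifs
  · rw [Matrix.mulVec_mulVec]
  · rw [Matrix.mulVec_smul]

/-- Redrawing a direction amounts to applying an orthogonal matrix. -/
theorem exists_redraw_eq_mul (ha : a ⬝ᵥ a = 1) {U : Matrix (Fin d) (Fin r) ℝ}
    (hU : U ∈ Stiefel d r) (g : Fin d → ℝ) :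
    ∃ R : Matrix (Fin d) (Fin d) ℝ, R * Rᵀ = 1 ∧ redraw a U g = R * U := by
  classical
  set P := complProj (dropDir a U) with hP
  have hPs : P.IsSymm := complProj_isSymm _
  set v : Fin d → ℝ := if P *ᵥ g = 0 then U *ᵥ a else
      (√((P *ᵥ g) ⬝ᵥ (P *ᵥ g)))⁻¹ • (P *ᵥ g) with hv
  have hUa : (U *ᵥ a) ⬝ᵥ (U *ᵥ a) = 1 := by rw [stiefel_mulVec_dotProduct hU, ha]
  have hUperp : (dropDir a U)ᵀ *ᵥ (U *ᵥ a) = 0 := by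
    conv_lhs => rw [← dropDir_add (a := a) U]
    rw [Matrix.add_mulVec, Matrix.vecMulVec_mulVec, ha, dropDir_mulVec ha, zero_add]
    have h1 : (dropDir a U)ᵀ * U = 1 - Matrix.vecMulVec a a := by
      have hUU : Uᵀ * U = 1 := hU
      rw [dropDir, Matrix.transpose_sub, Matrix.transpose_vecMulVec, Matrix.sub_mul, hUU,
        Matrix.vecMulVec_mul, ← Matrix.mulVec_transpose, Matrix.mulVec_mulVec, hUU,
        Matrix.one_mulVec]
    simp only [MulOpposite.op_one, one_smul]
    rw [dropDir_add, Matrix.mulVec_mulVec, h1, Matrix.sub_mulVec, Matrix.one_mulVec,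
      Matrix.vecMulVec_mulVec, ha]
    simp
  have hPperp : ∀ x, (dropDir a U)ᵀ *ᵥ (P *ᵥ x) = 0 := by
    intro x
    have h := congrArg Matrix.transpose (complProj_dropDir_mul_dropDir ha hU)
    rw [Matrix.transpose_mul, ← hP, hPs.eq] at h
    rw [Matrix.mulVec_mulVec, h]
    simp
  have hvv : v ⬝ᵥ v = 1 := by
    rw [hv]
    split_ifs with h
    · exact hUa
    · have h0 : (P *ᵥ g) ⬝ᵥ (P *ᵥ g) ≠ 0 := by rwa [Ne, dotProduct_self_eq_zero]
      have h1 := Real.mul_self_sqrt (dotProduct_self_nonneg_real (P *ᵥ g))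
      rw [smul_dotProduct, dotProduct_smul, smul_eq_mul, smul_eq_mul]
      have h2 : √((P *ᵥ g) ⬝ᵥ (P *ᵥ g)) ≠ 0 := by
        intro h3
        rw [h3] at h1
        exact h0 (by linarith)
      field_simp
      linarith
  have hvperp : (dropDir a U)ᵀ *ᵥ v = 0 := by
    rw [hv]
    split_ifs
    · exact hUperp
    · rw [Matrix.mulVec_smul, hPperp, smul_zero]
  obtain ⟨R, hR, hRu, hRx⟩ := exists_reflection hUa hvv
  refine ⟨R, hR, ?_⟩
  have h1 : R * dropDir a U = dropDir a U := by
    ext i j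
    have h2 : ∀ y : Fin d → ℝ, (dropDir a U)ᵀ *ᵥ y = 0 →
        (fun l => dropDir a U l j) ⬝ᵥ y = 0 := fun y hy => congrFun hy j
    exact congrFun (hRx (fun l => dropDir a U l j) (h2 _ hUperp) (h2 _ hvperp)) i
  have h3 : R * U = R * (dropDir a U + Matrix.vecMulVec (U *ᵥ a) a) := by rw [dropDir_add]
  rw [h3, Matrix.mul_add, h1, Matrix.mul_vecMulVec, hRu]
  rfl

end dropDir

/-! ### Exponential moments of the overlap with a hidden direction. -/

section redraw

variable {d r : ℕ} {a : Fin r → ℝ} {ν : Measure (Matrix (Fin d) (Fin r) ℝ)}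
  [IsProbabilityMeasure ν]

/-- The joint law of U and g is invariant under a simultaneous rotation, so a random rotation may be
averaged in. -/
theorem lintegral_average_rotation (hinv : ∀ Q : Matrix (Fin d) (Fin d) ℝ, Q * Qᵀ = 1 →
      ν.map (fun U => Q * U) = ν) {H : Measure (Matrix (Fin d) (Fin d) ℝ)} [IsProbabilityMeasure H]
    (hH : ∀ᵐ Q ∂H, Q * Qᵀ = 1) {K : Matrix (Fin d) (Fin r) ℝ × (Fin d → ℝ) → ENNReal}
    (hK : Measurable K) :
    ∫⁻ x, K x ∂(ν.prod (stdGaussianPi d)) =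
      ∫⁻ x, ∫⁻ Q, K (Q * x.1, Q *ᵥ x.2) ∂H ∂(ν.prod (stdGaussianPi d)) := by
  have hm : Measurable fun y : (Matrix (Fin d) (Fin r) ℝ × (Fin d → ℝ)) ×
      Matrix (Fin d) (Fin d) ℝ => K (y.2 * y.1.1, y.2 *ᵥ y.1.2) :=
    hK.comp ((measurable_matrix_mul measurable_snd (measurable_fst.comp measurable_fst)).prodMk
      (measurable_mulVec measurable_snd (measurable_snd.comp measurable_fst)))
  rw [lintegral_lintegral_swap hm.aemeasurable]
  have h : ∀ᵐ Q ∂H, ∫⁻ x, K (Q * x.1, Q *ᵥ x.2) ∂(ν.prod (stdGaussianPi d)) =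
      ∫⁻ x, K x ∂(ν.prod (stdGaussianPi d)) := by
    filter_upwards [hH] with Q hQ
    have h1 : Measurable fun U : Matrix (Fin d) (Fin r) ℝ => Q * U :=
      measurable_matrix_mul measurable_const measurable_id
    have h2 : Measurable fun g : Fin d → ℝ => Q *ᵥ g :=
      measurable_mulVec measurable_const measurable_id
    have h3 : (ν.prod (stdGaussianPi d)).map (Prod.map (fun U => Q * U) fun g => Q *ᵥ g) =
        ν.prod (stdGaussianPi d) := by
      rw [← Measure.map_prod_map _ _ h1 h2, hinv Q hQ, map_mulVec_stdGaussianPi hQ]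
    conv_rhs => rw [← h3, lintegral_map hK (h1.prodMap h2)]
    rfl
  rw [lintegral_congr_ae h, lintegral_const, measure_univ, mul_one]

/-- For fixed U and g, redrawing replaces U by R U with R orthogonal. Once a random rotation Q is
applied, R is absorbed by right invariance, while the length of the projected Gaussian does not see
Q. So the direction U a may be taken to be that of the projected Gaussian, jointly with its length.
-/
theorem lintegral_redraw (ha : a ⬝ᵥ a = 1) (hmem : ∀ᵐ U ∂ν, U ∈ Stiefel d r)
    (hinv : ∀ Q : Matrix (Fin d) (Fin d) ℝ, Q * Qᵀ = 1 → ν.map (fun U => Q * U) = ν)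
    {F : Matrix (Fin d) (Fin r) ℝ × ℝ → ENNReal} (hF : Measurable F) :
    ∫⁻ x, F (redraw a x.1 x.2, (complProj (dropDir a x.1) *ᵥ x.2) ⬝ᵥ
        (complProj (dropDir a x.1) *ᵥ x.2)) ∂(ν.prod (stdGaussianPi d)) =
      ∫⁻ x, F (x.1, (complProj (dropDir a x.1) *ᵥ x.2) ⬝ᵥ
        (complProj (dropDir a x.1) *ᵥ x.2)) ∂(ν.prod (stdGaussianPi d)) := by
  obtain ⟨H, hHp, hH, hHinv⟩ := exists_invariant_orthogonal d
  have hP : Measurable fun x : Matrix (Fin d) (Fin r) ℝ × (Fin d → ℝ) =>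
      complProj (dropDir a x.1) *ᵥ x.2 :=
    measurable_mulVec (measurable_complProj (measurable_dropDir.comp measurable_fst)) measurable_snd
  refine (lintegral_average_rotation hinv hH
    (hF.comp (measurable_redraw.prodMk (measurable_dotProduct hP hP)))).trans (Eq.trans ?_
      (lintegral_average_rotation hinv hH
        (hF.comp (measurable_fst.prodMk (measurable_dotProduct hP hP)))).symm)
  simp only [Function.comp_apply]
  have hmem' : ∀ᵐ x ∂(ν.prod (stdGaussianPi d)), x.1 ∈ Stiefel d r :=
    Measure.quasiMeasurePreserving_fst.ae hmem
  refine lintegral_congr_ae ?_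
  filter_upwards [hmem'] with x hx
  obtain ⟨R, hR, hRx⟩ := exists_redraw_eq_mul ha hx x.2
  set ρ := (complProj (dropDir a x.1) *ᵥ x.2) ⬝ᵥ (complProj (dropDir a x.1) *ᵥ x.2) with hρ
  have hG : Measurable fun Q : Matrix (Fin d) (Fin d) ℝ => F (Q * x.1, ρ) :=
    hF.comp ((measurable_matrix_mul measurable_id measurable_const).prodMk measurable_const)
  calc _ = ∫⁻ Q, F ((Q * R) * x.1, ρ) ∂H := by
        refine lintegral_congr_ae ?_
        filter_upwards [hH] with Q hQ
        rw [Matrix.mul_assoc, ← hRx, ← redraw_mul hQ, complProj_dropDir_mul hQ,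
          dotProduct_mulVec_orthogonal hQ]
    _ = ∫⁻ Q, F (Q * x.1, ρ) ∂H := hHinv R hR _ hG
    _ = _ := by
        refine lintegral_congr_ae ?_
        filter_upwards [hH] with Q hQ
        rw [complProj_dropDir_mul hQ, dotProduct_mulVec_orthogonal hQ]

/-- Polar decomposition of the projected Gaussian: its length times the redrawn direction. If it is
zero, both sides vanish whatever the default. -/
theorem dotProduct_redraw (ha : a ⬝ᵥ a = 1) {k : ℕ} (V : Matrix (Fin d) (Fin k) ℝ)
    (U : Matrix (Fin d) (Fin r) ℝ) (g : Fin d → ℝ) :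
    (Vᵀ *ᵥ (complProj (dropDir a U) *ᵥ g)) ⬝ᵥ (Vᵀ *ᵥ (complProj (dropDir a U) *ᵥ g)) =
      (complProj (dropDir a U) *ᵥ g) ⬝ᵥ (complProj (dropDir a U) *ᵥ g) *
        ((Vᵀ *ᵥ (redraw a U g *ᵥ a)) ⬝ᵥ (Vᵀ *ᵥ (redraw a U g *ᵥ a))) := by
  rw [redraw, (dropDir_add_vecMulVec ha U _).1]
  set y := complProj (dropDir a U) *ᵥ g with hy
  split_ifs with h
  · simp [h]
  · have h0 : y ⬝ᵥ y ≠ 0 := by rwa [Ne, dotProduct_self_eq_zero]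
    have h1 := Real.mul_self_sqrt (dotProduct_self_nonneg_real y)
    rw [Matrix.mulVec_smul, smul_dotProduct, dotProduct_smul, smul_smul, smul_eq_mul,
      ← mul_inv, h1, mul_inv_cancel_left₀ h0]

/-- If the queries `V` depend only on the part of `U` orthogonal to the direction `a`, the overlap
of `V` with `U a` has the exponential moments of a `χ²` variable. -/
theorem lintegral_exp_overlap_le (ha : a ⬝ᵥ a = 1) (hmem : ∀ᵐ U ∂ν, U ∈ Stiefel d r)
    (hinv : ∀ Q : Matrix (Fin d) (Fin d) ℝ, Q * Qᵀ = 1 → ν.map (fun U => Q * U) = ν) {k : ℕ}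
    {V : Matrix (Fin d) (Fin r) ℝ → Matrix (Fin d) (Fin k) ℝ} (hVm : Measurable V)
    (hV : ∀ X, V X ∈ Stiefel d k) {θ : ℝ} (hθ0 : 0 ≤ θ) (hθ : θ < 1 / 2) :
    ∫⁻ U, ENNReal.ofReal (Real.exp (θ * (d - r + 1) * (((V (dropDir a U))ᵀ *ᵥ (U *ᵥ a)) ⬝ᵥ
      ((V (dropDir a U))ᵀ *ᵥ (U *ᵥ a))))) ∂ν ≤ ENNReal.ofReal ((1 - 2 * θ) ^ (-(k / 2) : ℝ)) := by
  set z : Matrix (Fin d) (Fin r) ℝ → ℝ := fun U =>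
    ((V (dropDir a U))ᵀ *ᵥ (U *ᵥ a)) ⬝ᵥ ((V (dropDir a U))ᵀ *ᵥ (U *ᵥ a)) with hz
  have hzm : Measurable z := by
    have h1 : Measurable fun U : Matrix (Fin d) (Fin r) ℝ => (V (dropDir a U))ᵀ *ᵥ (U *ᵥ a) :=
      measurable_mulVec (measurable_matrix_transpose (hVm.comp measurable_dropDir))
        (measurable_mulVec measurable_id measurable_const)
    exact measurable_dotProduct h1 h1
  set F : Matrix (Fin d) (Fin r) ℝ × ℝ → ENNReal := fun x =>
    ENNReal.ofReal (Real.exp (θ * (x.2 * z x.1))) with hFdef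
  have hF : Measurable F := (Real.measurable_exp.comp
    ((measurable_snd.mul (hzm.comp measurable_fst)).const_mul θ)).ennreal_ofReal
  have hP : Measurable fun x : Matrix (Fin d) (Fin r) ℝ × (Fin d → ℝ) =>
      complProj (dropDir a x.1) *ᵥ x.2 :=
    measurable_mulVec (measurable_complProj (measurable_dropDir.comp measurable_fst)) measurable_snd
  have hdrop : ∀ (U : Matrix (Fin d) (Fin r) ℝ) (g : Fin d → ℝ), dropDir a (redraw a U g) = dropDir a U := fun U g =>
    (dropDir_add_vecMulVec ha U _).2
  -- Jensen's inequality replaces d - r + 1, the trace of the projection, by the random squared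
  -- length of the projected Gaussian.
  calc ∫⁻ U, ENNReal.ofReal (Real.exp (θ * (d - r + 1) * z U)) ∂ν
      ≤ ∫⁻ U, ∫⁻ g, F (U, (complProj (dropDir a U) *ᵥ g) ⬝ᵥ (complProj (dropDir a U) *ᵥ g))
          ∂(stdGaussianPi d) ∂ν := by
        refine lintegral_mono_ae ?_
        filter_upwards [hmem] with U hU
        obtain ⟨hi, he⟩ := integral_dotProduct_proj_stdGaussianPi
          (complProj_isSymm (dropDir a U)) (complProj_dropDir_idem ha hU)
        have h := ofReal_exp_integral_le ((hi.mul_const (z U)).const_mul θ)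
        rw [integral_const_mul, integral_mul_const, he, trace_complProj_dropDir ha hU] at h
        rw [mul_assoc]
        exact h
    _ = ∫⁻ x, F (x.1, (complProj (dropDir a x.1) *ᵥ x.2) ⬝ᵥ
          (complProj (dropDir a x.1) *ᵥ x.2)) ∂(ν.prod (stdGaussianPi d)) :=
        (lintegral_prod _ (hF.comp
          (measurable_fst.prodMk (measurable_dotProduct hP hP))).aemeasurable).symm
    _ = ∫⁻ x, F (redraw a x.1 x.2, (complProj (dropDir a x.1) *ᵥ x.2) ⬝ᵥ
          (complProj (dropDir a x.1) *ᵥ x.2)) ∂(ν.prod (stdGaussianPi d)) :=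
        (lintegral_redraw ha hmem hinv hF).symm
    _ = ∫⁻ U, ∫⁻ g, F (redraw a U g, (complProj (dropDir a U) *ᵥ g) ⬝ᵥ
          (complProj (dropDir a U) *ᵥ g)) ∂(stdGaussianPi d) ∂ν :=
        lintegral_prod _ (hF.comp
          (measurable_redraw.prodMk (measurable_dotProduct hP hP))).aemeasurable
    _ ≤ ∫⁻ U, ENNReal.ofReal ((1 - 2 * θ) ^ (-(k / 2) : ℝ)) ∂ν := by
        refine lintegral_mono_ae ?_
        filter_upwards [hmem] with U hU
        -- Redrawing does not change `dropDir a U`, so V is fixed, and length times direction is the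
        -- projected Gaussian itself.
        refine le_trans (le_of_eq (lintegral_congr fun g => ?_))
          (lintegral_exp_sq_proj_le (hV (dropDir a U)) (complProj_isSymm (dropDir a U))
            (complProj_dropDir_idem ha hU) hθ0 hθ)
        simp only [hFdef, hz, hdrop]
        rw [dotProduct_redraw ha]
    _ = _ := by simp

end redraw

/-! ### The probability of a large jump in one direction. -/

namespace QueryAlgorithm

variable {d : ℕ} {S : Type*} [MeasurableSpace S] (A : QueryAlgorithm d S)

/-- The squared norm of the projection of `x` to the span of the first `k` queries. -/
noncomputable def seen (s : S) (M : Matrix (Fin d) (Fin d) ℝ) (k : ℕ) (x : Fin d → ℝ) : ℝ :=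
  ((A.queryMatrix s M k)ᵀ *ᵥ x) ⬝ᵥ ((A.queryMatrix s M k)ᵀ *ᵥ x)

theorem measurable_seen {α : Type*} [MeasurableSpace α] {s : α → S}
    {M : α → Matrix (Fin d) (Fin d) ℝ} {x : α → Fin d → ℝ} (hs : Measurable s)
    (hM : Measurable M) (hx : Measurable x) (k : ℕ) :
    Measurable fun y => A.seen (s y) (M y) k (x y) := by
  have h : Measurable fun y => (A.queryMatrix (s y) (M y) k)ᵀ *ᵥ x y :=
    measurable_mulVec (measurable_matrix_transpose
      ((A.measurable_queryMatrix k).comp (hs.prodMk hM))) hx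
  exact measurable_dotProduct h h

theorem measurable_queryMatrixOfHistory (s : S) (k : ℕ) :
    Measurable (A.queryMatrixOfHistory s k) := by
  rw [measurable_matrix_iff]
  intro i j
  refine Fin.lastCases ?_ (fun j => ?_) j
  · simp only [queryMatrixOfHistory, Matrix.of_apply, Fin.snoc_last]
    exact (measurable_pi_apply i).comp ((A.measurable_query k).comp measurable_prodMk_left)
  · simp only [queryMatrixOfHistory, Matrix.of_apply, Fin.snoc_castSucc]
    exact (measurable_pi_apply i).comp (measurable_fst.comp (measurable_pi_apply j))

/-- The probability that one query increases the part of `U a` seen by the algorithm by more than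
a factor `β`. -/
theorem IsOrthonormal.lintegral_jump_le {A : QueryAlgorithm d S} {T r : ℕ}
    (hA : A.IsOrthonormal T) (hd : 0 < d) (s : S) {a : Fin r → ℝ} (ha : a ⬝ᵥ a = 1) {lam : ℝ}
    {γ : Measure (Matrix (Fin d) (Fin d) ℝ)} [IsProbabilityMeasure γ] (hγ : IsGOELaw γ)
    {ν : Measure (Matrix (Fin d) (Fin r) ℝ)} [IsProbabilityMeasure ν]
    (hmem : ∀ᵐ U ∂ν, U ∈ Stiefel d r)
    (hinv : ∀ Q : Matrix (Fin d) (Fin d) ℝ, Q * Qᵀ = 1 → ν.map (fun U => Q * U) = ν)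
    {k : ℕ} (hk : k + 1 ≤ T) {p η β c θ : ℝ} (hp : 1 < p) (hη : 0 < η) (hβ : 0 < β)
    (hθ0 : 0 ≤ θ) (hθ : θ < 1 / 2) (hθβ : θ * (d - r + 1) * β = p * (d / 2 * lam ^ 2)) :
    ∫⁻ U, γ {W | β * (A.seen s (W + lam • (U * Uᵀ)) k (U *ᵥ a) + c) <
        A.seen s (W + lam • (U * Uᵀ)) (k + 1) (U *ᵥ a)} ∂ν ≤
      ENNReal.ofReal (p⁻¹ * η) + ENNReal.ofReal ((1 - p⁻¹) * η ^ (-(1 / (p - 1))) *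
        Real.exp (-(p * (d / 2 * lam ^ 2) * c)) * (1 - 2 * θ) ^ (-((k + 1 : ℕ) / 2) : ℝ)) := by
  have hpi : 0 ≤ 1 - p⁻¹ := sub_nonneg.2 (inv_le_one_of_one_le₀ hp.le)
  set C := (1 - p⁻¹) * η ^ (-(1 / (p - 1))) with hC
  have hC0 : 0 ≤ C := mul_nonneg hpi (Real.rpow_nonneg hη.le _)
  set κ := p * (d / 2 * lam ^ 2) with hκ
  have hκ0 : 0 ≤ κ := by
    have : (0 : ℝ) ≤ d := Nat.cast_nonneg d
    positivity
  set D₀ : Matrix (Fin d) (Fin r) ℝ → Matrix (Fin d) (Fin d) ℝ := fun U =>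
    lam • (dropDir a U * (dropDir a U)ᵀ) with hD₀
  have hD₀s : ∀ U, (D₀ U).IsSymm := by
    intro U
    simp [hD₀, Matrix.IsSymm]
  have hD₀m : Measurable D₀ := measurable_matrix_smul measurable_const
    (measurable_matrix_mul measurable_dropDir (measurable_matrix_transpose measurable_dropDir))
  have hm : Measurable fun x : Matrix (Fin d) (Fin r) ℝ × Matrix (Fin d) (Fin d) ℝ =>
      ENNReal.ofReal (Real.exp (θ * (d - r + 1) * A.seen s (x.2 + D₀ x.1) (k + 1) (x.1 *ᵥ a))) :=
    (Real.measurable_exp.comp ((A.measurable_seen measurable_const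
      (measurable_matrix_add measurable_snd (hD₀m.comp measurable_fst))
      (measurable_mulVec measurable_fst measurable_const) (k + 1)).const_mul _)).ennreal_ofReal
  have hmU : ∀ (U : Matrix (Fin d) (Fin r) ℝ) (u : Fin d → ℝ),
      Measurable fun W : Matrix (Fin d) (Fin d) ℝ => ENNReal.ofReal (Real.exp
        (θ * (d - r + 1) * A.seen s (W + D₀ U) (k + 1) u)) := fun U u =>
    (Real.measurable_exp.comp ((A.measurable_seen measurable_const
      (measurable_matrix_add measurable_id measurable_const)
      measurable_const (k + 1)).const_mul _)).ennreal_ofReal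
  have hstep : ∀ U ∈ Stiefel d r,
      γ {W | β * (A.seen s (W + lam • (U * Uᵀ)) k (U *ᵥ a) + c) <
        A.seen s (W + lam • (U * Uᵀ)) (k + 1) (U *ᵥ a)} ≤ ENNReal.ofReal (p⁻¹ * η) +
      ENNReal.ofReal (C * Real.exp (-(κ * c))) * ∫⁻ W, ENNReal.ofReal (Real.exp
        (θ * (d - r + 1) * A.seen s (W + D₀ U) (k + 1) (U *ᵥ a))) ∂γ := by
    intro U hU
    set u := U *ᵥ a with hu
    have huu : u ⬝ᵥ u = 1 := by rw [hu, stiefel_mulVec_dotProduct hU, ha]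
    let Vk : (Fin k → (Fin d → ℝ) × (Fin d → ℝ)) → Matrix (Fin d) (Fin k) ℝ := fun h =>
      Matrix.of fun i j => (h j).1 i
    have hVk : Measurable Vk := measurable_matrix_iff.2 fun i j =>
      (measurable_pi_apply i).comp (measurable_fst.comp (measurable_pi_apply j))
    have hVkm : Measurable fun h => (Vk h)ᵀ *ᵥ u :=
      measurable_mulVec (measurable_matrix_transpose hVk) measurable_const
    have hVkm' : Measurable fun h => (A.queryMatrixOfHistory s k h)ᵀ *ᵥ u :=
      measurable_mulVec (measurable_matrix_transpose (A.measurable_queryMatrixOfHistory s k))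
        measurable_const
    -- The event concerns k + 1 queries but is determined by the first k pairs. Hence the change of
    -- measure costs only the overlap of the first k queries.
    let E : Set (Fin k → (Fin d → ℝ) × (Fin d → ℝ)) :=
      {h | β * (((Vk h)ᵀ *ᵥ u) ⬝ᵥ ((Vk h)ᵀ *ᵥ u) + c) <
        ((A.queryMatrixOfHistory s k h)ᵀ *ᵥ u) ⬝ᵥ ((A.queryMatrixOfHistory s k h)ᵀ *ᵥ u)}
    have hE : MeasurableSet E := measurableSet_lt
      (((measurable_dotProduct hVkm hVkm).add_const c).const_mul β)
      (measurable_dotProduct hVkm' hVkm')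
    have hEiff : ∀ M, A.history s M k ∈ E ↔
        β * (A.seen s M k u + c) < A.seen s M (k + 1) u := by
      intro M
      simp only [seen, A.queryMatrix_succ_eq]
      rfl
    have hspike : lam • (U * Uᵀ) = D₀ U + lam • Matrix.vecMulVec u u := by
      rw [stiefel_mul_transpose_eq ha U, smul_add]
    have hb := hA.lintegral_history_spike_le hd s (hD₀s U) huu lam hγ (k.le_succ.trans hk)
      (G := E.indicator 1) (measurable_one.indicator hE)
      (fun h => Set.indicator_le_self' (fun _ _ => zero_le) h) hp hη
    have hset : γ {W | β * (A.seen s (W + lam • (U * Uᵀ)) k u + c) <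
        A.seen s (W + lam • (U * Uᵀ)) (k + 1) u} =
        ∫⁻ W, E.indicator 1 (A.history s (W + (D₀ U + lam • Matrix.vecMulVec u u)) k) ∂γ := by
      have hms : MeasurableSet {W | β * (A.seen s (W + lam • (U * Uᵀ)) k u + c) <
          A.seen s (W + lam • (U * Uᵀ)) (k + 1) u} := by
        have := (A.measurable_history_add s (lam • (U * Uᵀ)) k) hE
        simpa only [Set.preimage, hEiff] using this
      rw [← lintegral_indicator_one hms, ← hspike]
      refine lintegral_congr fun W => ?_
      simp only [Set.indicator_apply, hEiff, Set.mem_ofPred_eq, Pi.one_apply]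
    rw [hset]
    refine hb.trans (add_le_add_right ?_ _)
    rw [← lintegral_const_mul _ (hmU U u)]
    refine lintegral_mono fun W => ?_
    by_cases hW : A.history s (W + D₀ U) k ∈ E
    · rw [Set.indicator_of_mem hW, Pi.one_apply, one_mul,
        ← ENNReal.ofReal_mul (mul_nonneg hC0 (Real.exp_pos _).le), mul_assoc C, ← Real.exp_add]
      refine ENNReal.ofReal_le_ofReal (mul_le_mul_of_nonneg_left (Real.exp_le_exp.2 ?_) hC0)
      have h1 := (hEiff _).1 hW
      have h2 : A.seen s (W + D₀ U) k u ≤ A.seen s (W + D₀ U) (k + 1) u / β - c := by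
        rw [le_sub_iff_add_le, le_div_iff₀ hβ]
        linarith
      -- The choice of θ makes the cost of the k-overlap, divided by the jump factor β, equal to the
      -- exponent of the χ² moment.
      have h3 : θ * (d - r + 1) = κ / β := by
        rw [eq_div_iff hβ.ne', hθβ]
      calc _ = κ * A.seen s (W + D₀ U) k u := by rw [hκ, seen]; ring
        _ ≤ κ * (A.seen s (W + D₀ U) (k + 1) u / β - c) := mul_le_mul_of_nonneg_left h2 hκ0
        _ = _ := by rw [h3]; ring
    · rw [Set.indicator_of_notMem hW, zero_mul]
      exact zero_le
  calc _ ≤ ∫⁻ U, (ENNReal.ofReal (p⁻¹ * η) +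
      ENNReal.ofReal (C * Real.exp (-(κ * c))) * ∫⁻ W, ENNReal.ofReal (Real.exp
        (θ * (d - r + 1) * A.seen s (W + D₀ U) (k + 1) (U *ᵥ a))) ∂γ) ∂ν :=
        lintegral_mono_ae (hmem.mono hstep)
    _ = ENNReal.ofReal (p⁻¹ * η) + ENNReal.ofReal (C * Real.exp (-(κ * c))) *
        ∫⁻ U, ∫⁻ W, ENNReal.ofReal (Real.exp
          (θ * (d - r + 1) * A.seen s (W + D₀ U) (k + 1) (U *ᵥ a))) ∂γ ∂ν := by
        rw [lintegral_add_left measurable_const, lintegral_const, measure_univ, mul_one,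
          lintegral_const_mul _ hm.lintegral_prod_right']
    _ = ENNReal.ofReal (p⁻¹ * η) + ENNReal.ofReal (C * Real.exp (-(κ * c))) *
        ∫⁻ W, ∫⁻ U, ENNReal.ofReal (Real.exp
          (θ * (d - r + 1) * A.seen s (W + D₀ U) (k + 1) (U *ᵥ a))) ∂ν ∂γ := by
        rw [lintegral_lintegral_swap hm.aemeasurable]
    _ ≤ ENNReal.ofReal (p⁻¹ * η) + ENNReal.ofReal (C * Real.exp (-(κ * c))) *
        ∫⁻ W, ENNReal.ofReal ((1 - 2 * θ) ^ (-((k + 1 : ℕ) / 2) : ℝ)) ∂γ := by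
        refine add_le_add le_rfl (mul_le_mul_right (lintegral_mono_ae ?_) _)
        filter_upwards [hγ.symm] with W hW
        -- With the spike removed, the queries are a function of `dropDir a U` for fixed W, as the
        -- moment bound requires.
        refine lintegral_exp_overlap_le ha hmem hinv
          (V := fun X => A.queryMatrix s (W + lam • (X * Xᵀ)) (k + 1)) ?_ (fun X => ?_) hθ0 hθ
        · exact (A.measurable_queryMatrix (k + 1)).comp (measurable_const.prodMk
            (measurable_matrix_add measurable_const (measurable_matrix_smul measurable_const
              (measurable_matrix_mul measurable_id (measurable_matrix_transpose measurable_id)))))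
        · refine hA.mem_stiefel s (hW.add ?_) hk
          simp [Matrix.IsSymm]
    _ = _ := by
        rw [lintegral_const, measure_univ, mul_one, ← ENNReal.ofReal_mul
          (mul_nonneg hC0 (Real.exp_pos _).le)]

end QueryAlgorithm

/-! ### Determinants, eigenvalues and overlaps. -/

/-- The determinant grows by 1 + t with t = xᵀ A⁻¹ x. Testing the form inequality at A⁻¹ x gives t +
t² ≤ β t, hence 1 + t ≤ β. The case t = 0 uses 1 ≤ β. -/
theorem det_add_vecMulVec_le {r : ℕ} {A : Matrix (Fin r) (Fin r) ℝ} (hA : A.PosDef)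
    (x : Fin r → ℝ) {β : ℝ} (hβ : 1 ≤ β)
    (h : ∀ v, v ⬝ᵥ ((A + Matrix.vecMulVec x x) *ᵥ v) ≤ β * (v ⬝ᵥ (A *ᵥ v))) :
    (A + Matrix.vecMulVec x x).det ≤ β * A.det := by
  have hdet : 0 < A.det := hA.det_pos
  have hu : IsUnit A.det := hdet.ne'.isUnit
  have h1 : (A + Matrix.vecMulVec x x).det = A.det * (1 + x ⬝ᵥ (A⁻¹ *ᵥ x)) := by
    rw [Matrix.vecMulVec_eq Unit, Matrix.det_add_replicateCol_mul_replicateRow hu]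
    congr 1
    rw [Matrix.det_unique]
    simp only [Matrix.add_apply, Matrix.one_apply_eq, Matrix.mul_assoc, Matrix.mul_apply,
      Matrix.replicateRow_apply, Matrix.replicateCol_apply, dotProduct, Matrix.mulVec]
  set t := x ⬝ᵥ (A⁻¹ *ᵥ x) with ht
  have hAv : A *ᵥ (A⁻¹ *ᵥ x) = x := by
    rw [Matrix.mulVec_mulVec, Matrix.mul_nonsing_inv _ hu, Matrix.one_mulVec]
  have h2 := h (A⁻¹ *ᵥ x)
  rw [Matrix.add_mulVec, dotProduct_add, hAv, Matrix.vecMulVec_mulVec, ← ht] at h2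
  simp only [op_smul_eq_smul, dotProduct_smul, dotProduct_comm (A⁻¹ *ᵥ x) x, ← ht, smul_eq_mul] at h2
  have ht0 : 0 ≤ t := by
    have := hA.posSemidef.dotProduct_mulVec_nonneg (A⁻¹ *ᵥ x)
    rw [hAv] at this
    simpa [dotProduct_comm, ht] using this
  rw [h1, mul_comm β]
  refine mul_le_mul_of_nonneg_left ?_ hdet.le
  rcases ht0.eq_or_lt with h0 | h0
  · rw [← h0]
    linarith
  · nlinarith

theorem det_add_smul_one_eq {r : ℕ} {A : Matrix (Fin r) (Fin r) ℝ} (hA : A.IsHermitian) (c : ℝ) :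
    (A + c • (1 : Matrix (Fin r) (Fin r) ℝ)).det = ∏ i, (hA.eigenvalues i + c) := by
  have h := congrArg (Polynomial.eval (-c)) hA.charpoly_eq
  rw [Matrix.eval_charpoly, Polynomial.eval_prod] at h
  have e : Matrix.scalar (Fin r) (-c) - A = -(A + c • (1 : Matrix (Fin r) (Fin r) ℝ)) := by
    ext i j
    by_cases hij : i = j
    · subst hij
      simp
      ring
    · simp [hij]
  rw [e, Matrix.det_neg, Fintype.card_fin] at h
  have h2 : ∏ i, (hA.eigenvalues i + c) = (-1) ^ r * ∏ i,
      Polynomial.eval (-c) (Polynomial.X - Polynomial.C (hA.eigenvalues i)) := by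
    have h3 : ∀ i, Polynomial.eval (-c) (Polynomial.X - Polynomial.C (hA.eigenvalues i)) =
        (-1) * (hA.eigenvalues i + c) := by
      intro i
      simp
      ring
    simp only [h3, Finset.prod_mul_distrib, Finset.prod_const, Finset.card_univ, Fintype.card_fin]
    rw [← mul_assoc, ← mul_pow]
    simp
  rw [h2]
  refine Eq.trans ?_ (congrArg (fun t => (-1) ^ r * t) h)
  rw [← mul_assoc, ← mul_pow]
  simp

theorem exists_sortedEigenvalue_eq {r : ℕ} {A : Matrix (Fin r) (Fin r) ℝ} (hA : A.IsHermitian) :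
    ∃ σ : Fin r ≃ Fin r, ∀ j, sortedEigenvalue hA j = hA.eigenvalues (σ j) := by
  refine ⟨(finCongr (Fintype.card_fin r).symm).trans
    (Fintype.equivOfCardEq (Fintype.card_fin _)), fun j => ?_⟩
  rw [sortedEigenvalue, Matrix.IsHermitian.eigenvalues]
  congr 1
  simp

theorem sortedEigenvalue_antitone {r : ℕ} {A : Matrix (Fin r) (Fin r) ℝ} (hA : A.IsHermitian) :
    Antitone (sortedEigenvalue hA) := by
  intro i j hij
  exact hA.eigenvalues₀_antitone hij

theorem sortedEigenvalue_nonneg {r : ℕ} {A : Matrix (Fin r) (Fin r) ℝ} (hA : A.IsHermitian)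
    (h : A.PosSemidef) (j : Fin r) : 0 ≤ sortedEigenvalue hA j := by
  obtain ⟨σ, hσ⟩ := exists_sortedEigenvalue_eq hA
  rw [hσ]
  exact h.eigenvalues_nonneg _

theorem sortedEigenvalue_le_one {r : ℕ} {A : Matrix (Fin r) (Fin r) ℝ} (hA : A.IsHermitian)
    (h : ∀ x, x ⬝ᵥ (A *ᵥ x) ≤ x ⬝ᵥ x) (j : Fin r) : sortedEigenvalue hA j ≤ 1 := by
  obtain ⟨σ, hσ⟩ := exists_sortedEigenvalue_eq hA
  rw [hσ]
  set i := σ j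
  have h1 := h (hA.eigenvectorBasis i)
  rw [hA.mulVec_eigenvectorBasis, dotProduct_smul, smul_eq_mul] at h1
  have h2 : (hA.eigenvectorBasis i).ofLp ⬝ᵥ (hA.eigenvectorBasis i).ofLp = 1 := by
    have := hA.eigenvectorBasis.orthonormal.1 i
    have h3 := EuclideanSpace.real_norm_sq_eq (hA.eigenvectorBasis i)
    rw [this] at h3
    simp only [dotProduct, ← sq]
    linarith
  rw [h2] at h1
  linarith

/-- If `det (A + c) ≤ cʳ B` for a positive semidefinite `A`, then the `(j+1)`-st eigenvalue of `A` is
at most `c B ^ (1 / (j + 1))`. -/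
theorem sortedEigenvalue_le_of_det_le {r : ℕ} {A : Matrix (Fin r) (Fin r) ℝ} (hA : A.IsHermitian)
    (hpos : A.PosSemidef) {c B : ℝ} (hc : 0 < c) (hB : 0 ≤ B)
    (h : (A + c • (1 : Matrix (Fin r) (Fin r) ℝ)).det ≤ c ^ r * B) (j : Fin r) :
    sortedEigenvalue hA j ≤ c * B ^ (1 / ((j : ℝ) + 1)) := by
  obtain ⟨σ, hσ⟩ := exists_sortedEigenvalue_eq hA
  have hprod : ∏ i, (hA.eigenvalues i + c) = ∏ i, (sortedEigenvalue hA i + c) := by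
    simp only [hσ]
    exact (Equiv.prod_comp σ fun i => hA.eigenvalues i + c).symm
  rw [det_add_smul_one_eq hA, hprod] at h
  set e := sortedEigenvalue hA with he
  have he0 : ∀ i, 0 ≤ e i := sortedEigenvalue_nonneg hA hpos
  -- The j + 1 largest eigenvalues are bounded below by the last of them, and the others by 0. The
  -- surplus powers of c then cancel.
  have hlow : ∏ i : Fin r, (if i ≤ j then e j + c else c) ≤ ∏ i, (e i + c) := by
    refine Finset.prod_le_prod (fun i _ => ?_) fun i _ => ?_
    · split_ifs <;> linarith [he0 j]
    · split_ifs with hij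
      · linarith [sortedEigenvalue_antitone hA hij]
      · linarith [he0 i]
  have hj : (j : ℕ) + 1 ≤ r := j.2
  rw [Finset.prod_ite, Finset.prod_const, Finset.prod_const] at hlow
  have hcard : (Finset.univ.filter fun i : Fin r => i ≤ j).card = j + 1 := by
    rw [← Fin.card_Iic]
    congr 1
    ext i
    simp
  have hcard' : (Finset.univ.filter fun i : Fin r => ¬ i ≤ j).card = r - (j + 1) := by
    have := Finset.card_filter_add_card_filter_not (s := (Finset.univ : Finset (Fin r)))
      fun i : Fin r => i ≤ j
    rw [hcard, Finset.card_univ, Fintype.card_fin] at this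
    omega
  rw [hcard, hcard'] at hlow
  have h1 : (e j + c) ^ ((j : ℕ) + 1) ≤ c ^ ((j : ℕ) + 1) * B := by
    have h2 := hlow.trans h
    have h3 : c ^ r = c ^ ((j : ℕ) + 1) * c ^ (r - (j + 1)) := by
      rw [← pow_add]
      congr 1
      omega
    rw [h3] at h2
    have h4 : 0 < c ^ (r - ((j : ℕ) + 1)) := pow_pos hc _
    refine le_of_mul_le_mul_right ?_ h4
    linarith
  have h5 : ((e j + c) ^ ((j : ℕ) + 1)) ^ (1 / ((j : ℝ) + 1)) ≤
      (c ^ ((j : ℕ) + 1) * B) ^ (1 / ((j : ℝ) + 1)) :=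
    Real.rpow_le_rpow (pow_nonneg (by linarith [he0 j]) _) h1 (by positivity)
  have h6 : ∀ x : ℝ, 0 ≤ x → (x ^ ((j : ℕ) + 1)) ^ (1 / ((j : ℝ) + 1)) = x := by
    intro x hx
    rw [← Real.rpow_natCast, ← Real.rpow_mul hx]
    push_cast
    rw [mul_one_div_cancel (by positivity), Real.rpow_one]
  rw [Real.mul_rpow (pow_nonneg hc.le _) hB, h6 _ hc.le, h6 _ (by linarith [he0 j])] at h5
  linarith

theorem dotProduct_overlap_mulVec {d r k : ℕ} (U : Matrix (Fin d) (Fin r) ℝ)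
    (V : Matrix (Fin d) (Fin k) ℝ) (a : Fin r → ℝ) :
    a ⬝ᵥ (overlap U V *ᵥ a) = (Vᵀ *ᵥ (U *ᵥ a)) ⬝ᵥ (Vᵀ *ᵥ (U *ᵥ a)) := by
  rw [overlap, ← Matrix.mulVec_mulVec, ← Matrix.mulVec_mulVec, ← Matrix.mulVec_mulVec,
    Matrix.dotProduct_mulVec, Matrix.vecMul_transpose, Matrix.dotProduct_mulVec,
    ← Matrix.mulVec_transpose]

theorem overlap_posSemidef {d r k : ℕ} (U : Matrix (Fin d) (Fin r) ℝ)
    (V : Matrix (Fin d) (Fin k) ℝ) : (overlap U V).PosSemidef :=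
  Matrix.PosSemidef.of_dotProduct_mulVec_nonneg (overlap_isHermitian U V) fun x => by
    rw [star_trivial, dotProduct_overlap_mulVec]
    exact dotProduct_self_nonneg_real _

theorem stiefel_transpose_mulVec_le {d k : ℕ} {V : Matrix (Fin d) (Fin k) ℝ}
    (hV : V ∈ Stiefel d k) (x : Fin d → ℝ) : (Vᵀ *ᵥ x) ⬝ᵥ (Vᵀ *ᵥ x) ≤ x ⬝ᵥ x := by
  have h := dotProduct_self_nonneg_real (complProj V *ᵥ x)
  have h1 : (complProj V *ᵥ x) ⬝ᵥ (complProj V *ᵥ x) = x ⬝ᵥ x - (Vᵀ *ᵥ x) ⬝ᵥ (Vᵀ *ᵥ x) := by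
    rw [Matrix.dotProduct_mulVec, ← Matrix.mulVec_transpose, (complProj_isSymm V).eq,
      Matrix.mulVec_mulVec, complProj_mul_complProj hV,
      complProj, Matrix.sub_mulVec, Matrix.one_mulVec, sub_dotProduct, ← Matrix.mulVec_mulVec,
      dotProduct_comm (V *ᵥ _), Matrix.dotProduct_mulVec, ← Matrix.mulVec_transpose]
  linarith

/-! ### From grid directions to all directions. -/

theorem dotProduct_self_le_add {n : ℕ} (x y : Fin n → ℝ) {t : ℝ} (ht : 0 < t) :
    x ⬝ᵥ x ≤ (1 + t) * (y ⬝ᵥ y) + (1 + t⁻¹) * ((x - y) ⬝ᵥ (x - y)) := by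
  simp only [dotProduct, Finset.mul_sum, ← Finset.sum_add_distrib]
  refine Finset.sum_le_sum fun i _ => ?_
  rw [Pi.sub_apply]
  have h : 0 ≤ t⁻¹ * (t * y i - (x i - y i)) ^ 2 := by positivity
  have e : t⁻¹ * (t * y i - (x i - y i)) ^ 2 = t * y i ^ 2 - 2 * y i * (x i - y i) +
      t⁻¹ * (x i - y i) ^ 2 := by
    field_simp
    ring
  rw [e] at h
  nlinarith

/-- The points of the grid `{-1, …, 0, 1/m, …, 1}^r`. -/
noncomputable def gridVec {m r : ℕ} (f : Fin r → Fin (2 * m + 1)) : Fin r → ℝ :=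
  fun i => ((f i : ℝ) - m) / m

theorem exists_gridVec {m r : ℕ} (hm : 0 < m) {a : Fin r → ℝ} (ha : a ⬝ᵥ a = 1) :
    ∃ f : Fin r → Fin (2 * m + 1),
      (a - gridVec f) ⬝ᵥ (a - gridVec f) ≤ r / (m : ℝ) ^ 2 := by
  have hm' : (0 : ℝ) < m := by exact_mod_cast hm
  have hai : ∀ i, |a i| ≤ 1 := by
    intro i
    rw [abs_le_one_iff_mul_self_le_one, ← ha]
    exact Finset.single_le_sum (f := fun i => a i * a i) (fun i _ => mul_self_nonneg _)
      (Finset.mem_univ i)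
  have hex : ∀ i, ∃ n : Fin (2 * m + 1), (a i - ((n : ℝ) - m) / m) ^ 2 ≤ 1 / (m : ℝ) ^ 2 := by
    intro i
    obtain ⟨h1, h2⟩ := abs_le.1 (hai i)
    have h0 : 0 ≤ (a i + 1) * m := mul_nonneg (by linarith) hm'.le
    have hlt : ⌊(a i + 1) * m⌋₊ < 2 * m + 1 := by
      rw [Nat.lt_succ_iff]
      refine Nat.floor_le_of_le ?_
      push_cast
      nlinarith
    refine ⟨⟨⌊(a i + 1) * m⌋₊, hlt⟩, ?_⟩
    have h3 := Nat.floor_le h0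
    have h4 := Nat.lt_floor_add_one ((a i + 1) * m)
    have e : a i - ((⌊(a i + 1) * m⌋₊ : ℝ) - m) / m =
        ((a i + 1) * m - ⌊(a i + 1) * m⌋₊) / m := by
      field_simp
      ring
    simp only
    rw [e, div_pow]
    refine div_le_div_of_nonneg_right ?_ (by positivity)
    nlinarith
  choose f hf using hex
  refine ⟨f, ?_⟩
  calc (a - gridVec f) ⬝ᵥ (a - gridVec f) ≤ ∑ _i : Fin r, 1 / (m : ℝ) ^ 2 := by
        refine Finset.sum_le_sum fun i _ => ?_
        rw [Pi.sub_apply, ← sq]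
        exact hf i
    _ = _ := by
        rw [Finset.sum_const, Finset.card_univ, Fintype.card_fin, nsmul_eq_mul, mul_one_div]

/-- A comparison of two quadratic forms on a grid extends to all vectors. -/
theorem quadratic_le_of_grid {m r k l : ℕ} (hr : 1 ≤ r) (hrm : r ≤ m)
    {X : Matrix (Fin k) (Fin r) ℝ} {Y : Matrix (Fin l) (Fin r) ℝ}
    (hX : ∀ a, (X *ᵥ a) ⬝ᵥ (X *ᵥ a) ≤ a ⬝ᵥ a) (hY : ∀ a, (Y *ᵥ a) ⬝ᵥ (Y *ᵥ a) ≤ a ⬝ᵥ a)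
    {β c c' : ℝ} (hβ : 0 ≤ β) (hc : 0 ≤ c)
    (h : ∀ f : Fin r → Fin (2 * m + 1), (Y *ᵥ gridVec f) ⬝ᵥ (Y *ᵥ gridVec f) ≤
      β * ((X *ᵥ gridVec f) ⬝ᵥ (X *ᵥ gridVec f) + c * (gridVec f ⬝ᵥ gridVec f)))
    (hc' : β * (3 * (r / m) + 4 * c) + 6 * (r / m) ≤ (β - 1) * c') (a : Fin r → ℝ) :
    (Y *ᵥ a) ⬝ᵥ (Y *ᵥ a) + c' * (a ⬝ᵥ a) ≤
      β * ((X *ᵥ a) ⬝ᵥ (X *ᵥ a) + c' * (a ⬝ᵥ a)) := by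
  have hm0 : 0 < m := by omega
  have hm1 : (1 : ℝ) ≤ m := by exact_mod_cast hm0
  have hm' : (0 : ℝ) < m := by linarith
  have hr1 : (1 : ℝ) ≤ r := by exact_mod_cast hr
  have hrm' : (r : ℝ) ≤ m := by exact_mod_cast hrm
  have hunit : ∀ a : Fin r → ℝ, a ⬝ᵥ a = 1 → (Y *ᵥ a) ⬝ᵥ (Y *ᵥ a) + c' ≤
      β * ((X *ᵥ a) ⬝ᵥ (X *ᵥ a) + c') := by
    intro a ha
    obtain ⟨f, hf⟩ := exists_gridVec hm0 ha
    set b := gridVec f with hb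
    have hinv : (0 : ℝ) < (m : ℝ)⁻¹ := by positivity
    have h1m : (m : ℝ)⁻¹ ≤ r / m := by
      rw [div_eq_mul_inv]
      exact le_mul_of_one_le_left hinv.le hr1
    -- Young's inequality with parameter 1/m balances the errors: the rounding error r/m² is
    -- multiplied by 1 + m, and the main term changes only by a fraction 1/m.
    have herr : (1 + ((m : ℝ)⁻¹)⁻¹) * ((a - b) ⬝ᵥ (a - b)) ≤ 2 * (r / m) := by
      rw [inv_inv]
      calc (1 + (m : ℝ)) * ((a - b) ⬝ᵥ (a - b)) ≤ (2 * m) * (r / (m : ℝ) ^ 2) := by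
            refine mul_le_mul (by linarith) hf (dotProduct_self_nonneg_real _) (by linarith)
        _ = 2 * (r / m) := by field_simp
    have hrm1 : (r : ℝ) / m ≤ 1 := (div_le_one hm').2 hrm'
    have hswap : (b - a) ⬝ᵥ (b - a) = (a - b) ⬝ᵥ (a - b) := by
      rw [← neg_sub a b, neg_dotProduct_neg]
    have hbb : b ⬝ᵥ b ≤ 4 := by
      have := dotProduct_self_le_add b a hinv
      rw [ha, hswap] at this
      linarith
    have hpos : (0 : ℝ) ≤ 1 + ((m : ℝ)⁻¹)⁻¹ := by positivity
    have hYa : (Y *ᵥ a) ⬝ᵥ (Y *ᵥ a) ≤ (Y *ᵥ b) ⬝ᵥ (Y *ᵥ b) + 6 * (r / m) := by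
      have h1 := dotProduct_self_le_add (Y *ᵥ a) (Y *ᵥ b) hinv
      rw [← Matrix.mulVec_sub] at h1
      have h2 := mul_le_mul_of_nonneg_left (hY (a - b)) hpos
      have h3 : (m : ℝ)⁻¹ * ((Y *ᵥ b) ⬝ᵥ (Y *ᵥ b)) ≤ (m : ℝ)⁻¹ * 4 :=
        mul_le_mul_of_nonneg_left ((hY b).trans hbb) hinv.le
      linarith
    have hXb : (X *ᵥ b) ⬝ᵥ (X *ᵥ b) ≤ (X *ᵥ a) ⬝ᵥ (X *ᵥ a) + 3 * (r / m) := by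
      have h1 := dotProduct_self_le_add (X *ᵥ b) (X *ᵥ a) hinv
      rw [← Matrix.mulVec_sub] at h1
      have h2 := mul_le_mul_of_nonneg_left (hX (b - a)) hpos
      have h3 : (m : ℝ)⁻¹ * ((X *ᵥ a) ⬝ᵥ (X *ᵥ a)) ≤ (m : ℝ)⁻¹ * 1 :=
        mul_le_mul_of_nonneg_left ((hX a).trans ha.le) hinv.le
      rw [hswap] at h2
      linarith
    have h4 : β * ((X *ᵥ b) ⬝ᵥ (X *ᵥ b) + c * (b ⬝ᵥ b)) ≤
        β * ((X *ᵥ a) ⬝ᵥ (X *ᵥ a) + 3 * (r / m) + 4 * c) := by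
      refine mul_le_mul_of_nonneg_left ?_ hβ
      nlinarith
    have h5 := h f
    linarith
  by_cases ha : a = 0
  · simp [ha]
  have haa : 0 < a ⬝ᵥ a := lt_of_le_of_ne (dotProduct_self_nonneg_real a)
    (Ne.symm (by rwa [Ne, dotProduct_self_eq_zero]))
  have hs := Real.mul_self_sqrt haa.le
  have hs0 : 0 < √(a ⬝ᵥ a) := Real.sqrt_pos.2 haa
  have e : ∀ (n : ℕ) (x : Fin n → ℝ), ((√(a ⬝ᵥ a))⁻¹ • x) ⬝ᵥ ((√(a ⬝ᵥ a))⁻¹ • x) =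
      (a ⬝ᵥ a)⁻¹ * (x ⬝ᵥ x) := by
    intro n x
    rw [smul_dotProduct, dotProduct_smul, smul_smul, ← mul_inv, hs, smul_eq_mul]
  have h1 := hunit ((√(a ⬝ᵥ a))⁻¹ • a) (by rw [e, inv_mul_cancel₀ haa.ne'])
  rw [Matrix.mulVec_smul, Matrix.mulVec_smul, e, e] at h1
  have h2 := mul_le_mul_of_nonneg_left h1 haa.le
  have e1 : ∀ x : ℝ, (a ⬝ᵥ a) * ((a ⬝ᵥ a)⁻¹ * x) = x := fun x => mul_inv_cancel_left₀ haa.ne' x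
  calc _ = (a ⬝ᵥ a) * ((a ⬝ᵥ a)⁻¹ * ((Y *ᵥ a) ⬝ᵥ (Y *ᵥ a)) + c') := by rw [mul_add, e1]; ring
    _ ≤ _ := h2
    _ = β * ((a ⬝ᵥ a) * ((a ⬝ᵥ a)⁻¹ * ((X *ᵥ a) ⬝ᵥ (X *ᵥ a))) + c' * (a ⬝ᵥ a)) := by ring
    _ = _ := by rw [e1]

/-! ### Growth of the determinant potential. -/

namespace QueryAlgorithm

variable {d : ℕ} {S : Type*} [MeasurableSpace S] (A : QueryAlgorithm d S)

theorem overlap_queryMatrix_succ {r : ℕ} (U : Matrix (Fin d) (Fin r) ℝ) (s : S)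
    (M : Matrix (Fin d) (Fin d) ℝ) (k : ℕ) :
    overlap U (A.queryMatrix s M (k + 1)) = overlap U (A.queryMatrix s M k) +
      Matrix.vecMulVec (Uᵀ *ᵥ A.query k s (A.history s M k))
        (Uᵀ *ᵥ A.query k s (A.history s M k)) := by
  have h : A.queryMatrix s M (k + 1) * (A.queryMatrix s M (k + 1))ᵀ =
      A.queryMatrix s M k * (A.queryMatrix s M k)ᵀ +
      Matrix.vecMulVec (A.query k s (A.history s M k)) (A.query k s (A.history s M k)) := by
    ext i j
    rw [A.queryMatrix_succ_eq, Matrix.mul_apply, Fin.sum_univ_castSucc]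
    simp [queryMatrixOfHistory, queryMatrix, Matrix.mul_apply, Matrix.vecMulVec_apply]
  rw [overlap, overlap, Matrix.mul_assoc Uᵀ, h, Matrix.mul_add, Matrix.add_mul,
    Matrix.mul_vecMulVec, Matrix.vecMulVec_mul, ← Matrix.mulVec_transpose, ← Matrix.mul_assoc Uᵀ]

/-- Each query adds a positive semidefinite rank-one term to the overlap, so the one-step
determinant bound multiplies up from the value c^r at k = 0. -/
theorem det_overlap_le {r : ℕ} (U : Matrix (Fin d) (Fin r) ℝ) (s : S)
    (M : Matrix (Fin d) (Fin d) ℝ) {β c : ℝ} (hβ : 1 ≤ β) (hc : 0 < c) (k : ℕ)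
    (h : ∀ i < k, ∀ a : Fin r → ℝ, A.seen s M (i + 1) (U *ᵥ a) + c * (a ⬝ᵥ a) ≤
      β * (A.seen s M i (U *ᵥ a) + c * (a ⬝ᵥ a))) :
    (overlap U (A.queryMatrix s M k) + c • (1 : Matrix (Fin r) (Fin r) ℝ)).det ≤
      c ^ r * β ^ k := by
  have hquad : ∀ (i : ℕ) (a : Fin r → ℝ), a ⬝ᵥ ((overlap U (A.queryMatrix s M i) +
      c • (1 : Matrix (Fin r) (Fin r) ℝ)) *ᵥ a) = A.seen s M i (U *ᵥ a) + c * (a ⬝ᵥ a) := by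
    intro i a
    rw [Matrix.add_mulVec, dotProduct_add, dotProduct_overlap_mulVec, Matrix.smul_mulVec,
      Matrix.one_mulVec, dotProduct_smul, smul_eq_mul, seen]
  induction k with
  | zero =>
    have : overlap U (A.queryMatrix s M 0) = 0 := by
      ext i j
      simp [overlap]
    rw [this, zero_add, Matrix.det_smul]
    simp
  | succ k ih =>
    have hpos : (overlap U (A.queryMatrix s M k) + c • (1 : Matrix (Fin r) (Fin r) ℝ)).PosDef :=
      Matrix.PosDef.posSemidef_add (overlap_posSemidef _ _) (Matrix.PosDef.one.smul hc)
    have e : overlap U (A.queryMatrix s M (k + 1)) + c • (1 : Matrix (Fin r) (Fin r) ℝ) =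
        overlap U (A.queryMatrix s M k) + c • (1 : Matrix (Fin r) (Fin r) ℝ) +
        Matrix.vecMulVec (Uᵀ *ᵥ A.query k s (A.history s M k))
        (Uᵀ *ᵥ A.query k s (A.history s M k)) := by
      rw [A.overlap_queryMatrix_succ]
      abel
    have h1 := det_add_vecMulVec_le hpos (Uᵀ *ᵥ A.query k s (A.history s M k)) hβ (by
      intro v
      rw [← e, hquad, hquad]
      exact h k k.lt_succ_self v)
    rw [e]
    refine h1.trans ?_
    have h2 := mul_le_mul_of_nonneg_left (ih fun i hi => h i (hi.trans k.lt_succ_self))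
      (zero_le_one.trans hβ)
    calc _ ≤ _ := h2
      _ = _ := by ring

end QueryAlgorithm

/-! ### Choice of constants. -/

section constants

variable {lam : ℝ}

theorem asymptoticGap_eq (hlam : 1 < lam) :
    asymptoticGap lam = (lam - 1) ^ 2 / (lam ^ 2 + 1) := by
  have h0 : lam ≠ 0 := by linarith
  rw [asymptoticGap]
  field_simp
  ring

theorem asymptoticGap_pos (hlam : 1 < lam) : 0 < asymptoticGap lam := by
  rw [asymptoticGap_eq hlam]
  have : 0 < lam - 1 := by linarith
  positivity

theorem asymptoticGap_le (hlam : 1 < lam) : asymptoticGap lam ≤ (lam - 1) / lam := by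
  rw [asymptoticGap_eq hlam, div_le_div_iff₀ (by positivity) (by linarith)]
  nlinarith

theorem asymptoticGap_sq_le (hlam : 1 < lam) : asymptoticGap lam ^ 2 ≤ (lam - 1) / lam := by
  have h1 := asymptoticGap_le hlam
  have h2 : (lam - 1) / lam ≤ 1 := (div_le_one (by linarith)).2 (by linarith)
  have h3 := asymptoticGap_pos hlam
  nlinarith

/-- The right side is the gain produced by c, in units of r log(20 d²) log(e/δ). On the left, 2 pays
for -log η and the fraction pays for the χ² normalisation. -/
theorem gap_threshold (hlam : 1 < lam) :
    2 + 1 / (36 * lam * (lam - 1)) ≤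
      5 / 2 * lam * (lam - 1) ^ 2 * (lam + 1) / asymptoticGap lam ^ 2 := by
  obtain ⟨x, rfl⟩ : ∃ x, lam = x + 1 := ⟨lam - 1, by ring⟩
  have hx : 0 < x := by linarith
  have e : 5 / 2 * (x + 1) * (x + 1 - 1) ^ 2 * (x + 1 + 1) / asymptoticGap (x + 1) ^ 2 =
      5 / 2 * (x + 1) * (x + 2) * ((x + 1) ^ 2 + 1) ^ 2 / x ^ 2 := by
    rw [asymptoticGap_eq hlam]
    have : (x + 1) ^ 2 + 1 ≠ 0 := by positivity
    have h1 : x + 1 - 1 = x := by ring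
    rw [h1]
    field_simp
    ring
  rw [e, le_div_iff₀ (by positivity)]
  have h2 : 1 / (36 * (x + 1) * (x + 1 - 1)) * x ^ 2 ≤ x := by
    have : 1 / (36 * (x + 1) * (x + 1 - 1)) * x ^ 2 = x / (36 * (x + 1)) := by
      have h1 : x + 1 - 1 = x := by ring
      rw [h1]
      field_simp
    rw [this]
    exact div_le_self hx.le (by linarith)
  have h3 : (1 : ℝ) ≤ ((x + 1) ^ 2 + 1) ^ 2 := by
    have : (1 : ℝ) ≤ (x + 1) ^ 2 + 1 := by nlinarith
    nlinarith
  have h4 : 0 ≤ 5 / 2 * (x + 1) * (x + 2) := by positivity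
  calc _ = 2 * x ^ 2 + 1 / (36 * (x + 1) * (x + 1 - 1)) * x ^ 2 := by ring
    _ ≤ 2 * x ^ 2 + x := by linarith
    _ ≤ 5 / 2 * (x + 1) * (x + 2) * 1 := by nlinarith
    _ ≤ _ := mul_le_mul_of_nonneg_left h3 h4

variable {d r : ℕ} {δ : ℝ}

theorem three_le_log (hd2 : 2 ≤ d) : 3 ≤ Real.log (20 * (d : ℝ) ^ 2) := by
  have h2 : (2 : ℝ) ≤ d := by exact_mod_cast hd2
  rw [Real.le_log_iff_exp_le (by positivity)]
  have h := Real.exp_one_lt_d9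
  have e : Real.exp 3 = Real.exp 1 ^ 3 := by
    rw [← Real.exp_nat_mul]
    norm_num
  rw [e]
  calc Real.exp 1 ^ 3 ≤ 3 ^ 3 := pow_le_pow_left₀ (Real.exp_pos _).le (by linarith) 3
    _ ≤ _ := by nlinarith

theorem log_exp_div (hδ0 : 0 < δ) : Real.log (Real.exp 1 / δ) = 1 - Real.log δ := by
  rw [Real.log_div (Real.exp_pos 1).ne' hδ0.ne', Real.log_exp]

/-- The tail bound for one direction beats the union bound. -/
theorem jump_tail_le (hlam : 1 < lam) (hd : 1 ≤ d) (hr : 1 ≤ r) (hδ0 : 0 < δ) (hδ1 : δ < 1)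
    {k : ℕ} (hk : 18 * k * Real.log lam ≤ r * Real.log (20 * (d : ℝ) ^ 2))
    (hl : 1 ≤ Real.log (20 * (d : ℝ) ^ 2)) {θ : ℝ} (hθ : 2 * θ ≤ (lam ^ 2)⁻¹) {η c : ℝ}
    (hη : η = δ / (d * (2 * d + 1) ^ r))
    (hc : c = 5 * r * Real.log (20 * (d : ℝ) ^ 2) * Real.log (Real.exp 1 / δ) * (lam - 1) /
      (d * lam * asymptoticGap lam ^ 2)) :
    η ^ (-(1 / (lam ^ 2 - 1))) * Real.exp (-(lam ^ 2 * (d / 2 * lam ^ 2) * c)) *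
      (1 - 2 * θ) ^ (-(k / 2) : ℝ) ≤ η := by
  set ℓ := Real.log (20 * (d : ℝ) ^ 2) with hℓ
  set Λ := Real.log (Real.exp 1 / δ) with hΛ
  have hg := asymptoticGap_pos hlam
  have hd1 : (1 : ℝ) ≤ d := by exact_mod_cast hd
  have hr1 : (1 : ℝ) ≤ r := by exact_mod_cast hr
  have hlam0 : 0 < lam := by linarith
  have hp1 : 0 < lam ^ 2 - 1 := by nlinarith
  have hη0 : 0 < η := by rw [hη]; positivity
  have hy : (lam ^ 2)⁻¹ < 1 := inv_lt_one_of_one_lt₀ (by linarith)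
  have hθ1 : 0 < 1 - 2 * θ := by linarith
  have hΛ1 : 1 ≤ Λ := by
    rw [hΛ, log_exp_div hδ0]
    linarith [Real.log_nonpos hδ0.le hδ1.le]
  -- The cost of the union bound: log(1/δ), one log d for the rounds and r log(2d + 1) for the grid.
  have hlogη : -Real.log η ≤ 2 * (r * ℓ * Λ) := by
    have h1 : Real.log η = Real.log δ - (Real.log d + r * Real.log (2 * d + 1)) := by
      rw [hη, Real.log_div hδ0.ne' (by positivity), Real.log_mul (by positivity) (by positivity),
        Real.log_pow]
    have h2 : Real.log d ≤ ℓ := Real.log_le_log (by linarith) (by nlinarith)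
    have h3 : Real.log (2 * d + 1) ≤ ℓ := Real.log_le_log (by linarith) (by nlinarith)
    have h4 : Real.log δ = 1 - Λ := by rw [hΛ, log_exp_div hδ0]; ring
    have h5 : (r : ℝ) * Real.log (2 * d + 1) ≤ r * ℓ := mul_le_mul_of_nonneg_left h3 (by linarith)
    have h6 : 1 ≤ r * ℓ := by nlinarith
    have h7 : ℓ ≤ r * ℓ := by nlinarith
    rw [h1, h4]
    nlinarith
  have hlog : (1 - (lam ^ 2)⁻¹) * -Real.log (1 - 2 * θ) ≤ (lam ^ 2)⁻¹ := by
    have h1 : 0 < 1 - (lam ^ 2)⁻¹ := by linarith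
    have h2 : Real.log (1 - (lam ^ 2)⁻¹) ≤ Real.log (1 - 2 * θ) :=
      Real.log_le_log h1 (by linarith)
    have h3 := Real.one_sub_inv_le_log_of_pos h1
    calc (1 - (lam ^ 2)⁻¹) * -Real.log (1 - 2 * θ)
        ≤ (1 - (lam ^ 2)⁻¹) * ((1 - (lam ^ 2)⁻¹)⁻¹ - 1) :=
          mul_le_mul_of_nonneg_left (by linarith) h1.le
      _ = (lam ^ 2)⁻¹ := by
          rw [mul_sub, mul_inv_cancel₀ h1.ne']
          ring
  -- The restriction on k enters here, through log λ ≥ (λ - 1)/λ.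
  have hkb : (k : ℝ) / 2 * (lam ^ 2)⁻¹ ≤ r * ℓ * Λ * (1 / (36 * lam * (lam - 1))) := by
    have h1 := Real.one_sub_inv_le_log_of_pos hlam0
    have h2 : (lam - 1) / lam ≤ Real.log lam := by
      rwa [sub_div, div_self hlam0.ne', one_div]
    have h3 : 18 * k * ((lam - 1) / lam) ≤ r * ℓ :=
      (mul_le_mul_of_nonneg_left h2 (by positivity)).trans hk
    have h4 : (r : ℝ) * ℓ ≤ r * ℓ * Λ := le_mul_of_one_le_right (by positivity) hΛ1
    have hl1 : 0 < lam - 1 := by linarith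
    calc (k : ℝ) / 2 * (lam ^ 2)⁻¹ =
        (18 * k * ((lam - 1) / lam)) * (1 / (36 * lam * (lam - 1))) := by
          field_simp
          ring
      _ ≤ _ := mul_le_mul_of_nonneg_right (h3.trans h4) (by positivity)
  have hcv : (lam ^ 2 - 1) * (d / 2 * lam ^ 2) * c = r * ℓ * Λ *
      (5 / 2 * lam * (lam - 1) ^ 2 * (lam + 1) / asymptoticGap lam ^ 2) := by
    rw [hc]
    field_simp
    ring
  have hmain : -Real.log η + (1 - (lam ^ 2)⁻¹) * (k / 2 * -Real.log (1 - 2 * θ)) ≤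
      (lam ^ 2 - 1) * (d / 2 * lam ^ 2) * c := by
    have h1 := mul_le_mul_of_nonneg_left (gap_threshold hlam)
      (show 0 ≤ r * ℓ * Λ by positivity)
    have h2 := mul_le_mul_of_nonneg_left hlog (show (0 : ℝ) ≤ k / 2 by positivity)
    rw [hcv]
    linarith
  rw [Real.rpow_def_of_pos hη0, Real.rpow_def_of_pos hθ1, ← Real.exp_add, ← Real.exp_add]
  conv_rhs => rw [← Real.exp_log hη0]
  refine Real.exp_le_exp.2 ?_
  -- With p = λ², the factor p/(p - 1) = 1 + 1/(p - 1) collects the two powers of η.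
  have h3 := mul_le_mul_of_nonneg_left hmain
    (show 0 ≤ lam ^ 2 / (lam ^ 2 - 1) by positivity)
  have e1 : lam ^ 2 / (lam ^ 2 - 1) * ((lam ^ 2 - 1) * (d / 2 * lam ^ 2) * c) =
      lam ^ 2 * (d / 2 * lam ^ 2) * c := by
    field_simp
  have e2 : lam ^ 2 / (lam ^ 2 - 1) * (-Real.log η + (1 - (lam ^ 2)⁻¹) *
      (k / 2 * -Real.log (1 - 2 * θ))) =
      -Real.log η - Real.log η * (1 / (lam ^ 2 - 1)) + k / 2 * -Real.log (1 - 2 * θ) := by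
    field_simp
    ring
  rw [e1, e2] at h3
  linarith

/-- In units of Y = (r ℓ Λ / d) · ((λ - 1)/λ) / gap², the left side is at most (1 + 20 + 2) λ^9 Y.
The right side is at least 26 λ^9 Y, because λ^9 - 1 ≥ λ^9 (λ - 1)/λ. -/
theorem grid_constants_le (hlam : 1 < lam) (hd : 1 ≤ d)
    {ℓ Λ : ℝ} (hℓ : 3 ≤ ℓ) (hΛ : 1 ≤ Λ) {c c' : ℝ}
    (hc : c = 5 * r * ℓ * Λ * (lam - 1) / (d * lam * asymptoticGap lam ^ 2))
    (hc' : c' = 26 * r * ℓ * Λ / (d * asymptoticGap lam ^ 2)) :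
    lam ^ 9 * (3 * (r / d) + 4 * c) + 6 * (r / d) ≤ (lam ^ 9 - 1) * c' := by
  have hg := asymptoticGap_pos hlam
  have hd1 : (1 : ℝ) ≤ d := by exact_mod_cast hd
  have hlam0 : 0 < lam := by linarith
  have hl1 : 0 < lam - 1 := by linarith
  have hβ : (1 : ℝ) ≤ lam ^ 8 := one_le_pow₀ hlam.le
  set X : ℝ := r * ℓ * Λ / d with hX
  have hX0 : 0 ≤ X := by positivity
  have hrX : 3 * ((r : ℝ) / d) ≤ X := by
    have h1 : 3 ≤ ℓ * Λ := by nlinarith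
    calc 3 * ((r : ℝ) / d) ≤ (ℓ * Λ) * (r / d) := mul_le_mul_of_nonneg_right h1 (by positivity)
      _ = X := by rw [hX]; ring
  have hc2 : c = 5 * (X * ((lam - 1) / lam / asymptoticGap lam ^ 2)) := by
    rw [hc, hX]
    field_simp
  have hc2' : c' = 26 * (X / asymptoticGap lam ^ 2) := by
    rw [hc', hX]
    field_simp
  have h1 : 1 ≤ (lam - 1) / lam / asymptoticGap lam ^ 2 := by
    rw [le_div_iff₀ (by positivity), one_mul]
    exact asymptoticGap_sq_le hlam
  have h2 : X ≤ X * ((lam - 1) / lam / asymptoticGap lam ^ 2) := le_mul_of_one_le_right hX0 h1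
  have hβ9 : 1 ≤ lam ^ 9 := one_le_pow₀ hlam.le
  have h3 : lam ^ 9 * ((lam - 1) / lam) ≤ lam ^ 9 - 1 := by
    have : lam ^ 9 * ((lam - 1) / lam) = lam ^ 9 - lam ^ 8 := by
      field_simp
    linarith
  have h4 : (lam ^ 9 * ((lam - 1) / lam)) * c' ≤ (lam ^ 9 - 1) * c' :=
    mul_le_mul_of_nonneg_right h3 (by rw [hc2']; positivity)
  have h5 : (lam ^ 9 * ((lam - 1) / lam)) * c' =
      26 * (lam ^ 9 * (X * ((lam - 1) / lam / asymptoticGap lam ^ 2))) := by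
    rw [hc2']
    ring
  set Y := X * ((lam - 1) / lam / asymptoticGap lam ^ 2) with hY
  have h6 : 6 * ((r : ℝ) / d) ≤ lam ^ 9 * (2 * Y) := by nlinarith
  have h7 : lam ^ 9 * (3 * (r / d) + 4 * c) ≤ lam ^ 9 * (Y + 20 * Y) :=
    mul_le_mul_of_nonneg_left (by linarith) (by linarith)
  have h8 : 0 ≤ lam ^ 9 * Y := by positivity
  linarith

end constants

/-! ### Assembly: independence, union bound, conclusion. -/

/-- Fubini: conditioning on the seed reduces a randomized algorithm to deterministic ones. -/
theorem measure_le_of_indepFun {Ω α β' S : Type*} [MeasurableSpace Ω] [MeasurableSpace α]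
    [MeasurableSpace β'] [MeasurableSpace S] {μ : Measure Ω} [IsProbabilityMeasure μ]
    {X : Ω → α} {Y : Ω → β'} {Z : Ω → S} (hX : Measurable X) (hY : Measurable Y)
    (hZ : Measurable Z) (hXY : IndepFun X Y μ) (hXYZ : IndepFun (fun ω => (X ω, Y ω)) Z μ)
    {B : Set ((α × β') × S)} (hB : MeasurableSet B) {ε : ENNReal}
    (h : ∀ s, ∫⁻ y, μ.map X {x | ((x, y), s) ∈ B} ∂(μ.map Y) ≤ ε) :
    μ {ω | ((X ω, Y ω), Z ω) ∈ B} ≤ ε := by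
  have hXp := Measure.isProbabilityMeasure_map (μ := μ) hX.aemeasurable
  have hYp := Measure.isProbabilityMeasure_map (μ := μ) hY.aemeasurable
  have hZp := Measure.isProbabilityMeasure_map (μ := μ) hZ.aemeasurable
  have h1 := (indepFun_iff_map_prod_eq_prod_map_map (hX.prodMk hY).aemeasurable
    hZ.aemeasurable).1 hXYZ
  have h2 := (indepFun_iff_map_prod_eq_prod_map_map hX.aemeasurable hY.aemeasurable).1 hXY
  have h3 : μ {ω | ((X ω, Y ω), Z ω) ∈ B} =
      μ.map (fun ω => ((X ω, Y ω), Z ω)) B :=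
    (Measure.map_apply ((hX.prodMk hY).prodMk hZ) hB).symm
  rw [h3, h1, h2, Measure.prod_apply_symm hB]
  calc _ ≤ ∫⁻ _, ε ∂(μ.map Z) := by
        refine lintegral_mono fun s => ?_
        rw [Measure.prod_apply_symm (measurable_prodMk_right hB)]
        exact h s
    _ = ε := by rw [lintegral_const, measure_univ, mul_one]

theorem measurableSet_stiefel (d k : ℕ) : MeasurableSet (Stiefel d k) := by
  have h : Stiefel d k = ⋂ i, ⋂ j, {V | (Vᵀ * V) i j = (1 : Matrix (Fin k) (Fin k) ℝ) i j} := by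
    ext V
    simp only [Set.mem_iInter]
    exact Matrix.ext_iff.symm
  rw [h]
  refine MeasurableSet.iInter fun i => MeasurableSet.iInter fun j =>
    measurableSet_eq_fun (measurable_matrix_iff.1 ?_ i j) measurable_const
  exact measurable_matrix_mul (measurable_matrix_transpose measurable_id) measurable_id

/-- Subadditivity on N ∪ G suffices, so the good event G need not be measurable. -/
theorem one_sub_le_measureReal {Ω : Type*} [MeasurableSpace Ω] {μ : Measure Ω}
    [IsProbabilityMeasure μ] {N G : Set Ω} {δ : ℝ} (hδ : 0 ≤ δ) (hN : μ N ≤ ENNReal.ofReal δ)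
    (h : ∀ᵐ ω ∂μ, ω ∉ N → ω ∈ G) : 1 - δ ≤ μ.real G := by
  have h1 : μ Set.univ ≤ μ (N ∪ G) := measure_mono_ae (by
    filter_upwards [h] with ω hω _
    by_cases hn : ω ∈ N
    · exact Or.inl hn
    · exact Or.inr (hω hn))
  rw [measure_univ] at h1
  have h2 := h1.trans ((measure_union_le N G).trans (add_le_add_left hN _))
  rw [← ofReal_measureReal (s := G), ← ENNReal.ofReal_add hδ measureReal_nonneg,
    ENNReal.one_le_ofReal] at h2
  linarith

theorem card_le_of_mem_stiefel {d k : ℕ} {V : Matrix (Fin d) (Fin k) ℝ} (hV : V ∈ Stiefel d k) :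
    k ≤ d := by
  have hV' : Vᵀ * V = 1 := hV
  have h := Matrix.rank_mul_le_left Vᵀ V
  rw [hV', Matrix.rank_one, Fintype.card_fin] at h
  simpa using h.trans (Matrix.rank_le_width Vᵀ)

namespace QueryAlgorithm

variable {d : ℕ} {S : Type*} [MeasurableSpace S] (A : QueryAlgorithm d S)

theorem seen_smul (s : S) (M : Matrix (Fin d) (Fin d) ℝ) (k : ℕ) (t : ℝ) (x : Fin d → ℝ) :
    A.seen s M k (t • x) = t ^ 2 * A.seen s M k x := by
  rw [seen, seen, Matrix.mulVec_smul, smul_dotProduct, dotProduct_smul, smul_eq_mul, smul_eq_mul]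
  ring

variable {A} in
/-- The probability that one query multiplies the (regularised) overlap with a fixed direction by
more than `lam ^ 9`. -/
theorem IsOrthonormal.measure_jump_le {r T : ℕ} (hA : A.IsOrthonormal T) {lam : ℝ}
    (hlam : 1 < lam) (hrd : lam * r ≤ (lam - 1) * d) (hd : 0 < d)
    {Ω : Type*} [MeasurableSpace Ω] {μ : Measure Ω} [IsProbabilityMeasure μ]
    {W : Ω → Matrix (Fin d) (Fin d) ℝ} {U : Ω → Matrix (Fin d) (Fin r) ℝ}
    (hW : IsGOE W μ) (hU : IsUniformStiefel U μ) (hWU : IndepFun W U μ)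
    {seed : Ω → S} (hseed : Measurable seed) (hindep : IndepFun (fun ω => (W ω, U ω)) seed μ)
    {k : ℕ} (hk : k + 1 ≤ T) {η c : ℝ} (hη : 0 < η)
    (htail : ∀ θ, 2 * θ ≤ (lam ^ 2)⁻¹ → η ^ (-(1 / (lam ^ 2 - 1))) *
      Real.exp (-(lam ^ 2 * (d / 2 * lam ^ 2) * c)) * (1 - 2 * θ) ^ (-((k + 1 : ℕ) / 2) : ℝ) ≤ η)
    (b : Fin r → ℝ) :
    μ {ω | lam ^ 9 * (A.seen (seed ω) (W ω + lam • (U ω * (U ω)ᵀ)) k (U ω *ᵥ b) +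
        c * (b ⬝ᵥ b)) < A.seen (seed ω) (W ω + lam • (U ω * (U ω)ᵀ)) (k + 1) (U ω *ᵥ b)} ≤
      ENNReal.ofReal η := by
  have hlam0 : 0 < lam := by linarith
  by_cases hb : b = 0
  · simp [hb, seen]
  have hbb : 0 < b ⬝ᵥ b := lt_of_le_of_ne (dotProduct_self_nonneg_real b)
    (Ne.symm (by rwa [Ne, dotProduct_self_eq_zero]))
  have hs := Real.sq_sqrt hbb.le
  have hs0 : 0 < √(b ⬝ᵥ b) := Real.sqrt_pos.2 hbb
  set a := (√(b ⬝ᵥ b))⁻¹ • b with ha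
  have haa : a ⬝ᵥ a = 1 := by
    rw [ha, smul_dotProduct, dotProduct_smul, smul_smul, ← mul_inv, ← sq, hs, smul_eq_mul,
      inv_mul_cancel₀ hbb.ne']
  have hba : b = √(b ⬝ᵥ b) • a := by rw [ha, smul_inv_smul₀ hs0.ne']
  -- Grid vectors are not unit vectors, but the event is homogeneous of degree two.
  have hscale : ∀ s M (V : Matrix (Fin d) (Fin r) ℝ),
      (lam ^ 9 * (A.seen s M k (V *ᵥ b) + c * (b ⬝ᵥ b)) < A.seen s M (k + 1) (V *ᵥ b)) ↔
      lam ^ 9 * (A.seen s M k (V *ᵥ a) + c) < A.seen s M (k + 1) (V *ᵥ a) := by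
    intro s M V
    have e : V *ᵥ b = √(b ⬝ᵥ b) • (V *ᵥ a) := by rw [← Matrix.mulVec_smul, ← hba]
    rw [e, A.seen_smul, A.seen_smul, hs, ← mul_lt_mul_iff_right₀ hbb (c := A.seen s M _ (V *ᵥ a))]
    refine Eq.to_iff (congrArg₂ _ ?_ rfl)
    ring
  simp only [hscale]
  have hWp := Measure.isProbabilityMeasure_map (μ := μ) hW.measurable.aemeasurable
  have hUp := Measure.isProbabilityMeasure_map (μ := μ) hU.measurable.aemeasurable
  have hmem : ∀ᵐ V ∂(μ.map U), V ∈ Stiefel d r := by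
    rw [ae_map_iff hU.measurable.aemeasurable]
    · exact hU.mem
    · exact measurableSet_stiefel d r
  have hinv : ∀ Q : Matrix (Fin d) (Fin d) ℝ, Q * Qᵀ = 1 →
      (μ.map U).map (fun V => Q * V) = μ.map U := by
    intro Q hQ
    have hm : Measurable fun V : Matrix (Fin d) (Fin r) ℝ => Q * V :=
      measurable_matrix_mul measurable_const measurable_id
    rw [Measure.map_map hm hU.measurable]
    exact hU.invariant Q ((Matrix.mem_orthogonalGroup_iff (Fin d) ℝ).2 hQ)
  have hdr : (d : ℝ) ≤ lam * (d - r + 1) := by linarith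
  have hdr0 : (0 : ℝ) < d - r + 1 := by
    have : (0 : ℝ) < d := by exact_mod_cast hd
    by_contra hneg
    nlinarith
  have hp : 1 < lam ^ 2 := by nlinarith
  -- This θ solves the matching condition for p = λ² and β = λ^9. Then 2θ ≤ λ⁻², since d ≤ λ (d - r
  -- + 1).
  set θ : ℝ := d / (2 * lam ^ 5 * (d - r + 1)) with hθdef
  have hθ0 : 0 ≤ θ := by positivity
  have hθ2 : 2 * θ ≤ (lam ^ 2)⁻¹ := by
    have e : 2 * θ = d / (lam ^ 5 * (d - r + 1)) := by
      rw [hθdef]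
      field_simp
    rw [e, ← one_div, div_le_div_iff₀ (by positivity) (by positivity)]
    have h1 : (1 : ℝ) ≤ lam ^ 2 := hp.le
    calc (d : ℝ) * lam ^ 2 ≤ (lam * (d - r + 1)) * lam ^ 2 :=
          mul_le_mul_of_nonneg_right hdr (by positivity)
      _ ≤ (lam * (d - r + 1)) * lam ^ 2 * lam ^ 2 := le_mul_of_one_le_right (by positivity) h1
      _ = _ := by ring
  have hθ : θ < 1 / 2 := by
    have := inv_lt_one_of_one_lt₀ hp
    linarith
  have hθβ : θ * (d - r + 1) * lam ^ 9 = lam ^ 2 * (d / 2 * lam ^ 2) := by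
    rw [hθdef]
    field_simp
  have hpi : 0 ≤ 1 - (lam ^ 2)⁻¹ := by linarith [inv_lt_one_of_one_lt₀ hp]
  refine measure_le_of_indepFun hW.measurable hU.measurable hseed hWU hindep
    (B := {x | lam ^ 9 * (A.seen x.2 (x.1.1 + lam • (x.1.2 * x.1.2ᵀ)) k (x.1.2 *ᵥ a) + c) <
      A.seen x.2 (x.1.1 + lam • (x.1.2 * x.1.2ᵀ)) (k + 1) (x.1.2 *ᵥ a)}) ?_ fun s => ?_
  · have hm2 : Measurable fun x : (Matrix (Fin d) (Fin d) ℝ × Matrix (Fin d) (Fin r) ℝ) × S =>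
        x.1.2 := measurable_snd.comp measurable_fst
    have hM : Measurable fun x : (Matrix (Fin d) (Fin d) ℝ × Matrix (Fin d) (Fin r) ℝ) × S =>
        x.1.1 + lam • (x.1.2 * x.1.2ᵀ) :=
      measurable_matrix_add (measurable_fst.comp measurable_fst) (measurable_matrix_smul
        measurable_const (measurable_matrix_mul hm2 (measurable_matrix_transpose hm2)))
    have hx : Measurable fun x : (Matrix (Fin d) (Fin d) ℝ × Matrix (Fin d) (Fin r) ℝ) × S =>
        x.1.2 *ᵥ a := measurable_mulVec hm2 measurable_const
    exact measurableSet_lt (((A.measurable_seen measurable_snd hM hx k).add_const c).const_mul _)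
      (A.measurable_seen measurable_snd hM hx (k + 1))
  · refine (hA.lintegral_jump_le hd s haa hW.isGOELaw hmem hinv hk hp hη (pow_pos hlam0 9) hθ0 hθ
      hθβ).trans ?_
    rw [← ENNReal.ofReal_add (by positivity) (by
      have : 0 ≤ 1 - 2 * θ := by linarith
      positivity)]
    refine ENNReal.ofReal_le_ofReal ?_
    have h := mul_le_mul_of_nonneg_left (htail θ hθ2) hpi
    linarith

variable {A} in
/-- On the event that no query makes a large jump in a grid direction, the eigenvalues of the
overlap matrix grow at most geometrically. -/
theorem IsOrthonormal.sortedEigenvalue_overlap_le {r T : ℕ} (hA : A.IsOrthonormal T) (hr : 1 ≤ r)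
    (hrd : r ≤ d) {U : Matrix (Fin d) (Fin r) ℝ} (hU : U ∈ Stiefel d r) (s : S)
    {M : Matrix (Fin d) (Fin d) ℝ} (hM : M.IsSymm) {β c c' : ℝ} (hβ : 1 ≤ β) (hc : 0 ≤ c)
    (hc0 : 0 < c') (hc' : β * (3 * (r / d) + 4 * c) + 6 * (r / d) ≤ (β - 1) * c') {k : ℕ}
    (hk : k ≤ T)
    (h : ∀ i < k, ∀ f : Fin r → Fin (2 * d + 1), A.seen s M (i + 1) (U *ᵥ gridVec f) ≤
      β * (A.seen s M i (U *ᵥ gridVec f) + c * (gridVec f ⬝ᵥ gridVec f))) (j : Fin r) :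
    sortedEigenvalue (overlap_isHermitian U (A.queryMatrix s M k)) j ≤
      c' * (β ^ k) ^ (1 / ((j : ℝ) + 1)) := by
  refine sortedEigenvalue_le_of_det_le _ (overlap_posSemidef _ _) hc0
    (pow_nonneg (zero_le_one.trans hβ) _) (A.det_overlap_le U s M hβ hc0 k fun i hi a => ?_) j
  have hcontr : ∀ l ≤ T, ∀ a : Fin r → ℝ, (((A.queryMatrix s M l)ᵀ * U) *ᵥ a) ⬝ᵥ
      (((A.queryMatrix s M l)ᵀ * U) *ᵥ a) ≤ a ⬝ᵥ a := by
    intro l hl a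
    rw [← Matrix.mulVec_mulVec]
    exact (stiefel_transpose_mulVec_le (hA.mem_stiefel s hM hl) _).trans
      (stiefel_mulVec_dotProduct hU a).le
  have hq := quadratic_le_of_grid hr hrd (hcontr i (hi.le.trans hk))
    (hcontr (i + 1) (Nat.succ_le_of_lt (hi.trans_le hk))) (zero_le_one.trans hβ) hc (fun f => by
      simpa only [← Matrix.mulVec_mulVec, seen] using h i hi f) hc' a
  simpa only [← Matrix.mulVec_mulVec, seen] using hq

variable {A} in
theorem IsOrthonormal.sortedEigenvalue_overlap_le_one {r T : ℕ} (hA : A.IsOrthonormal T)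
    {U : Matrix (Fin d) (Fin r) ℝ} (hU : U ∈ Stiefel d r) (s : S)
    {M : Matrix (Fin d) (Fin d) ℝ} (hM : M.IsSymm) {k : ℕ} (hk : k ≤ T) (j : Fin r) :
    sortedEigenvalue (overlap_isHermitian U (A.queryMatrix s M k)) j ≤ 1 := by
  refine sortedEigenvalue_le_one _ (fun x => ?_) j
  rw [dotProduct_overlap_mulVec]
  exact (stiefel_transpose_mulVec_le (hA.mem_stiefel s hM hk) _).trans
    (stiefel_mulVec_dotProduct hU x).le

end QueryAlgorithm

theorem mainTheorem3 {d r T : ℕ} {lam δ : ℝ} (hlam : 1 < lam)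
    (hd : asymptoticGap lam ^ (-(1 / 2) : ℝ) ≤ (d : ℝ)) (hδ0 : 0 < δ) (hδ1 : δ < 1)
    {Ω : Type*} [MeasurableSpace Ω] (μ : Measure Ω) [IsProbabilityMeasure μ]
    (W : Ω → Matrix (Fin d) (Fin d) ℝ) (U : Ω → Matrix (Fin d) (Fin r) ℝ)
    (hW : IsGOE W μ) (hU : IsUniformStiefel U μ) (hWU : IndepFun W U μ)
    {S : Type*} [MeasurableSpace S] (seed : Ω → S) (hseed : Measurable seed)
    (hindep : IndepFun (fun ω => (W ω, U ω)) seed μ)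
    (A : QueryAlgorithm d S) (hA : A.IsOrthonormal T) :
    1 - δ ≤ μ.real {ω | ∀ k ∈ Finset.Icc 1 T, ∀ j : Fin r,
      sortedEigenvalue (overlap_isHermitian (U ω)
          (A.queryMatrix (seed ω) (W ω + lam • (U ω * (U ω)ᵀ)) k)) j ≤
        26 * (r : ℝ) * lam ^ (9 * (k : ℝ) / ((j : ℝ) + 1)) * Real.log (20 * (d : ℝ) ^ 2)
            * Real.log (Real.exp 1 / δ) /
          ((d : ℝ) * asymptoticGap lam ^ 2)} := by
  have hg := asymptoticGap_pos hlam
  have hlam0 : 0 < lam := by linarith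
  have hg1 : asymptoticGap lam < 1 :=
    (asymptoticGap_le hlam).trans_lt ((div_lt_one hlam0).2 (by linarith))
  have hd2 : 2 ≤ d := by
    have h1 : (1 : ℝ) < d :=
      (Real.one_lt_rpow_of_pos_of_lt_one_of_neg hg hg1 (by norm_num)).trans_le hd
    exact_mod_cast h1
  have hd0 : (0 : ℝ) < d := by positivity
  rcases Nat.eq_zero_or_pos r with rfl | hr
  · simpa using hδ0.le
  have hr0 : (0 : ℝ) < r := by exact_mod_cast hr
  have hℓ := three_le_log hd2
  have hΛ : 1 ≤ Real.log (Real.exp 1 / δ) := by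
    rw [log_exp_div hδ0]
    linarith [Real.log_nonpos hδ0.le hδ1.le]
  set ℓ := Real.log (20 * (d : ℝ) ^ 2) with hℓdef
  set Λ := Real.log (Real.exp 1 / δ) with hΛdef
  obtain ⟨c', hc'⟩ : ∃ c', c' = 26 * r * ℓ * Λ / (d * asymptoticGap lam ^ 2) := ⟨_, rfl⟩
  obtain ⟨c, hc⟩ : ∃ c, c = 5 * r * ℓ * Λ * (lam - 1) / (d * lam * asymptoticGap lam ^ 2) :=
    ⟨_, rfl⟩
  obtain ⟨η, hη⟩ : ∃ η, η = δ / (d * (2 * d + 1) ^ r) := ⟨_, rfl⟩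
  have hc'0 : 0 < c' := by rw [hc']; positivity
  have hc0 : 0 ≤ c := by
    have : 0 < lam - 1 := by linarith
    rw [hc]
    positivity
  have hη0 : 0 < η := by rw [hη]; positivity
  have hβ : (1 : ℝ) ≤ lam ^ 9 := one_le_pow₀ hlam.le
  have hrhs : ∀ (k : ℕ) (j : Fin r), 26 * (r : ℝ) * lam ^ (9 * (k : ℝ) / ((j : ℝ) + 1)) * ℓ * Λ /
      ((d : ℝ) * asymptoticGap lam ^ 2) = c' * ((lam ^ 9) ^ k) ^ (1 / ((j : ℝ) + 1)) := by
    intro k j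
    rw [← pow_mul, ← Real.rpow_natCast lam (9 * k), ← Real.rpow_mul hlam0.le, mul_one_div, hc']
    push_cast
    ring
  simp only [hrhs]
  have hone : ∀ (k : ℕ) (j : Fin r), 1 ≤ ((lam ^ 9) ^ k) ^ (1 / ((j : ℝ) + 1)) := fun k j =>
    Real.one_le_rpow (one_le_pow₀ hβ) (by positivity)
  have hsymm : ∀ ω, (W ω).IsSymm → (W ω + lam • (U ω * (U ω)ᵀ)).IsSymm := fun ω h =>
    h.add (by simp [Matrix.IsSymm])
  -- Overlap eigenvalues never exceed 1, so only c' < 1 needs work. That inequality also forces r to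
  -- be small compared with d.
  rcases le_or_gt 1 c' with h1c | hc1
  · refine one_sub_le_measureReal (N := ∅) hδ0.le (by simp) ?_
    filter_upwards [hW.symm, hU.mem] with ω hω hUω _ k hk j
    refine (hA.sortedEigenvalue_overlap_le_one hUω (seed ω) (hsymm ω hω)
      (Finset.mem_Icc.1 hk).2 j).trans ?_
    exact h1c.trans (le_mul_of_one_le_right hc'0.le (hone k j))
  have hsmall : (r : ℝ) ≤ d * asymptoticGap lam ^ 2 := by
    rw [hc', div_lt_one (by positivity)] at hc1
    have : (r : ℝ) ≤ 26 * r * ℓ * Λ := by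
      have h1 : 3 ≤ ℓ * Λ := by nlinarith
      nlinarith
    linarith
  have hrlam : lam * r ≤ (lam - 1) * d := by
    have h1 := hsmall.trans (mul_le_mul_of_nonneg_left (asymptoticGap_sq_le hlam) hd0.le)
    calc lam * r ≤ lam * (d * ((lam - 1) / lam)) := mul_le_mul_of_nonneg_left h1 hlam0.le
      _ = _ := by field_simp
  have hrd : r ≤ d := by
    have : (r : ℝ) ≤ d := by nlinarith
    exact_mod_cast this
  have hTd : T ≤ d := by
    obtain ⟨ω⟩ := μ.nonempty_of_neZero
    exact card_le_of_mem_stiefel (hA (seed ω) 0 Matrix.isSymm_zero)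
  have hgrid := grid_constants_le (r := r) hlam (one_le_two.trans hd2) hℓ hΛ hc hc'
  -- The cutoff on the round is part of the event, so later rounds contribute empty sets to the
  -- union bound.
  let bad : ℕ → (Fin r → Fin (2 * d + 1)) → Set Ω := fun i f =>
    {ω | 18 * (i + 1 : ℕ) * Real.log lam ≤ r * ℓ ∧
      lam ^ 9 * (A.seen (seed ω) (W ω + lam • (U ω * (U ω)ᵀ)) i (U ω *ᵥ gridVec f) +
        c * (gridVec f ⬝ᵥ gridVec f)) <
      A.seen (seed ω) (W ω + lam • (U ω * (U ω)ᵀ)) (i + 1) (U ω *ᵥ gridVec f)}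
  have hbad : ∀ i ∈ Finset.range T, ∀ f, μ (bad i f) ≤ ENNReal.ofReal η := by
    intro i hi f
    by_cases hk : 18 * (i + 1 : ℕ) * Real.log lam ≤ r * ℓ
    · refine (measure_mono fun ω hω => hω.2).trans (hA.measure_jump_le hlam hrlam (by omega) hW hU
        hWU hseed hindep (Nat.succ_le_of_lt (Finset.mem_range.1 hi)) hη0 (fun θ hθ => ?_) _)
      exact jump_tail_le hlam (one_le_two.trans hd2) hr hδ0 hδ1 hk (by linarith) hθ hη hc
    · have : bad i f = ∅ := Set.eq_empty_of_forall_notMem fun ω hω => hk hω.1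
      rw [this, measure_empty]
      exact zero_le
  refine one_sub_le_measureReal (N := ⋃ i ∈ Finset.range T, ⋃ f, bad i f) hδ0.le ?_ ?_
  · calc μ (⋃ i ∈ Finset.range T, ⋃ f, bad i f)
        ≤ ∑ i ∈ Finset.range T, ∑ f, μ (bad i f) :=
          (measure_biUnion_finset_le _ _).trans
            (Finset.sum_le_sum fun i _ => measure_iUnion_fintype_le _ _)
      _ ≤ ∑ i ∈ Finset.range T, ∑ _f : Fin r → Fin (2 * d + 1), ENNReal.ofReal η :=
          Finset.sum_le_sum fun i hi => Finset.sum_le_sum fun f _ => hbad i hi f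
      _ = ENNReal.ofReal (T * (((2 * d + 1) ^ r : ℕ) * η)) := by
          rw [ENNReal.ofReal_mul (by positivity), ENNReal.ofReal_mul (by positivity),
            ENNReal.ofReal_natCast, ENNReal.ofReal_natCast]
          simp only [Finset.sum_const, Finset.card_univ, Fintype.card_fun, Fintype.card_fin,
            Finset.card_range, nsmul_eq_mul]
      _ ≤ ENNReal.ofReal δ := by
          refine ENNReal.ofReal_le_ofReal ?_
          have hT : (T : ℝ) ≤ d := by exact_mod_cast hTd
          calc (T : ℝ) * (((2 * d + 1) ^ r : ℕ) * η) ≤ d * (((2 * d + 1) ^ r : ℕ) * η) :=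
                mul_le_mul_of_nonneg_right hT (by positivity)
            _ = δ := by
                rw [hη]
                push_cast
                field_simp
  filter_upwards [hW.symm, hU.mem] with ω hω hUω hωN k hk j
  have hkT := (Finset.mem_Icc.1 hk).2
  by_cases hbig : 1 ≤ c' * ((lam ^ 9) ^ k) ^ (1 / ((j : ℝ) + 1))
  · exact (hA.sortedEigenvalue_overlap_le_one hUω (seed ω) (hsymm ω hω) hkT j).trans hbig
  have hlog0 : 0 < Real.log lam := Real.log_pos hlam
  -- If the bound is below 1 then c' ≥ 1/d gives λ^(9k/(j+1)) ≤ d. Taking logarithms, with 2 log d ≤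
  -- ℓ and j + 1 ≤ r, yields the cutoff.
  have hk18 : 18 * k * Real.log lam ≤ r * ℓ := by
    have h1 : (d : ℝ)⁻¹ ≤ c' := by
      rw [hc', inv_eq_one_div, div_le_div_iff₀ hd0 (by positivity)]
      have h2 : 1 ≤ 26 * r * ℓ * Λ := by
        have h3 : 3 ≤ ℓ * Λ := by nlinarith
        have h4 : (1 : ℝ) ≤ r := by exact_mod_cast hr
        nlinarith
      have h3 : asymptoticGap lam ^ 2 ≤ 1 := pow_le_one₀ hg.le hg1.le
      nlinarith
    have h2 : ((lam ^ 9) ^ k) ^ (1 / ((j : ℝ) + 1)) ≤ d := by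
      have h3 := (mul_le_mul_of_nonneg_right h1 (zero_le_one.trans (hone k j))).trans
        (not_le.1 hbig).le
      rwa [inv_mul_le_iff₀ hd0, mul_one] at h3
    have h3 := Real.log_le_log (zero_lt_one.trans_le (hone k j)) h2
    rw [Real.log_rpow (by positivity), Real.log_pow, Real.log_pow, one_div_mul_eq_div,
      div_le_iff₀ (by positivity)] at h3
    have h4 : 2 * Real.log d ≤ ℓ := by
      rw [hℓdef, ← Nat.cast_two, ← Real.log_pow]
      refine Real.log_le_log (by positivity) ?_
      nlinarith [sq_nonneg (d : ℝ)]
    have h5 : (j : ℝ) + 1 ≤ r := by exact_mod_cast j.2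
    have h6 : 2 * Real.log d * (j + 1) ≤ ℓ * r := mul_le_mul h4 h5 (by positivity) (by linarith)
    push_cast at h3
    linarith
  refine hA.sortedEigenvalue_overlap_le hr hrd hUω (seed ω) (hsymm ω hω) hβ hc0 hc'0 hgrid hkT
    (fun i hi f => ?_) j
  by_contra hcon
  refine hωN (Set.mem_iUnion₂.2 ⟨i, Finset.mem_range.2 (hi.trans_le hkT),
    Set.mem_iUnion.2 ⟨f, ?_, not_le.1 hcon⟩⟩)
  refine le_trans ?_ hk18
  have : ((i + 1 : ℕ) : ℝ) ≤ k := by exact_mod_cast hi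
  gcongr
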